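/- Let $N\ge 2$ and $p>1$, and put $p^*=\frac{Np}{N-p}$ if $p<N$ and $p^*=+\infty$ if $p\ge N$. Let $V:\mathbb R^N\to\mathbb R$ be Lebesgue measurable and $A,g:\mathbb R^N\times\mathbb R\to\mathbb R$. A $\mathcal C^k$-Carathéodory function is a function $h:\mathbb R^N\times\mathbb R\to\mathbb R$ such that $h(\cdot,t)$ is measurable for all $t\in\mathbb R$ and $h(x,\cdot)$ is of class $\mathcal C^k$ for a.e. $x\in\mathbb R^N$. Write $B_R(x)=\{y\in\mathbb R^N:|y-x|<R\}$, $B_R=B_R(0)$, $A_t=\partial A/\partial t$ and $G(x,t)=\int_0^t g(x,s)\,ds$. For an open set $\Omega\subset\mathbb R^N$ let $W_V^{1,p}(\Omega)$ (respectively $W_{0,V}^{1,p}(\Omega)$) be the space of all $u\in W^{1,p}(\Omega)$ (respectively $u\in W^{1,p}_0(\Omega)$) with $\int_\Omega V|u|^p\,dx<+\infty$, with the norm $$\|u\|_{\Omega,V}=\Big(\int_\Omega|\nabla u|^p\,dx+\int_\Omega V(x)|u|^p\,dx\Big)^{1/p};$$ write $\|u\|_V$ for $\Omega=\mathbb R^N$.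 Let $X_\Omega=W_{0,V}^{1,p}(\Omega)\cap L^\infty(\Omega)$, whose elements are extended by $0$ to $\mathbb R^N$. Assume: - $(V_1)$ $\operatorname{ess\,inf}_{\mathbb R^N}V>0$; - $(V_2)$ $\lim_{|x|\to+\infty}\int_{B_1(x)}\frac{dy}{V(y)}=0$; - $(V_3)$ $\operatorname{ess\,sup}_{|x|\le\varrho}V(x)<+\infty$ for every $\varrho>0$; - $(h_0)$ $A$ is a $\mathcal C^1$-Carathéodory function; - $(h_1)$ $\sup_{|t|\le\rho}|A(\cdot,t)|\in L^\infty(\mathbb R^N)$ and $\sup_{|t|\le\rho}|A_t(\cdot,t)|\in L^\infty(\mathbb R^N)$ for every $\rho>0$; - $(h_2)$ there is $\alpha_0>0$ with $A(x,t)\ge\alpha_0$ for a.e. $x$ and all $t$; - $(h_3)$ there are $\mu>p$ and $\alpha_1>0$ with $(\mu-p)A(x,t)-A_t(x,t)t\ge\alpha_1A(x,t)$ for a.e. $x$ and all $t$; - $(h_4)$ there is $\alpha_2>0$ with $pA(x,t)+A_t(x,t)t\ge\alpha_2A(x,t)$ for a.e. $x$ and all $t$; - $(g_0)$ $g$ is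 a $\mathcal C^0$-Carathéodory function; - $(g_1)$ there are $a_1,a_2>0$ and $q$ with $p\le q<p^*$ such that $|g(x,t)|\le a_1|t|^{p-1}+a_2|t|^{q-1}$ for a.e. $x$ and all $t$; - $(g_2)$ there is a real number $\bar\alpha<\alpha_0/\tau_p^p$ such that $\lim_{t\to0}\frac{g(x,t)}{|t|^{p-2}t}=\bar\alpha$ uniformly for a.e. $x$, where $\alpha_0$ is as in $(h_2)$ and $\tau_p>0$ is the best constant in $|w|_{L^p(\mathbb R^N)}\le\tau_p\|w\|_V$ for all $w\in W_V^{1,p}(\mathbb R^N)$; - $(g_3)$ $0<\mu G(x,t)\le g(x,t)t$ for a.e. $x$ and all $t\ne0$, with $\mu$ as in $(h_3)$. For bounded $u,v\in W_V^{1,p}(\mathbb R^N)$ let $$\mathcal J(u)=\frac1p\int_{\mathbb R^N}A(x,u)|\nabla u|^p\,dx+\frac1p\int_{\mathbb R^N}V(x)|u|^p\,dx-\int_{\mathbb R^N}G(x,u)\,dx,$$ $$\langle d\mathcal J(u),v\rangle=\int_{\mathbb R^N}A(x,u)|\nabla u|^{p-2}\nabla u\cdot\nabla v\,dx+\frac1p\int_{\mathbb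 R^N}A_t(x,u)v|\nabla u|^p\,dx+\int_{\mathbb R^N}V(x)|u|^{p-2}uv\,dx-\int_{\mathbb R^N}g(x,u)v\,dx.$$ Let $(u_k)_{k\ge1}$ be a sequence of functions on $\mathbb R^N$ and $\alpha^*,\alpha^{**}\in\mathbb R$ constants such that, for every integer $k\ge1$: - $(i)$ $u_k\in X_{B_k}$, with $u_k=0$ in $\mathbb R^N\setminus B_k$; - $(ii)$ $\alpha^*\le\mathcal J(u_k)\le\alpha^{**}$; - $(iii)$ $\langle d\mathcal J(u_k),v\rangle=0$ for all $v\in X_{B_k}$. Let $u_\infty\in W_V^{1,p}(\mathbb R^N)$ be the weak limit in $W_V^{1,p}(\mathbb R^N)$ of $(u_k)_k$, or of a subsequence of it (then still denoted by $(u_k)_k$). Then $$u_k\to u_\infty\quad\text{strongly in }W_V^{1,p}(B_R)\quad\text{for all }R\ge1.$$ -/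

import Mathlib

open MeasureTheory Filter Set Metric
open scoped Topology ContDiff

namespace QuasilinearSchrodinger

/-- The Euclidean space `ℝ^N`. -/
abbrev RN (N : ℕ) : Type := EuclideanSpace ℝ (Fin N)

/-- `h : ℝ^N × ℝ → ℝ` is a `C^k`-Carathéodory function: `h(·,t)` is Lebesgue measurable for all `t`,
and `h(x,·)` is of class `C^k` for almost every `x`. -/
def IsCaratheodory {N : ℕ} (k : ℕ) (h : RN N → ℝ → ℝ) : Prop :=
  (∀ t : ℝ, AEMeasurable (fun x => h x t) volume) ∧
    ∀ᵐ x : RN N, ContDiff ℝ (k : WithTop ℕ∞) (h x)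

/-- `φ ∈ C_c^∞(Ω)`. -/
def IsTestFunction {N : ℕ} (Ω : Set (RN N)) (φ : RN N → ℝ) : Prop :=
  ContDiff ℝ ∞ φ ∧ HasCompactSupport φ ∧ tsupport φ ⊆ Ω

/-- `w` is a weak (distributional) gradient of `u` on `Ω`. -/
def IsWeakGradient {N : ℕ} (Ω : Set (RN N)) (u : RN N → ℝ) (w : RN N → RN N) : Prop :=
  LocallyIntegrableOn u Ω ∧ LocallyIntegrableOn w Ω ∧
    ∀ φ : RN N → ℝ, IsTestFunction Ω φ → ∀ e : RN N,
      ∫ x in Ω, u x * fderiv ℝ φ x e = -∫ x in Ω, φ x * inner ℝ (w x) e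

open Classical in
/-- The weak gradient `∇u` on `Ω` (unique up to null sets of an open `Ω`; `0` if there is none). -/
noncomputable def weakGradient {N : ℕ} (Ω : Set (RN N)) (u : RN N → ℝ) : RN N → RN N :=
  if h : ∃ w, IsWeakGradient Ω u w then h.choose else 0

/-- `u ∈ W^{1,p}(Ω)`. -/
def MemW {N : ℕ} (Ω : Set (RN N)) (p : ℝ) (u : RN N → ℝ) : Prop :=
  MemLp u (ENNReal.ofReal p) (volume.restrict Ω) ∧
    ∃ w, IsWeakGradient Ω u w ∧ MemLp w (ENNReal.ofReal p) (volume.restrict Ω)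

/-- The weighted norm `‖u‖_{Ω,V} = (∫_Ω |∇u|^p + ∫_Ω V |u|^p)^{1/p}`. -/
noncomputable def normV {N : ℕ} (Ω : Set (RN N)) (V : RN N → ℝ) (p : ℝ) (u : RN N → ℝ) : ℝ :=
  ((∫ x in Ω, ‖weakGradient Ω u x‖ ^ p) + ∫ x in Ω, V x * |u x| ^ p) ^ (1 / p)

/-- The standard Sobolev norm `‖u‖_Ω = (∫_Ω |∇u|^p + ∫_Ω |u|^p)^{1/p}`. -/
noncomputable def normW {N : ℕ} (Ω : Set (RN N)) (p : ℝ) (u : RN N → ℝ) : ℝ :=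
  ((∫ x in Ω, ‖weakGradient Ω u x‖ ^ p) + ∫ x in Ω, |u x| ^ p) ^ (1 / p)

/-- `u ∈ W_0^{1,p}(Ω)`, the closure of `C_c^∞(Ω)` in `W^{1,p}(Ω)`. -/
def MemW0 {N : ℕ} (Ω : Set (RN N)) (p : ℝ) (u : RN N → ℝ) : Prop :=
  MemW Ω p u ∧ ∀ ε : ℝ, 0 < ε → ∃ φ : RN N → ℝ, IsTestFunction Ω φ ∧ normW Ω p (u - φ) < ε

/-- `u ∈ W_V^{1,p}(Ω)`. -/
def MemWV {N : ℕ} (Ω : Set (RN N)) (V : RN N → ℝ) (p : ℝ) (u : RN N → ℝ) : Prop :=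
  MemW Ω p u ∧ IntegrableOn (fun x => V x * |u x| ^ p) Ω

/-- The constant `τ_p` of the embedding of `W_V^{1,p}(ℝ^N)` in `L^p(ℝ^N)`: the best `τ > 0` with
`|w|_p ≤ τ ‖w‖_V` for all `w`. Such `τ` exist as soon as `V` is bounded below by a positive constant
(any `τ ≥ c^{-1/p}` will do if `V ≥ c > 0`). -/
noncomputable def embeddingConstant {N : ℕ} (V : RN N → ℝ) (p : ℝ) : ℝ :=
  sInf {τ : ℝ | 0 < τ ∧ ∀ w : RN N → ℝ, MemWV univ V p w →
    (∫ x, |w x| ^ p) ^ (1 / p) ≤ τ * normV univ V p w}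

/-- `u : ℝ^N → ℝ` is the trivial extension, by `0` outside `Ω`, of an element of
`X_Ω = W_{0,V}^{1,p}(Ω) ∩ L^∞(Ω)`. -/
def MemXOn {N : ℕ} (Ω : Set (RN N)) (V : RN N → ℝ) (p : ℝ) (u : RN N → ℝ) : Prop :=
  MemW0 Ω p u ∧ IntegrableOn (fun x => V x * |u x| ^ p) Ω ∧
    MemLp u ⊤ (volume.restrict Ω) ∧ ∀ᵐ x : RN N, x ∉ Ω → u x = 0

/-- The functional
`J(u) = (1/p) ∫ A(x,u) |∇u|^p + (1/p) ∫ V |u|^p - ∫ G(x,u)`, with `G(x,t) = ∫_0^t g(x,s) ds`. -/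
noncomputable def energy {N : ℕ} (p : ℝ) (V : RN N → ℝ) (A g : RN N → ℝ → ℝ)
    (u : RN N → ℝ) : ℝ :=
  (1 / p) * (∫ x, A x (u x) * ‖weakGradient univ u x‖ ^ p)
    + (1 / p) * (∫ x, V x * |u x| ^ p)
    - ∫ x, ∫ s in (0 : ℝ)..(u x), g x s

/-- The differential `⟨dJ(u), v⟩` of the functional, with `A_t = ∂A/∂t`:
`∫ A(x,u) |∇u|^{p-2} ∇u·∇v + (1/p) ∫ A_t(x,u) v |∇u|^p + ∫ V |u|^{p-2} u v - ∫ g(x,u) v`. -/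
noncomputable def energyDifferential {N : ℕ} (p : ℝ) (V : RN N → ℝ) (A g : RN N → ℝ → ℝ)
    (u v : RN N → ℝ) : ℝ :=
  (∫ x, A x (u x) * ‖weakGradient univ u x‖ ^ (p - 2)
      * inner ℝ (weakGradient univ u x) (weakGradient univ v x))
    + (1 / p) * (∫ x, deriv (A x) (u x) * v x * ‖weakGradient univ u x‖ ^ p)
    + (∫ x, V x * |u x| ^ (p - 2) * u x * v x)
    - ∫ x, g x (u x) * v x

/-- `ℓ` is (an arbitrary extension to all functions of) an element of the dual space of
`W_V^{1,p}(Ω)`: it is linear and bounded on `W_V^{1,p}(Ω)`. -/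
def IsDualWV {N : ℕ} (Ω : Set (RN N)) (V : RN N → ℝ) (p : ℝ) (ℓ : (RN N → ℝ) → ℝ) : Prop :=
  (∀ v w : RN N → ℝ, MemWV Ω V p v → MemWV Ω V p w → ∀ a b : ℝ,
      ℓ (a • v + b • w) = a * ℓ v + b * ℓ w) ∧
    ∃ C : ℝ, ∀ w : RN N → ℝ, MemWV Ω V p w → |ℓ w| ≤ C * normV Ω V p w

/-- `u_n ⇀ u` weakly in `W_V^{1,p}(Ω)`. -/
def WeaklyConvergesWV {N : ℕ} (Ω : Set (RN N)) (V : RN N → ℝ) (p : ℝ)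
    (u : ℕ → RN N → ℝ) (uLim : RN N → ℝ) : Prop :=
  (∀ n, MemWV Ω V p (u n)) ∧ MemWV Ω V p uLim ∧
    ∀ ℓ : (RN N → ℝ) → ℝ, IsDualWV Ω V p ℓ → Tendsto (fun n => ℓ (u n)) atTop (𝓝 (ℓ uLim))

/-- `u_n → u` strongly in `W_V^{1,p}(Ω)`. -/
def StronglyConvergesWV {N : ℕ} (Ω : Set (RN N)) (V : RN N → ℝ) (p : ℝ)
    (u : ℕ → RN N → ℝ) (uLim : RN N → ℝ) : Prop :=
  (∀ n, MemWV Ω V p (u n)) ∧ MemWV Ω V p uLim ∧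
    Tendsto (fun n => normV Ω V p (u n - uLim)) atTop (𝓝 0)

/-- The critical Sobolev exponent `p^* = Np/(N-p)` if `p < N`, and `p^* = +∞` if `p ≥ N`. -/
noncomputable def criticalExponent (N : ℕ) (p : ℝ) : EReal :=
  if p < N then ((N * p / (N - p) : ℝ) : EReal) else ⊤

end QuasilinearSchrodinger

open QuasilinearSchrodinger

namespace QuasilinearSchrodinger

/-
The Ambrosetti–Rabinowitz condition and `(h_3)` turn the bound on the energies of the critical
points `u_k` into a bound in `W_V^{1,p}`. Testing with truncations of `u_k` and iterating as De
Giorgi does improves it to a uniform bound in `L^∞`, and Rellich's theorem gives `u_k → u_∞` almost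
everywhere along a subsequence. The obstruction to local strong convergence is the term
`A_t(x,u) v |∇u|^p`, which has the same growth in the gradient as the principal part. It is absorbed
by testing with `η F(u_k - u_∞)`, where `η` is a cutoff and `F` has exponential growth, so that
`F' - κ |F| ≥ 1` for a large `κ`. What remains is that the integral of the monotonicity gap
`(|∇u_k|^{p-2} ∇u_k - |∇u_∞|^{p-2} ∇u_∞) · (∇u_k - ∇u_∞)` tends to zero on every ball, and strict
monotonicity of the field `|ξ|^{p-2} ξ` upgrades this to strong convergence of the gradients.
-/

section WeakGradient

variable {N : ℕ} {Ω Ω' : Set (RN N)} {φ u v : RN N → ℝ} {w w' : RN N → RN N}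

namespace IsTestFunction

lemma mono (h : IsTestFunction Ω φ) (hΩ : Ω ⊆ Ω') : IsTestFunction Ω' φ :=
  ⟨h.1, h.2.1, h.2.2.trans hΩ⟩

lemma continuous (h : IsTestFunction Ω φ) : Continuous φ :=
  h.1.continuous

lemma continuous_fderiv_apply (h : IsTestFunction Ω φ) (e : RN N) :
    Continuous fun x => fderiv ℝ φ x e :=
  (h.1.continuous_fderiv (by simp)).clm_apply continuous_const

lemma hasCompactSupport_fderiv_apply (h : IsTestFunction Ω φ) (e : RN N) :
    HasCompactSupport fun x => fderiv ℝ φ x e :=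
  h.2.1.fderiv_apply ℝ e

lemma tsupport_fderiv_apply_subset (h : IsTestFunction Ω φ) (e : RN N) :
    tsupport (fun x => fderiv ℝ φ x e) ⊆ Ω :=
  (_root_.tsupport_fderiv_apply_subset ℝ e).trans h.2.2

lemma eq_zero_of_notMem (h : IsTestFunction Ω φ) {x : RN N} (hx : x ∉ Ω) : φ x = 0 :=
  image_eq_zero_of_notMem_tsupport fun hx' => hx (h.2.2 hx')

lemma fderiv_apply_eq_zero_of_notMem (h : IsTestFunction Ω φ) (e : RN N) {x : RN N}
    (hx : x ∉ Ω) : fderiv ℝ φ x e = 0 :=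
  image_eq_zero_of_notMem_tsupport (f := fun x => fderiv ℝ φ x e)
    fun hx' => hx (h.tsupport_fderiv_apply_subset e hx')

end IsTestFunction

lemma integrable_smul_of_tsupport_subset {X F : Type*} [TopologicalSpace X] [T2Space X]
    [MeasurableSpace X] [OpensMeasurableSpace X] {ν : Measure X} [NormedAddCommGroup F]
    [NormedSpace ℝ F] {s : Set X} {f : X → F} (hf : LocallyIntegrableOn f s ν) {ψ : X → ℝ}
    (hψ : Continuous ψ) (hc : HasCompactSupport ψ) (hs : tsupport ψ ⊆ s) :
    Integrable (fun x => ψ x • f x) ν := by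
  have hf' : IntegrableOn f (tsupport ψ) ν := hf.integrableOn_compact_subset hs hc
  refine (integrableOn_iff_integrable_of_support_subset ?_).1
    (hf'.continuousOn_smul hψ.continuousOn hc)
  exact (Function.support_smul_subset_left ψ f).trans (subset_tsupport ψ)

lemma integral_mul_inner_const {X E : Type*} [MeasurableSpace X] {ν : Measure X}
    [NormedAddCommGroup E] [InnerProductSpace ℝ E] [CompleteSpace E] {ψ : X → ℝ} {f : X → E}
    (h : Integrable (fun x => ψ x • f x) ν) (e : E) :
    ∫ x, ψ x * inner ℝ (f x) e ∂ν = inner ℝ (∫ x, ψ x • f x ∂ν) e := by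
  rw [real_inner_comm, ← integral_inner h]
  congr with x
  rw [real_inner_smul_right, real_inner_comm]

namespace IsWeakGradient

lemma mono (h : IsWeakGradient Ω' u w) (hΩ : Ω ⊆ Ω') : IsWeakGradient Ω u w := by
  refine ⟨h.1.mono_set hΩ, h.2.1.mono_set hΩ, fun φ hφ e => ?_⟩
  have hparts := h.2.2 φ (hφ.mono hΩ) e
  have hu : ∀ s ⊇ Ω, ∫ x in s, u x * fderiv ℝ φ x e = ∫ x, u x * fderiv ℝ φ x e := fun s hs =>
    setIntegral_eq_integral_of_forall_compl_eq_zero fun x hx => by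
      rw [hφ.fderiv_apply_eq_zero_of_notMem e fun hx' => hx (hs hx'), mul_zero]
  have hw : ∀ s ⊇ Ω, ∫ x in s, φ x * inner ℝ (w x) e = ∫ x, φ x * inner ℝ (w x) e := fun s hs =>
    setIntegral_eq_integral_of_forall_compl_eq_zero fun x hx => by
      rw [hφ.eq_zero_of_notMem fun hx' => hx (hs hx'), zero_mul]
  rwa [hu Ω subset_rfl, hw Ω subset_rfl, ← hu Ω' hΩ, ← hw Ω' hΩ]

lemma integrable_mul_fderiv (h : IsWeakGradient Ω u w) (hφ : IsTestFunction Ω φ) (e : RN N) :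
    Integrable fun x => u x * fderiv ℝ φ x e :=
  (integrable_smul_of_tsupport_subset h.1 (hφ.continuous_fderiv_apply e)
    (hφ.hasCompactSupport_fderiv_apply e) (hφ.tsupport_fderiv_apply_subset e)).congr
    (ae_of_all _ fun _ => mul_comm _ _)

lemma integrable_mul_inner (h : IsWeakGradient Ω u w) (hφ : IsTestFunction Ω φ) (e : RN N) :
    Integrable fun x => φ x * inner ℝ (w x) e :=
  ((integrable_smul_of_tsupport_subset h.2.1 hφ.continuous hφ.2.1 hφ.2.2).inner_const e).congr
    (ae_of_all _ fun _ => real_inner_smul_left _ _ _)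

lemma linear_combination (hu : IsWeakGradient Ω u w) (hv : IsWeakGradient Ω v w') (a b : ℝ) :
    IsWeakGradient Ω (a • u + b • v) (a • w + b • w') := by
  refine ⟨(hu.1.smul a).add (hv.1.smul b), (hu.2.1.smul a).add (hv.2.1.smul b),
    fun φ hφ e => ?_⟩
  have hleft : ∫ x in Ω, (a • u + b • v) x * fderiv ℝ φ x e
      = a * (∫ x in Ω, u x * fderiv ℝ φ x e) + b * ∫ x in Ω, v x * fderiv ℝ φ x e := by
    rw [← integral_const_mul, ← integral_const_mul,
      ← integral_add ((hu.integrable_mul_fderiv hφ e).integrableOn.const_mul a)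
        ((hv.integrable_mul_fderiv hφ e).integrableOn.const_mul b)]
    congr with x
    simp only [Pi.add_apply, Pi.smul_apply, smul_eq_mul]
    ring
  have hright : ∫ x in Ω, φ x * inner ℝ ((a • w + b • w') x) e
      = a * (∫ x in Ω, φ x * inner ℝ (w x) e) + b * ∫ x in Ω, φ x * inner ℝ (w' x) e := by
    rw [← integral_const_mul, ← integral_const_mul,
      ← integral_add ((hu.integrable_mul_inner hφ e).integrableOn.const_mul a)
        ((hv.integrable_mul_inner hφ e).integrableOn.const_mul b)]
    congr with x
    simp only [Pi.add_apply, Pi.smul_apply, inner_add_left, real_inner_smul_left]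
    ring
  rw [hleft, hright, hu.2.2 φ hφ e, hv.2.2 φ hφ e]
  ring

lemma sub (hu : IsWeakGradient Ω u w) (hv : IsWeakGradient Ω v w') :
    IsWeakGradient Ω (u - v) (w - w') := by
  simpa [sub_eq_add_neg] using hu.linear_combination hv 1 (-1)

lemma ae_unique (hΩ : IsOpen Ω) (hw : IsWeakGradient Ω u w) (hw' : IsWeakGradient Ω u w') :
    w =ᵐ[volume.restrict Ω] w' := by
  have hdiff : ∀ᵐ x : RN N, x ∈ Ω → w x - w' x = 0 := by
    refine hΩ.ae_eq_zero_of_integral_contDiff_smul_eq_zero (hw.2.1.sub hw'.2.1)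
      fun φ hφ hc hs => ext_inner_right ℝ fun e => ?_
    have hφ' : IsTestFunction Ω φ := ⟨hφ, hc, hs⟩
    have hInt := integrable_smul_of_tsupport_subset (hw.2.1.sub hw'.2.1) hφ.continuous hc hs
    calc inner ℝ (∫ x, φ x • (w x - w' x)) e
        = ∫ x in Ω, φ x * inner ℝ (w x) e - φ x * inner ℝ (w' x) e := by
          rw [setIntegral_eq_integral_of_forall_compl_eq_zero fun x hx => by
            simp [hφ'.eq_zero_of_notMem hx]]
          simpa only [Pi.sub_apply, inner_sub_left, mul_sub]
            using (integral_mul_inner_const hInt e).symm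
      _ = inner ℝ 0 e := by
          rw [integral_sub (hw.integrable_mul_inner hφ' e).integrableOn
            (hw'.integrable_mul_inner hφ' e).integrableOn, inner_zero_left, sub_eq_zero]
          exact neg_injective ((hw.2.2 φ hφ' e).symm.trans (hw'.2.2 φ hφ' e))
  rw [EventuallyEq, ae_restrict_iff' hΩ.measurableSet]
  exact hdiff.mono fun x hx hxΩ => sub_eq_zero.1 (hx hxΩ)

lemma weakGradient_ae_eq (hΩ : IsOpen Ω) (h : IsWeakGradient Ω u w) :
    weakGradient Ω u =ᵐ[volume.restrict Ω] w := by
  have hex : ∃ w, IsWeakGradient Ω u w := ⟨w, h⟩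
  have hspec : IsWeakGradient Ω u (weakGradient Ω u) := by
    rw [weakGradient, dif_pos hex]
    exact hex.choose_spec
  exact hspec.ae_unique hΩ h

lemma weakGradient_univ_ae_eq (h : IsWeakGradient univ u w) :
    weakGradient univ u =ᵐ[volume] w := by
  simpa using h.weakGradient_ae_eq isOpen_univ

end IsWeakGradient

lemma norm_gradient (φ : RN N → ℝ) (x : RN N) : ‖gradient φ x‖ = ‖fderiv ℝ φ x‖ := by
  simp [gradient]

lemma inner_gradient (φ : RN N → ℝ) (x e : RN N) :
    (inner ℝ (gradient φ x) e : ℝ) = fderiv ℝ φ x e := by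
  simp [gradient]

lemma continuous_gradient {n : WithTop ℕ∞} (h : ContDiff ℝ n φ) (hn : n ≠ 0) :
    Continuous (gradient φ) :=
  (InnerProductSpace.toDual ℝ (RN N)).symm.continuous.comp (h.continuous_fderiv hn)

lemma isWeakGradient_gradient (h : ContDiff ℝ 1 φ) : IsWeakGradient Ω φ (gradient φ) := by
  refine IsWeakGradient.mono ⟨h.continuous.locallyIntegrable.locallyIntegrableOn _,
    (continuous_gradient h one_ne_zero).locallyIntegrable.locallyIntegrableOn _, fun ψ hψ e => ?_⟩
    (subset_univ Ω)
  have hφ' : Continuous fun x => fderiv ℝ φ x e :=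
    (h.continuous_fderiv one_ne_zero).clm_apply continuous_const
  simp only [setIntegral_univ, inner_gradient, mul_comm (ψ _)]
  refine integral_mul_fderiv_eq_neg_fderiv_mul_of_integrable ?_ ?_ ?_
    (fun x _ => (h.differentiable one_ne_zero).differentiableAt)
    (fun x _ => (hψ.1.differentiable (by simp)).differentiableAt)
  · exact (hφ'.mul hψ.continuous).integrable_of_hasCompactSupport hψ.2.1.mul_left
  · exact (h.continuous.mul (hψ.continuous_fderiv_apply e)).integrable_of_hasCompactSupport
      (hψ.hasCompactSupport_fderiv_apply e).mul_left
  · exact (h.continuous.mul hψ.continuous).integrable_of_hasCompactSupport hψ.2.1.mul_left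

end WeakGradient

section LpLimits

lemma tendsto_integral_smul_of_tendsto_eLpNorm {α F ι : Type*} [MeasurableSpace α]
    {ν : Measure α} [NormedAddCommGroup F] [NormedSpace ℝ F] {l : Filter ι} {P Q : ENNReal}
    [ENNReal.HolderConjugate Q P] {f : ι → α → F} {f₀ : α → F} {h : α → ℝ}
    (hf : ∀ n, MemLp (f n) P ν) (hf₀ : MemLp f₀ P ν) (hh : MemLp h Q ν)
    (hlim : Tendsto (fun n => eLpNorm (f n - f₀) P ν) l (𝓝 0)) :
    Tendsto (fun n => ∫ x, h x • f n x ∂ν) l (𝓝 (∫ x, h x • f₀ x ∂ν)) := by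
  refine tendsto_integral_of_L1' _ (memLp_one_iff_integrable.1 (hf₀.smul hh)).1
    (Eventually.of_forall fun n => memLp_one_iff_integrable.1 ((hf n).smul hh)) ?_
  have hHolder : ∀ n, eLpNorm ((h • f n) - h • f₀) 1 ν
      ≤ eLpNorm h Q ν * eLpNorm (f n - f₀) P ν := fun n => by
    rw [← smul_sub]
    exact eLpNorm_smul_le_mul_eLpNorm ((hf n).sub hf₀).1 hh.1
  refine tendsto_of_tendsto_of_tendsto_of_le_of_le tendsto_const_nhds ?_ (fun _ => zero_le) hHolder
  simpa using ENNReal.Tendsto.const_mul hlim (Or.inr hh.2.ne) (a := eLpNorm h Q ν)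

lemma IsWeakGradient.of_tendsto_eLpNorm {N : ℕ} {P : ENNReal} (hP : 1 ≤ P) {ι : Type*}
    {l : Filter ι} [l.NeBot] {u : ι → RN N → ℝ} {w : ι → RN N → RN N} {u₀ : RN N → ℝ}
    {w₀ : RN N → RN N} (h : ∀ n, IsWeakGradient univ (u n) (w n)) (hu : ∀ n, MemLp (u n) P)
    (hw : ∀ n, MemLp (w n) P) (hu₀ : MemLp u₀ P) (hw₀ : MemLp w₀ P)
    (hul : Tendsto (fun n => eLpNorm (u n - u₀) P) l (𝓝 0))
    (hwl : Tendsto (fun n => eLpNorm (w n - w₀) P) l (𝓝 0)) :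
    IsWeakGradient univ u₀ w₀ := by
  refine ⟨(hu₀.locallyIntegrable hP).locallyIntegrableOn _,
    (hw₀.locallyIntegrable hP).locallyIntegrableOn _, fun φ hφ e => ?_⟩
  have : (ENNReal.conjExponent P).HolderConjugate P :=
    (ENNReal.HolderConjugate.conjExponent hP).symm
  have hφL := hφ.continuous.memLp_of_hasCompactSupport (μ := volume)
    (p := ENNReal.conjExponent P) hφ.2.1
  have hlim_u := tendsto_integral_smul_of_tendsto_eLpNorm (Q := ENNReal.conjExponent P) hu hu₀
    ((hφ.continuous_fderiv_apply e).memLp_of_hasCompactSupport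
      (hφ.hasCompactSupport_fderiv_apply e)) hul
  have hlim_w := ((tendsto_integral_smul_of_tendsto_eLpNorm hw hw₀ hφL hwl).inner (𝕜 := ℝ)
    (tendsto_const_nhds (x := e))).neg
  have hinner : ∀ f : RN N → RN N, MemLp f P →
      ∫ x, φ x * (inner ℝ (f x) e : ℝ) = inner ℝ (∫ x, φ x • f x) e := fun f hf =>
    integral_mul_inner_const (memLp_one_iff_integrable.1 (hf.smul hφL)) e
  have hparts : ∀ n, -(inner ℝ (∫ x, φ x • w n x) e : ℝ) = ∫ x, fderiv ℝ φ x e • u n x := by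
    intro n
    simpa only [setIntegral_univ, hinner _ (hw n), smul_eq_mul, mul_comm (u n _)]
      using ((h n).2.2 φ hφ e).symm
  simp only [hparts] at hlim_w
  simpa only [setIntegral_univ, hinner _ hw₀, smul_eq_mul, mul_comm (u₀ _)]
    using tendsto_nhds_unique hlim_u hlim_w

end LpLimits

section Mollification

-- Jensen's inequality for the probability measure `ν`, followed by Tonelli's theorem.
lemma eLpNorm_integral_le_of_ae_eLpNorm_le {X T F : Type*} [MeasurableSpace X]
    [MeasurableSpace T] [NormedAddCommGroup F] [NormedSpace ℝ F] {μ : Measure X} [SFinite μ]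
    {ν : Measure T} [IsProbabilityMeasure ν] {P : ENNReal} (hP : 1 ≤ P) (hP' : P ≠ ⊤)
    {H : X → T → F} (hH : AEStronglyMeasurable (Function.uncurry H) (μ.prod ν)) {K : ENNReal}
    (hK : ∀ᵐ t ∂ν, eLpNorm (fun x => H x t) P μ ≤ K) :
    eLpNorm (fun x => ∫ t, H x t ∂ν) P μ ≤ K := by
  have hP0 : P ≠ 0 := (one_pos.trans_le hP).ne'
  have hp0 : 0 < P.toReal := ENNReal.toReal_pos hP0 hP'
  have hle_iff : ∀ f : X → F,
      eLpNorm f P μ ≤ K ↔ ∫⁻ x, ‖f x‖ₑ ^ P.toReal ∂μ ≤ K ^ P.toReal := fun f => by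
    rw [eLpNorm_eq_lintegral_rpow_enorm_toReal hP0 hP', one_div, ENNReal.rpow_inv_le_iff hp0]
  have hJensen : ∀ᵐ x ∂μ, ‖∫ t, H x t ∂ν‖ₑ ^ P.toReal ≤ ∫⁻ t, ‖H x t‖ₑ ^ P.toReal ∂ν := by
    filter_upwards [hH.prodMk_left] with x hx
    have hmono := eLpNorm_le_eLpNorm_of_exponent_le hP hx
    rw [eLpNorm_one_eq_lintegral_enorm, eLpNorm_eq_lintegral_rpow_enorm_toReal hP0 hP', one_div,
      ENNReal.le_rpow_inv_iff hp0] at hmono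
    exact le_trans (by gcongr; exact enorm_integral_le_lintegral_enorm _) hmono
  rw [hle_iff]
  calc ∫⁻ x, ‖∫ t, H x t ∂ν‖ₑ ^ P.toReal ∂μ
      ≤ ∫⁻ x, ∫⁻ t, ‖H x t‖ₑ ^ P.toReal ∂ν ∂μ := lintegral_mono_ae hJensen
    _ = ∫⁻ t, ∫⁻ x, ‖H x t‖ₑ ^ P.toReal ∂μ ∂ν :=
        lintegral_lintegral_swap (hH.enorm.pow_const P.toReal)
    _ ≤ ∫⁻ _, K ^ P.toReal ∂ν := lintegral_mono_ae (hK.mono fun t ht => (hle_iff _).1 ht)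
    _ = K ^ P.toReal := by simp

lemma tendsto_eLpNorm_translate_sub {E F : Type*} [NormedAddCommGroup E] [MeasurableSpace E]
    [BorelSpace E] [ProperSpace E] {μ : Measure E} [μ.IsAddHaarMeasure] [NormedAddCommGroup F]
    {P : ENNReal} (hP : 1 ≤ P) (hP' : P ≠ ⊤) {f : E → F} (hf : MemLp f P μ) :
    Tendsto (fun t => eLpNorm (fun x => f (x - t) - f x) P μ) (𝓝 0) (𝓝 0) := by
  have : Fact (1 ≤ P) := ⟨hP⟩
  let τ : C(E, C(E, E)) := (ContinuousMap.mk (fun a : E × E => a.2 - a.1) (by fun_prop)).curry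
  have hτ : ∀ t, MeasurePreserving (τ t) μ μ := fun t => measurePreserving_sub_right _ t
  let T : E → Lp F P μ := fun t => Lp.compMeasurePreserving (τ t) (hτ t) (hf.toLp f)
  have hT : ∀ t, T t =ᵐ[μ] fun x => f (x - t) := fun t =>
    (Lp.coeFn_compMeasurePreserving _ (hτ t)).trans
      ((hτ t).quasiMeasurePreserving.ae_eq_comp hf.coeFn_toLp)
  have hT0 : T 0 = hf.toLp f := by
    rw [Lp.ext_iff]
    simpa using (hT 0).trans (by simpa using hf.coeFn_toLp.symm)
  have hcont : Continuous T := continuous_const.compMeasurePreservingLp τ.continuous hτ hP'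
  have hlim : Tendsto (fun t => edist (T t) (hf.toLp f)) (𝓝 0) (𝓝 0) := by
    simpa [hT0] using (hcont.tendsto 0).edist (tendsto_const_nhds (x := hf.toLp f))
  refine hlim.congr fun t => ?_
  rw [Lp.edist_def]
  exact eLpNorm_congr_ae ((hT t).sub hf.coeFn_toLp)

variable {N : ℕ} {F : Type*} [NormedAddCommGroup F] {ρ : ContDiffBump (0 : RN N)}

/-- The probability measure on `ℝ^N` whose density is the normalized bump function `ρ`. -/
noncomputable def bumpMeasure (ρ : ContDiffBump (0 : RN N)) : Measure (RN N) :=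
  volume.withDensity fun t => ENNReal.ofReal (ρ.normed volume t)

lemma measurable_ofReal_normed (ρ : ContDiffBump (0 : RN N)) :
    Measurable fun t => ENNReal.ofReal (ρ.normed volume t) :=
  ρ.continuous_normed.measurable.ennreal_ofReal

instance (ρ : ContDiffBump (0 : RN N)) : IsProbabilityMeasure (bumpMeasure ρ) := by
  refine ⟨?_⟩
  rw [bumpMeasure, withDensity_apply _ MeasurableSet.univ, setLIntegral_univ,
    ← ofReal_integral_eq_lintegral_ofReal ρ.integrable_normed (ae_of_all _ ρ.nonneg_normed),
    ρ.integral_normed, ENNReal.ofReal_one]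

lemma bumpMeasure_absolutelyContinuous : bumpMeasure ρ ≪ volume :=
  withDensity_absolutelyContinuous _ _

lemma ae_bumpMeasure_norm_lt_rOut : ∀ᵐ t ∂bumpMeasure ρ, ‖t‖ < ρ.rOut := by
  rw [bumpMeasure, ae_withDensity_iff (measurable_ofReal_normed ρ)]
  refine ae_of_all _ fun t ht => ?_
  have hmem : t ∈ Function.support (ρ.normed volume) := fun h => by simp [h] at ht
  simpa [ρ.support_normed_eq] using hmem

lemma eLpNorm_translate_sub_le_add {P : ENNReal} (hP : 1 ≤ P) {u φ : RN N → F}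
    (hu : AEStronglyMeasurable u) (hφ : AEStronglyMeasurable φ) (t : RN N) :
    eLpNorm (fun x => u (x - t) - u x) P
      ≤ eLpNorm (fun x => φ (x - t) - φ x) P + 2 * eLpNorm (φ - u) P := by
  have hshift := measurePreserving_sub_right (volume : Measure (RN N)) t
  have hdiff : AEStronglyMeasurable (φ - u) volume := hφ.sub hu
  have hφ' : AEStronglyMeasurable (fun x => φ (x - t) - φ x) volume :=
    (hφ.comp_measurePreserving hshift).sub hφ
  have hshift_diff := hdiff.comp_measurePreserving hshift
  have hsplit : (fun x => u (x - t) - u x)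
      = ((fun x => φ (x - t) - φ x) - (φ - u) ∘ fun x => x - t) + (φ - u) := by
    ext x
    simp
  rw [hsplit, two_mul, ← add_assoc]
  refine (eLpNorm_add_le (hφ'.sub hshift_diff) hdiff hP).trans ?_
  gcongr
  refine (eLpNorm_sub_le hφ' hshift_diff hP).trans_eq ?_
  rw [eLpNorm_comp_measurePreserving hdiff hshift]

variable [NormedSpace ℝ F]

lemma integral_bumpMeasure (f : RN N → F) :
    ∫ t, f t ∂bumpMeasure ρ = ∫ t, ρ.normed volume t • f t := by
  rw [bumpMeasure, integral_withDensity_eq_integral_toReal_smul (measurable_ofReal_normed ρ)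
    (ae_of_all _ fun _ => ENNReal.ofReal_lt_top)]
  simp [ENNReal.toReal_ofReal (ρ.nonneg_normed _)]

/-- The mollification `ρ ⋆ f`, where `ρ` is normalized to have integral `1`. -/
noncomputable def mollify (ρ : ContDiffBump (0 : RN N)) (f : RN N → F) (x : RN N) : F :=
  ∫ y, ρ.normed volume (x - y) • f y

lemma mollify_eq_convolution (ρ : ContDiffBump (0 : RN N)) (f : RN N → F) :
    mollify ρ f
      = convolution f (ρ.normed volume) (ContinuousLinearMap.lsmul ℝ ℝ).flip volume := rfl

lemma isTestFunction_normed_sub (ρ : ContDiffBump (0 : RN N)) (x : RN N) :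
    IsTestFunction univ fun y => ρ.normed volume (x - y) :=
  ⟨ρ.contDiff_normed.comp (contDiff_const.sub contDiff_id),
    ρ.hasCompactSupport_normed.comp_homeomorph (Homeomorph.subLeft x), subset_univ _⟩

lemma integrable_normed_sub_smul {f : RN N → F} (hf : LocallyIntegrable f) (x : RN N) :
    Integrable fun y => ρ.normed volume (x - y) • f y :=
  have hρ := isTestFunction_normed_sub ρ x
  integrable_smul_of_tsupport_subset (hf.locallyIntegrableOn univ) hρ.continuous hρ.2.1 hρ.2.2

lemma mollify_sub_eq_integral [CompleteSpace F] {f : RN N → F} (hf : LocallyIntegrable f)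
    (x : RN N) : mollify ρ f x - f x = ∫ t, f (x - t) - f x ∂bumpMeasure ρ := by
  have hInt : Integrable fun t => ρ.normed volume t • f (x - t) := by
    simpa using (integrable_normed_sub_smul (ρ := ρ) hf x).comp_sub_left x
  have hmollify : mollify ρ f x = ∫ t, ρ.normed volume t • f (x - t) := by
    rw [mollify, ← integral_sub_left_eq_self _ _ x]
    simp
  simp only [integral_bumpMeasure, smul_sub]
  rw [integral_sub hInt (ρ.integrable_normed.smul_const _), hmollify, integral_smul_const,
    ρ.integral_normed, one_smul]

lemma eLpNorm_mollify_sub_le_of_translate [CompleteSpace F] {P : ENNReal} (hP : 1 ≤ P)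
    (hP' : P ≠ ⊤) {f : RN N → F} (hf : LocallyIntegrable f) {K : ENNReal}
    (hK : ∀ t : RN N, ‖t‖ < ρ.rOut → eLpNorm (fun x => f (x - t) - f x) P ≤ K) :
    eLpNorm (mollify ρ f - f) P ≤ K := by
  have hmeas : AEStronglyMeasurable (Function.uncurry fun x t => f (x - t) - f x)
      (volume.prod (bumpMeasure ρ)) :=
    (hf.aestronglyMeasurable.comp_quasiMeasurePreserving
      ((quasiMeasurePreserving_sub_of_right_invariant volume volume).mono_left
        (Measure.AbsolutelyContinuous.rfl.prod bumpMeasure_absolutelyContinuous))).sub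
      hf.aestronglyMeasurable.comp_fst
  rw [show mollify ρ f - f = _ from funext (mollify_sub_eq_integral hf)]
  exact eLpNorm_integral_le_of_ae_eLpNorm_le hP hP' hmeas (ae_bumpMeasure_norm_lt_rOut.mono hK)

lemma contDiff_mollify {f : RN N → F} (hf : LocallyIntegrable f) :
    ContDiff ℝ ∞ (mollify ρ f) := by
  rw [mollify_eq_convolution]
  exact ρ.hasCompactSupport_normed.contDiff_convolution_right (n := (⊤ : ℕ∞)) _ hf ρ.contDiff_normed

lemma fderiv_mollify_apply {f : RN N → F} (hf : LocallyIntegrable f) (x e : RN N) :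
    fderiv ℝ (mollify ρ f) x e = ∫ y, fderiv ℝ (ρ.normed volume) (x - y) e • f y := by
  rw [mollify_eq_convolution, (ρ.hasCompactSupport_normed.hasFDerivAt_convolution_right _ hf
    ρ.contDiff_normed x).fderiv, convolution_precompR_apply _ hf
    (ρ.hasCompactSupport_normed.fderiv ℝ) (ρ.contDiff_normed.continuous_fderiv one_ne_zero)]
  rfl

lemma gradient_mollify {u : RN N → ℝ} {w : RN N → RN N} (h : IsWeakGradient univ u w) :
    gradient (mollify ρ u) = mollify ρ w := by
  ext1 x
  refine ext_inner_right ℝ fun e => ?_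
  have hderiv : ∀ y, fderiv ℝ (fun y => ρ.normed volume (x - y)) y e
      = -fderiv ℝ (ρ.normed volume) (x - y) e := fun y => by
    have hρ := (ρ.contDiff_normed (μ := volume) (n := 1)).differentiable one_ne_zero (x - y)
    have hcomp := hρ.hasFDerivAt.comp y ((hasFDerivAt_id y).const_sub x)
    calc fderiv ℝ (fun y => ρ.normed volume (x - y)) y e
        = (fderiv ℝ (ρ.normed volume) (x - y)).comp (-ContinuousLinearMap.id ℝ (RN N)) e :=
          congrArg (· e) hcomp.fderiv
      _ = -fderiv ℝ (ρ.normed volume) (x - y) e := by simp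
  have hparts := h.2.2 _ (isTestFunction_normed_sub ρ x) e
  simp only [setIntegral_univ, hderiv, mul_neg, integral_neg, neg_inj] at hparts
  rw [inner_gradient, fderiv_mollify_apply (locallyIntegrableOn_univ.1 h.1), mollify,
    ← integral_mul_inner_const (integrable_normed_sub_smul (locallyIntegrableOn_univ.1 h.2.1) x),
    ← hparts]
  simp only [smul_eq_mul, mul_comm]

/-- The bump function at `0` of inner radius `δ / 2` and outer radius `δ`. -/
noncomputable def bumpOfRadius (N : ℕ) (δ : ℝ) (hδ : 0 < δ) : ContDiffBump (0 : RN N) :=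
  ⟨δ / 2, δ, half_pos hδ, half_lt_self hδ⟩

lemma exists_contDiff_eLpNorm_sub_le {P : ENNReal} (hP : 1 ≤ P) (hP' : P ≠ ⊤) {u : RN N → ℝ}
    {w : RN N → RN N} (hu : MemLp u P) (hw : MemLp w P) (h : IsWeakGradient univ u w)
    {ε : ENNReal} (hε : 0 < ε) :
    ∃ φ : RN N → ℝ, ContDiff ℝ ∞ φ ∧ eLpNorm (φ - u) P ≤ ε ∧ eLpNorm (gradient φ - w) P ≤ ε := by
  have hsmall := ((tendsto_eLpNorm_translate_sub hP hP' hu).eventually (gt_mem_nhds hε)).and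
    ((tendsto_eLpNorm_translate_sub hP hP' hw).eventually (gt_mem_nhds hε))
  obtain ⟨δ, hδ, hball⟩ := Metric.eventually_nhds_iff.1 hsmall
  refine ⟨mollify (bumpOfRadius N δ hδ) u, contDiff_mollify (hu.locallyIntegrable hP), ?_, ?_⟩
  · exact eLpNorm_mollify_sub_le_of_translate hP hP' (hu.locallyIntegrable hP)
      fun t ht => (hball (y := t) (by rwa [dist_zero_right])).1.le
  · rw [gradient_mollify h]
    exact eLpNorm_mollify_sub_le_of_translate hP hP' (hw.locallyIntegrable hP)
      fun t ht => (hball (y := t) (by rwa [dist_zero_right])).2.le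

lemma translate_sub_eq_integral {u : RN N → ℝ} (hu : ContDiff ℝ 1 u) (x t : RN N) :
    u (x - t) - u x = ∫ s in Ioc (0 : ℝ) 1, -(inner ℝ (gradient u (x - s • t)) t : ℝ) := by
  have hcont : Continuous (gradient u) := continuous_gradient hu one_ne_zero
  have hderiv : ∀ s ∈ uIcc (0 : ℝ) 1,
      HasDerivAt (fun s : ℝ => u (x - s • t)) (-(inner ℝ (gradient u (x - s • t)) t)) s := by
    intro s _
    have hline : HasDerivAt (fun s : ℝ => x - s • t) (-t) s := by
      simpa using ((hasDerivAt_id s).smul_const t).const_sub x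
    rw [inner_gradient, ← map_neg]
    exact ((hu.differentiable one_ne_zero) _).hasFDerivAt.comp_hasDerivAt s hline
  have hftc := intervalIntegral.integral_eq_sub_of_hasDerivAt hderiv
    ((by fun_prop : Continuous _).intervalIntegrable _ _)
  rw [intervalIntegral.integral_of_le zero_le_one] at hftc
  simpa using hftc.symm

lemma eLpNorm_translate_sub_le_of_contDiff {P : ENNReal} (hP : 1 ≤ P) (hP' : P ≠ ⊤)
    {u : RN N → ℝ} (hu : ContDiff ℝ 1 u) (t : RN N) :
    eLpNorm (fun x => u (x - t) - u x) P ≤ ‖t‖ₑ * eLpNorm (gradient u) P := by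
  have hcont : Continuous (gradient u) := continuous_gradient hu one_ne_zero
  have : IsProbabilityMeasure (volume.restrict (Ioc (0 : ℝ) 1)) := ⟨by simp⟩
  simp only [translate_sub_eq_integral hu]
  refine eLpNorm_integral_le_of_ae_eLpNorm_le hP hP'
    (Continuous.aestronglyMeasurable (by simp only [Function.uncurry_def]; fun_prop))
    (ae_of_all _ fun s => ?_)
  have htranslate := eLpNorm_comp_measurePreserving (p := P) hcont.aestronglyMeasurable
    (measurePreserving_sub_right volume (s • t))
  rw [← htranslate, ← enorm_norm t, ← eLpNorm_const_smul]
  refine eLpNorm_mono fun x => ?_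
  rw [norm_neg, Pi.smul_apply, norm_smul, norm_norm, mul_comm]
  exact norm_inner_le_norm _ _

namespace IsWeakGradient

variable {u : RN N → ℝ} {w : RN N → RN N} {P : ENNReal}

lemma eLpNorm_translate_sub_le (h : IsWeakGradient univ u w) (hP : 1 ≤ P) (hP' : P ≠ ⊤)
    (hu : MemLp u P) (hw : MemLp w P) (t : RN N) :
    eLpNorm (fun x => u (x - t) - u x) P ≤ ‖t‖ₑ * eLpNorm w P := by
  refine ENNReal.le_of_forall_pos_le_add fun ε hε _ => ?_
  have hT : ‖t‖ₑ + 2 ≠ ⊤ := ENNReal.add_ne_top.2 ⟨enorm_ne_top, ENNReal.ofNat_ne_top⟩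
  obtain ⟨κ, hκ, hκ_mul⟩ : ∃ κ : ENNReal, 0 < κ ∧ κ * (‖t‖ₑ + 2) = ε :=
    ⟨ε / (‖t‖ₑ + 2), ENNReal.div_pos (by exact_mod_cast hε.ne') hT,
      ENNReal.div_mul_cancel (by simp) hT⟩
  obtain ⟨φ, hφ, hφu, hφw⟩ := exists_contDiff_eLpNorm_sub_le hP hP' hu hw h hκ
  have hφ1 : ContDiff ℝ 1 φ := hφ.of_le (by simp)
  have hgrad : eLpNorm (gradient φ) P ≤ κ + eLpNorm w P := by
    have hsum := eLpNorm_add_le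
      ((continuous_gradient hφ1 one_ne_zero).aestronglyMeasurable.sub hw.1) hw.1 hP
    rw [sub_add_cancel] at hsum
    exact hsum.trans (by gcongr)
  have hφt : eLpNorm (fun x => φ (x - t) - φ x) P ≤ ‖t‖ₑ * (κ + eLpNorm w P) :=
    (eLpNorm_translate_sub_le_of_contDiff hP hP' hφ1 t).trans (by gcongr)
  refine (eLpNorm_translate_sub_le_add hP hu.1 hφ.continuous.aestronglyMeasurable t).trans
    ((add_le_add hφt (mul_le_mul_right hφu 2)).trans_eq ?_)
  rw [← hκ_mul]
  ring

lemma eLpNorm_mollify_sub_le (h : IsWeakGradient univ u w) (hP : 1 ≤ P) (hP' : P ≠ ⊤)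
    (hu : MemLp u P) (hw : MemLp w P) :
    eLpNorm (mollify ρ u - u) P ≤ ENNReal.ofReal ρ.rOut * eLpNorm w P := by
  refine eLpNorm_mollify_sub_le_of_translate hP hP' (hu.locallyIntegrable hP) fun t ht => ?_
  refine (h.eLpNorm_translate_sub_le hP hP' hu hw t).trans ?_
  gcongr
  rw [← ofReal_norm]
  exact ENNReal.ofReal_le_ofReal ht.le

end IsWeakGradient

end Mollification

section LpReal

variable {α F : Type*} [MeasurableSpace α] {ν : Measure α} [NormedAddCommGroup F] {p : ℝ}

lemma integrable_norm_rpow_of_memLp (hp : 0 < p) {f : α → F}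
    (hf : MemLp f (ENNReal.ofReal p) ν) : Integrable (fun x => ‖f x‖ ^ p) ν := by
  simpa only [ENNReal.toReal_ofReal hp.le] using
    hf.integrable_norm_rpow (by simpa using hp) ENNReal.ofReal_ne_top

lemma eLpNorm_eq_ofReal_integral (hp : 0 < p) {f : α → F} (hf : MemLp f (ENNReal.ofReal p) ν) :
    eLpNorm f (ENNReal.ofReal p) ν = ENNReal.ofReal ((∫ x, ‖f x‖ ^ p ∂ν) ^ (1 / p)) := by
  rw [hf.eLpNorm_eq_integral_rpow_norm (by simpa using hp) ENNReal.ofReal_ne_top,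
    ENNReal.toReal_ofReal hp.le, one_div]

lemma toReal_eLpNorm_eq_integral (hp : 0 < p) {f : α → F} (hf : MemLp f (ENNReal.ofReal p) ν) :
    (eLpNorm f (ENNReal.ofReal p) ν).toReal = (∫ x, ‖f x‖ ^ p ∂ν) ^ (1 / p) := by
  rw [eLpNorm_eq_ofReal_integral hp hf, ENNReal.toReal_ofReal (by positivity)]

lemma tendsto_rpow_zero {ι : Type*} {l : Filter ι} (hp : 0 < p) {a : ι → ℝ}
    (h : Tendsto a l (𝓝 0)) : Tendsto (fun n => a n ^ p) l (𝓝 0) := by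
  simpa only [Real.zero_rpow hp.ne'] using h.rpow_const (p := p) (Or.inr hp.le)

variable {ι G : Type*} {l : Filter ι} [NormedAddCommGroup G] {P : ENNReal}

lemma tendsto_eLpNorm_zero_of_norm_le_mul {f : ι → α → F} {g : ι → α → G} {C : ℝ}
    (hfg : ∀ n x, ‖f n x‖ ≤ C * ‖g n x‖) (hg : Tendsto (fun n => eLpNorm (g n) P ν) l (𝓝 0)) :
    Tendsto (fun n => eLpNorm (f n) P ν) l (𝓝 0) := by
  have hCg : Tendsto (fun n => ENNReal.ofReal C * eLpNorm (g n) P ν) l (𝓝 0) := by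
    simpa only [mul_zero] using ENNReal.Tendsto.const_mul hg (Or.inr ENNReal.ofReal_ne_top)
  exact tendsto_of_tendsto_of_tendsto_of_le_of_le tendsto_const_nhds hCg (fun _ => zero_le)
    fun n => eLpNorm_le_mul_eLpNorm_of_ae_le_mul (ae_of_all _ (hfg n)) P

lemma tendsto_eLpNorm_add {f g : ι → α → F} (hP : 1 ≤ P)
    (hf : ∀ n, AEStronglyMeasurable (f n) ν) (hg : ∀ n, AEStronglyMeasurable (g n) ν)
    (hf0 : Tendsto (fun n => eLpNorm (f n) P ν) l (𝓝 0))
    (hg0 : Tendsto (fun n => eLpNorm (g n) P ν) l (𝓝 0)) :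
    Tendsto (fun n => eLpNorm (f n + g n) P ν) l (𝓝 0) :=
  tendsto_of_tendsto_of_tendsto_of_le_of_le tendsto_const_nhds
    (by simpa only [add_zero] using hf0.add hg0) (fun _ => zero_le)
    fun n => eLpNorm_add_le (hf n) (hg n) hP

lemma tendsto_eLpNorm_zero_of_dominated (hP : P ≠ ⊤) {f : ℕ → α → F} {g : α → G}
    (hf : ∀ n, AEStronglyMeasurable (f n) ν) (hg : MemLp g P ν)
    (hfg : ∀ n, ∀ᵐ x ∂ν, ‖f n x‖ ≤ ‖g x‖)
    (hlim : ∀ᵐ x ∂ν, Tendsto (fun n => f n x) atTop (𝓝 0)) :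
    Tendsto (fun n => eLpNorm (f n) P ν) atTop (𝓝 0) := by
  rcases eq_or_ne P 0 with rfl | hP0
  · simp
  have hpos : 0 < P.toReal := ENNReal.toReal_pos hP0 hP
  have hInt : Tendsto (fun n => ∫⁻ x, ‖f n x‖ₑ ^ P.toReal ∂ν) atTop (𝓝 (∫⁻ _, 0 ∂ν)) := by
    refine tendsto_lintegral_of_dominated_convergence' (fun x => ‖g x‖ₑ ^ P.toReal)
      (fun n => (hf n).enorm.pow_const _) (fun n => ?_)
      (lintegral_rpow_enorm_lt_top_of_eLpNorm_lt_top hP0 hP hg.2).ne ?_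
    · filter_upwards [hfg n] with x hx
      gcongr
      exact enorm_le_iff_norm_le.2 hx
    · filter_upwards [hlim] with x hx
      simpa [Function.comp_def, hpos] using
        (ENNReal.continuous_rpow_const (y := P.toReal).tendsto _).comp hx.enorm
  simp only [eLpNorm_eq_lintegral_rpow_enorm_toReal hP0 hP]
  simpa [Function.comp_def, hpos] using
    (ENNReal.continuous_rpow_const (y := P.toReal⁻¹).tendsto _).comp hInt

end LpReal

section SmoothApproximation

variable {N : ℕ} {Ω : Set (RN N)} {p : ℝ} {P : ENNReal} {u : RN N → ℝ} {w : RN N → RN N}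
  {φ : ℕ → RN N → ℝ} {F : ℝ → ℝ} {L C : ℝ} {η : RN N → ℝ}

/-- The smooth functions `φ n` approximate `u` in the Sobolev space `W^{1,P}(ℝ^N)`, where the weak
gradient of `u` is `w`. The almost everywhere convergence, which can always be achieved by passing
to a subsequence, is included because the chain rule needs it. -/
structure IsSmoothApprox (P : ENNReal) (u : RN N → ℝ) (w : RN N → RN N) (φ : ℕ → RN N → ℝ) :
    Prop where
  memLp : MemLp u P
  memLp_grad : MemLp w P
  smooth : ∀ n, ContDiff ℝ ∞ (φ n)
  tendsto : Tendsto (fun n => eLpNorm (φ n - u) P) atTop (𝓝 0)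
  tendsto_grad : Tendsto (fun n => eLpNorm (gradient (φ n) - w) P) atTop (𝓝 0)
  tendsto_ae : ∀ᵐ x, Tendsto (fun n => φ n x) atTop (𝓝 (u x))

lemma gradient_comp {f : RN N → ℝ} {x : RN N} (hf : DifferentiableAt ℝ f x)
    (hF : DifferentiableAt ℝ F (f x)) :
    gradient (fun y => F (f y)) x = deriv F (f x) • gradient f x := by
  have h : fderiv ℝ (fun y => F (f y)) x = deriv F (f x) • fderiv ℝ f x :=
    (hF.hasDerivAt.comp_hasFDerivAt x hf.hasFDerivAt).fderiv
  simp [gradient, h]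

lemma gradient_mul {f g : RN N → ℝ} {x : RN N} (hf : DifferentiableAt ℝ f x)
    (hg : DifferentiableAt ℝ g x) :
    gradient (fun y => f y * g y) x = f x • gradient g x + g x • gradient f x := by
  have h : fderiv ℝ (fun y => f y * g y) x = f x • fderiv ℝ g x + g x • fderiv ℝ f x :=
    (hf.hasFDerivAt.mul hg.hasFDerivAt).fderiv
  simp [gradient, h]

lemma abs_sub_le_of_abs_deriv_le (hF : Differentiable ℝ F) (hL : ∀ t, |deriv F t| ≤ L)
    (a b : ℝ) : |F a - F b| ≤ L * |a - b| :=
  convex_univ.norm_image_sub_le_of_norm_deriv_le (𝕜 := ℝ) (fun x _ => hF x) (fun x _ => hL x)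
    (mem_univ b) (mem_univ a)

namespace IsSmoothApprox

lemma exists_of_forall_eLpNorm_le (hP : P ≠ 0) (hu : MemLp u P) (hw : MemLp w P)
    {Q : (RN N → ℝ) → Prop} (hQ : ∀ φ, Q φ → ContDiff ℝ ∞ φ)
    (h : ∀ ε : ENNReal, 0 < ε →
      ∃ φ, Q φ ∧ eLpNorm (φ - u) P ≤ ε ∧ eLpNorm (gradient φ - w) P ≤ ε) :
    ∃ φ : ℕ → RN N → ℝ, (∀ n, Q (φ n)) ∧ IsSmoothApprox P u w φ := by
  obtain ⟨ε, -, hε, hε0⟩ := exists_seq_strictAnti_tendsto' (zero_lt_one' ENNReal)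
  choose φ hφ hφu hφw using fun n => h (ε n) (hε n).1
  have htends {a : ℕ → ENNReal} (ha : ∀ n, a n ≤ ε n) : Tendsto a atTop (𝓝 0) :=
    tendsto_of_tendsto_of_tendsto_of_le_of_le tendsto_const_nhds hε0 (fun _ => zero_le) ha
  obtain ⟨σ, hσ, hae⟩ := (tendstoInMeasure_of_tendsto_eLpNorm hP
    (fun n => (hQ _ (hφ n)).continuous.aestronglyMeasurable) hu.1
    (htends hφu)).exists_seq_tendsto_ae
  exact ⟨fun n => φ (σ n), fun n => hφ _, hu, hw, fun n => hQ _ (hφ _),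
    (htends hφu).comp hσ.tendsto_atTop, (htends hφw).comp hσ.tendsto_atTop, hae⟩

lemma exists_of_isWeakGradient (hP : 1 ≤ P) (hP' : P ≠ ⊤) (hu : MemLp u P) (hw : MemLp w P)
    (h : IsWeakGradient univ u w) : ∃ φ, IsSmoothApprox P u w φ := by
  obtain ⟨φ, -, hφ⟩ := exists_of_forall_eLpNorm_le (one_pos.trans_le hP).ne' hu hw (fun _ => id)
    fun ε hε => exists_contDiff_eLpNorm_sub_le hP hP' hu hw h hε
  exact ⟨φ, hφ⟩

lemma aestronglyMeasurable_gradient (h : IsSmoothApprox P u w φ) (n : ℕ) :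
    AEStronglyMeasurable (gradient (φ n)) volume :=
  (continuous_gradient (h.smooth n) (by simp)).aestronglyMeasurable

lemma isWeakGradient (h : IsSmoothApprox P u w φ) (hP : 1 ≤ P) : IsWeakGradient univ u w := by
  obtain ⟨n₀, hn₀⟩ := eventually_atTop.1
    ((h.tendsto.eventually (gt_mem_nhds one_pos)).and
      (h.tendsto_grad.eventually (gt_mem_nhds one_pos)))
  have hshift := tendsto_add_atTop_nat n₀
  refine IsWeakGradient.of_tendsto_eLpNorm hP
    (fun n => isWeakGradient_gradient ((h.smooth (n + n₀)).of_le (by simp)))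
    (fun n => ?_) (fun n => ?_) h.memLp h.memLp_grad
    (h.tendsto.comp hshift) (h.tendsto_grad.comp hshift)
  · have hsub : MemLp (φ (n + n₀) - u) P :=
      ⟨(h.smooth _).continuous.aestronglyMeasurable.sub h.memLp.1,
        (hn₀ _ le_add_self).1.trans ENNReal.one_lt_top⟩
    simpa only [sub_add_cancel] using hsub.add h.memLp
  · have hsub : MemLp (gradient (φ (n + n₀)) - w) P :=
      ⟨(h.aestronglyMeasurable_gradient _).sub h.memLp_grad.1,
        (hn₀ _ le_add_self).2.trans ENNReal.one_lt_top⟩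
    simpa only [sub_add_cancel] using hsub.add h.memLp_grad

lemma tendsto_deriv_comp_sub_smul (h : IsSmoothApprox P u w φ)
    (hP : P ≠ ⊤) (hF : Continuous (deriv F))
    (hL : ∀ t, |deriv F t| ≤ L) :
    Tendsto (fun n => eLpNorm (fun x => (deriv F (φ n x) - deriv F (u x)) • w x) P) atTop
      (𝓝 0) := by
  have hL0 : 0 ≤ L := (abs_nonneg _).trans (hL 0)
  refine tendsto_eLpNorm_zero_of_dominated hP (fun n => ?_) (h.memLp_grad.const_smul (L + L))
    (fun n => ae_of_all _ fun x => ?_) ?_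
  · exact ((hF.comp (h.smooth n).continuous).aestronglyMeasurable.sub
      (hF.comp_aestronglyMeasurable h.memLp.1)).smul h.memLp_grad.1
  · rw [Pi.smul_apply, norm_smul, norm_smul, Real.norm_of_nonneg (add_nonneg hL0 hL0)]
    gcongr
    exact (norm_sub_le _ _).trans (add_le_add (hL _) (hL _))
  · filter_upwards [h.tendsto_ae] with x hx
    simpa using (((hF.tendsto _).comp hx).sub_const (deriv F (u x))).smul_const (w x)

lemma comp (h : IsSmoothApprox P u w φ) (hP : 1 ≤ P) (hP' : P ≠ ⊤) (hF : ContDiff ℝ ∞ F)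
    (hF0 : F 0 = 0) (hL : ∀ t, |deriv F t| ≤ L) :
    IsSmoothApprox P (fun x => F (u x)) (fun x => deriv F (u x) • w x)
      (fun n x => F (φ n x)) := by
  have hFd : Differentiable ℝ F := hF.differentiable (by simp)
  have hF' : Continuous (deriv F) := hF.continuous_deriv (by simp)
  have hlip := abs_sub_le_of_abs_deriv_le hFd hL
  have hmeas : AEStronglyMeasurable (fun x => deriv F (u x)) volume :=
    hF'.comp_aestronglyMeasurable h.memLp.1
  refine ⟨?_, ?_, fun n => hF.comp (h.smooth n), ?_, ?_, ?_⟩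
  · refine h.memLp.of_le_mul (c := L) (hF.continuous.comp_aestronglyMeasurable h.memLp.1)
      (ae_of_all _ fun x => ?_)
    simpa [hF0] using hlip (u x) 0
  · refine h.memLp_grad.of_le_mul (c := L) (hmeas.smul h.memLp_grad.1) (ae_of_all _ fun x => ?_)
    rw [norm_smul]
    gcongr
    exact hL _
  · exact tendsto_eLpNorm_zero_of_norm_le_mul (fun n x => hlip (φ n x) (u x)) h.tendsto
  · have hsplit (n : ℕ) : gradient (fun x => F (φ n x)) - (fun x => deriv F (u x) • w x)
        = (fun x => deriv F (φ n x) • (gradient (φ n) - w) x)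
          + fun x => (deriv F (φ n x) - deriv F (u x)) • w x := by
      ext1 x
      simp only [Pi.sub_apply, Pi.add_apply]
      rw [gradient_comp ((h.smooth n).differentiable (by simp) x) (hFd _)]
      module
    have hmeasφ (n : ℕ) : AEStronglyMeasurable (fun x => deriv F (φ n x)) volume :=
      (hF'.comp (h.smooth n).continuous).aestronglyMeasurable
    simp only [hsplit]
    refine tendsto_eLpNorm_add hP
      (fun n => (hmeasφ n).smul ((h.aestronglyMeasurable_gradient n).sub h.memLp_grad.1))
      (fun n => ((hmeasφ n).sub hmeas).smul h.memLp_grad.1)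
      (tendsto_eLpNorm_zero_of_norm_le_mul (C := L) (fun n x => ?_) h.tendsto_grad)
      (h.tendsto_deriv_comp_sub_smul hP' hF' hL)
    rw [norm_smul]
    gcongr
    exact hL _
  · filter_upwards [h.tendsto_ae] with x hx
    exact (hF.continuous.tendsto _).comp hx

lemma mul (h : IsSmoothApprox P u w φ) (hP : 1 ≤ P) (hη : ContDiff ℝ ∞ η)
    (hηC : ∀ x, |η x| ≤ C) (hηC' : ∀ x, ‖gradient η x‖ ≤ C) :
    IsSmoothApprox P (fun x => η x * u x) (fun x => η x • w x + u x • gradient η x)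
      (fun n x => η x * φ n x) := by
  have mη : AEStronglyMeasurable η volume := hη.continuous.aestronglyMeasurable
  have mη' : AEStronglyMeasurable (gradient η) volume :=
    (continuous_gradient hη (by simp)).aestronglyMeasurable
  have hmul (a : ℝ) (x : RN N) : ‖a • gradient η x‖ ≤ C * ‖a‖ := by
    rw [norm_smul, mul_comm]
    gcongr
    exact hηC' x
  have hsmul (v : RN N) (x : RN N) : ‖η x • v‖ ≤ C * ‖v‖ := by
    rw [norm_smul]
    gcongr
    exact hηC x
  refine ⟨?_, ?_, fun n => hη.mul (h.smooth n), ?_, ?_, ?_⟩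
  · refine h.memLp.of_le_mul (c := C) (mη.mul h.memLp.1) (ae_of_all _ fun x => ?_)
    rw [norm_mul]
    gcongr
    exact hηC x
  · exact (h.memLp_grad.of_le_mul (mη.smul h.memLp_grad.1) (ae_of_all _ fun x => hsmul _ x)).add
      (h.memLp.of_le_mul (h.memLp.1.smul mη') (ae_of_all _ fun x => hmul _ x))
  · refine tendsto_eLpNorm_zero_of_norm_le_mul (C := C) (fun n x => ?_) h.tendsto
    simp only [Pi.sub_apply]
    rw [← mul_sub, norm_mul]
    gcongr
    exact hηC x
  · have hsplit (n : ℕ) : gradient (fun x => η x * φ n x)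
          - (fun x => η x • w x + u x • gradient η x)
        = (fun x => η x • (gradient (φ n) - w) x) + fun x => (φ n - u) x • gradient η x := by
      ext1 x
      simp only [Pi.sub_apply, Pi.add_apply]
      rw [gradient_mul (hη.differentiable (by simp) x)
        ((h.smooth n).differentiable (by simp) x)]
      module
    simp only [hsplit]
    exact tendsto_eLpNorm_add hP
      (fun n => mη.smul ((h.aestronglyMeasurable_gradient n).sub h.memLp_grad.1))
      (fun n => ((h.smooth n).continuous.aestronglyMeasurable.sub h.memLp.1).smul mη')
      (tendsto_eLpNorm_zero_of_norm_le_mul (fun n x => hsmul _ x) h.tendsto_grad)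
      (tendsto_eLpNorm_zero_of_norm_le_mul (fun n x => hmul _ x) h.tendsto)
  · filter_upwards [h.tendsto_ae] with x hx
    exact hx.const_mul (η x)

end IsSmoothApprox

section Norms

variable {V : RN N → ℝ} {c : ℝ}

lemma MemW.isWeakGradient_weakGradient (h : MemW Ω p u) :
    IsWeakGradient Ω u (weakGradient Ω u) := by
  have hex : ∃ w, IsWeakGradient Ω u w := ⟨_, h.2.choose_spec.1⟩
  rw [weakGradient, dif_pos hex]
  exact hex.choose_spec

lemma MemW.memLp_weakGradient (h : MemW Ω p u) (hΩ : IsOpen Ω) :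
    MemLp (weakGradient Ω u) (ENNReal.ofReal p) (volume.restrict Ω) := by
  obtain ⟨-, w, hw, hwp⟩ := h
  exact hwp.ae_eq (hw.weakGradient_ae_eq hΩ).symm

lemma normW_eq_normV_one : normW Ω p u = normV Ω 1 p u := by
  simp [normW, normV]

lemma MemW.memWV_one (h : MemW Ω p u) (hp : 0 < p) : MemWV Ω 1 p u :=
  ⟨h, by simpa [IntegrableOn] using integrable_norm_rpow_of_memLp hp h.1⟩

lemma MemWV.toReal_eLpNorm_weakGradient_le_normV (h : MemWV Ω V p u) (hp : 0 < p)
    (hΩ : IsOpen Ω) (hV : ∀ᵐ x ∂volume.restrict Ω, 0 ≤ V x) :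
    (eLpNorm (weakGradient Ω u) (ENNReal.ofReal p) (volume.restrict Ω)).toReal
      ≤ normV Ω V p u := by
  have hVu : 0 ≤ ∫ x in Ω, V x * |u x| ^ p := integral_nonneg_of_ae <| by
    filter_upwards [hV] with x hx
    exact mul_nonneg hx (by positivity)
  rw [toReal_eLpNorm_eq_integral hp (h.1.memLp_weakGradient hΩ), normV]
  gcongr
  exact le_add_of_nonneg_right hVu

lemma MemWV.toReal_eLpNorm_le_normV (h : MemWV Ω V p u) (hp : 0 < p) (hc : 0 < c)
    (hV : ∀ᵐ x ∂volume.restrict Ω, c ≤ V x) :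
    (eLpNorm u (ENNReal.ofReal p) (volume.restrict Ω)).toReal
      ≤ (1 / c) ^ (1 / p) * normV Ω V p u := by
  have hcV : c * ∫ x in Ω, ‖u x‖ ^ p ≤ ∫ x in Ω, V x * |u x| ^ p := by
    rw [← integral_const_mul]
    refine integral_mono_ae ((integrable_norm_rpow_of_memLp hp h.1.1).const_mul c) h.2 ?_
    filter_upwards [hV] with x hx
    exact mul_le_mul_of_nonneg_right hx (by positivity)
  have hgrad : 0 ≤ ∫ x in Ω, ‖weakGradient Ω u x‖ ^ p := by positivity
  have hu : 0 ≤ ∫ x in Ω, ‖u x‖ ^ p := by positivity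
  rw [toReal_eLpNorm_eq_integral hp h.1.1, normV, ← Real.mul_rpow (by positivity) (by nlinarith)]
  gcongr
  rw [one_div, inv_mul_eq_div, le_div_iff₀ hc]
  linarith

lemma normW_le_add_toReal_eLpNorm (hp : 1 ≤ p) (hΩ : IsOpen Ω)
    (hu : MemLp u (ENNReal.ofReal p) (volume.restrict Ω)) (hw : IsWeakGradient Ω u w)
    (hwp : MemLp w (ENNReal.ofReal p) (volume.restrict Ω)) :
    normW Ω p u ≤ (eLpNorm w (ENNReal.ofReal p) (volume.restrict Ω)).toReal
      + (eLpNorm u (ENNReal.ofReal p) (volume.restrict Ω)).toReal := by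
  have hp0 : 0 < p := by linarith
  have hgrad : ∫ x in Ω, ‖weakGradient Ω u x‖ ^ p = ∫ x in Ω, ‖w x‖ ^ p := integral_congr_ae <| by
    filter_upwards [hw.weakGradient_ae_eq hΩ] with x hx
    rw [hx]
  rw [normW, hgrad, toReal_eLpNorm_eq_integral hp0 hu, toReal_eLpNorm_eq_integral hp0 hwp]
  exact Real.rpow_add_le_add_rpow (by positivity) (by positivity) (by positivity)
    ((div_le_one hp0).2 hp)

end Norms

lemma IsTestFunction.memLp {φ : RN N → ℝ} (h : IsTestFunction Ω φ) : MemLp φ P :=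
  h.continuous.memLp_of_hasCompactSupport h.2.1

lemma IsTestFunction.gradient_eq_zero_of_notMem {φ : RN N → ℝ} (h : IsTestFunction Ω φ) {x : RN N}
    (hx : x ∉ Ω) : gradient φ x = 0 :=
  ext_inner_right ℝ fun e => by
    rw [inner_gradient, h.fderiv_apply_eq_zero_of_notMem e hx, inner_zero_left]

lemma IsTestFunction.hasCompactSupport_gradient {φ : RN N → ℝ} (h : IsTestFunction Ω φ) :
    HasCompactSupport (gradient φ) :=
  (h.2.1.fderiv ℝ).comp_left (map_zero (InnerProductSpace.toDual ℝ (RN N)).symm)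

lemma IsTestFunction.memLp_gradient {φ : RN N → ℝ} (h : IsTestFunction Ω φ) :
    MemLp (gradient φ) P :=
  (continuous_gradient h.1 (by simp)).memLp_of_hasCompactSupport h.hasCompactSupport_gradient

/-- `u`, extended by `0` outside `Ω`, belongs to `W_0^{1,p}(Ω)`, and its weak gradient on `ℝ^N`
is `w`. -/
def IsW0Gradient (Ω : Set (RN N)) (p : ℝ) (u : RN N → ℝ) (w : RN N → RN N) : Prop :=
  ∃ φ : ℕ → RN N → ℝ, (∀ n, IsTestFunction Ω (φ n)) ∧ IsSmoothApprox (ENNReal.ofReal p) u w φ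

namespace IsW0Gradient

lemma isWeakGradient (h : IsW0Gradient Ω p u w) (hp : 1 ≤ p) : IsWeakGradient univ u w :=
  h.choose_spec.2.isWeakGradient (by simpa using hp)

lemma memLp (h : IsW0Gradient Ω p u w) : MemLp u (ENNReal.ofReal p) :=
  h.choose_spec.2.memLp

lemma memLp_grad (h : IsW0Gradient Ω p u w) : MemLp w (ENNReal.ofReal p) :=
  h.choose_spec.2.memLp_grad

lemma comp (h : IsW0Gradient Ω p u w) (hp : 1 ≤ p) (hF : ContDiff ℝ ∞ F) (hF0 : F 0 = 0)
    (hL : ∀ t, |deriv F t| ≤ L) :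
    IsW0Gradient Ω p (fun x => F (u x)) (fun x => deriv F (u x) • w x) := by
  obtain ⟨φ, hφ, happrox⟩ := h
  refine ⟨_, fun n => ⟨hF.comp (hφ n).1, (hφ n).2.1.comp_left hF0, ?_⟩,
    happrox.comp (by simpa using hp) ENNReal.ofReal_ne_top hF hF0 hL⟩
  exact (closure_mono (Function.support_comp_subset hF0 (φ n))).trans (hφ n).2.2

lemma memW0 (h : IsW0Gradient Ω p u w) (hΩ : IsOpen Ω) (hp : 1 ≤ p) : MemW0 Ω p u := by
  have hw := (h.isWeakGradient hp).mono (subset_univ Ω)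
  obtain ⟨φ, hφ, happrox⟩ := h
  refine ⟨⟨happrox.memLp.restrict Ω, w, hw, happrox.memLp_grad.restrict Ω⟩, fun ε hε => ?_⟩
  have hlim : Tendsto (fun n => (eLpNorm (gradient (φ n) - w) (ENNReal.ofReal p)).toReal
      + (eLpNorm (φ n - u) (ENNReal.ofReal p)).toReal) atTop (𝓝 0) := by
    have h0 := ENNReal.tendsto_toReal ENNReal.zero_ne_top
    simpa using (h0.comp happrox.tendsto_grad).add (h0.comp happrox.tendsto)
  obtain ⟨n, hn⟩ := (hlim.eventually (gt_mem_nhds hε)).exists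
  have hsub := happrox.memLp.sub (hφ n).memLp
  have hsub' := happrox.memLp_grad.sub (hφ n).memLp_gradient
  refine ⟨φ n, hφ n, (normW_le_add_toReal_eLpNorm hp hΩ (hsub.restrict Ω)
    (hw.sub (isWeakGradient_gradient ((hφ n).1.of_le (by simp)))) (hsub'.restrict Ω)).trans_lt
      (lt_of_le_of_lt ?_ hn)⟩
  rw [eLpNorm_sub_comm (gradient (φ n)), eLpNorm_sub_comm (φ n)]
  exact add_le_add
    (ENNReal.toReal_mono hsub'.2.ne (eLpNorm_mono_measure _ Measure.restrict_le_self))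
    (ENNReal.toReal_mono hsub.2.ne (eLpNorm_mono_measure _ Measure.restrict_le_self))

lemma memXOn (h : IsW0Gradient Ω p u w) (hΩ : IsOpen Ω) (hp : 1 ≤ p) {V : RN N → ℝ}
    (hV : IntegrableOn (fun x => V x * |u x| ^ p) Ω) (hC : ∀ᵐ x, |u x| ≤ C)
    (h0 : ∀ᵐ x, x ∉ Ω → u x = 0) : MemXOn Ω V p u :=
  ⟨h.memW0 hΩ hp, hV, (memLp_top_of_bound h.memLp.1 C hC).restrict _, h0⟩

end IsW0Gradient

lemma IsSmoothApprox.isW0Gradient_mul_comp (h : IsSmoothApprox (ENNReal.ofReal p) u w φ)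
    (hp : 1 ≤ p) (hη : IsTestFunction Ω η) (hF : ContDiff ℝ ∞ F) (hF0 : F 0 = 0)
    (hL : ∀ t, |deriv F t| ≤ L) :
    IsW0Gradient Ω p (fun x => η x * F (u x))
      (fun x => η x • deriv F (u x) • w x + F (u x) • gradient η x) := by
  obtain ⟨C₁, hC₁⟩ := hη.2.1.exists_bound_of_continuous hη.continuous
  obtain ⟨C₂, hC₂⟩ := hη.hasCompactSupport_gradient.exists_bound_of_continuous
    (continuous_gradient hη.1 (by simp))
  have hP : 1 ≤ ENNReal.ofReal p := by simpa using hp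
  have hmul := (h.comp hP ENNReal.ofReal_ne_top hF hF0 hL).mul hP hη.1
    (fun x => (hC₁ x).trans (le_max_left C₁ C₂)) (fun x => (hC₂ x).trans (le_max_right C₁ C₂))
  exact ⟨_, fun n => ⟨hmul.smooth n, hη.2.1.mul_right, tsupport_mul_subset_left.trans hη.2.2⟩, hmul⟩

lemma MemW0.exists_eLpNorm_sub_le (h : MemW0 Ω p u) (hΩ : IsOpen Ω) (hp : 0 < p)
    (hw : IsWeakGradient Ω u w) {ε : ENNReal} (hε : 0 < ε) :
    ∃ φ, IsTestFunction Ω φ ∧ eLpNorm (φ - u) (ENNReal.ofReal p) (volume.restrict Ω) ≤ ε ∧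
      eLpNorm (gradient φ - w) (ENNReal.ofReal p) (volume.restrict Ω) ≤ ε := by
  obtain ⟨r, hr, hr0, hrε⟩ := ENNReal.lt_iff_exists_real_btwn.1 hε
  obtain ⟨φ, hφ, hnorm⟩ := h.2 r (ENNReal.ofReal_pos.1 hr0)
  have hφ' : IsWeakGradient Ω φ (gradient φ) := isWeakGradient_gradient (hφ.1.of_le (by simp))
  have hsub : MemW Ω p (u - φ) := by
    refine ⟨h.1.1.sub (hφ.memLp.restrict Ω), _,
      h.1.isWeakGradient_weakGradient.sub hφ', (h.1.memLp_weakGradient hΩ).sub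
        (hφ.memLp_gradient.restrict Ω)⟩
  have hle {t : ENNReal} (ht : t ≠ ⊤) (htn : t.toReal ≤ normV Ω 1 p (u - φ)) : t ≤ ε :=
    ((ENNReal.le_ofReal_iff_toReal_le ht hr).2
      (htn.trans (normW_eq_normV_one.symm.trans_le hnorm.le))).trans hrε.le
  refine ⟨φ, hφ, ?_, ?_⟩
  · rw [eLpNorm_sub_comm]
    refine hle hsub.1.2.ne ?_
    simpa using (hsub.memWV_one hp).toReal_eLpNorm_le_normV hp one_pos (by simp)
  · rw [eLpNorm_sub_comm, ← eLpNorm_congr_ae ((hw.sub hφ').weakGradient_ae_eq hΩ)]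
    exact hle (hsub.memLp_weakGradient hΩ).2.ne
      ((hsub.memWV_one hp).toReal_eLpNorm_weakGradient_le_normV hp hΩ (by simp))

lemma MemXOn.exists_isW0Gradient {V : RN N → ℝ} (h : MemXOn Ω V p u) (hΩ : IsOpen Ω)
    (hp : 1 ≤ p) : ∃ w, IsW0Gradient Ω p u w := by
  obtain ⟨hu0, -, -, h0⟩ := h
  obtain ⟨hu, w, hw, hwp⟩ := hu0.1
  have hu_ind : Ω.indicator u =ᵐ[volume] u := by
    filter_upwards [h0] with x hx
    exact indicator_apply_eq_self.2 hx
  refine ⟨Ω.indicator w, IsSmoothApprox.exists_of_forall_eLpNorm_le (by simp; linarith)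
    (((memLp_indicator_iff_restrict hΩ.measurableSet).2 hu).ae_eq hu_ind)
    ((memLp_indicator_iff_restrict hΩ.measurableSet).2 hwp) (fun φ hφ => hφ.1) fun ε hε => ?_⟩
  obtain ⟨φ, hφ, hφu, hφw⟩ := hu0.exists_eLpNorm_sub_le hΩ (by linarith) hw hε
  have hφ_ind : Ω.indicator φ = φ := indicator_eq_self.2 fun x hx => by
    by_contra hxΩ
    exact hx (hφ.eq_zero_of_notMem hxΩ)
  have hgrad_ind : Ω.indicator (gradient φ) = gradient φ := indicator_eq_self.2 fun x hx => by
    by_contra hxΩ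
    exact hx (hφ.gradient_eq_zero_of_notMem hxΩ)
  refine ⟨φ, hφ, ?_, ?_⟩
  · rwa [eLpNorm_congr_ae ((ae_eq_refl φ).sub hu_ind.symm), ← hφ_ind, ← indicator_sub',
      eLpNorm_indicator_eq_eLpNorm_restrict hΩ.measurableSet]
  · rwa [← hgrad_ind, ← indicator_sub',
      eLpNorm_indicator_eq_eLpNorm_restrict hΩ.measurableSet]

end SmoothApproximation

section Duality

variable {α G : Type*} [MeasurableSpace α] {ν : Measure α} [NormedAddCommGroup G]
  [InnerProductSpace ℝ G] {P Q : ENNReal} [ENNReal.HolderConjugate Q P] {f g : α → G}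

lemma eLpNorm_inner_le (hf : AEStronglyMeasurable f ν) (hg : AEStronglyMeasurable g ν) :
    eLpNorm (fun x => (inner ℝ (f x) (g x) : ℝ)) 1 ν ≤ eLpNorm f Q ν * eLpNorm g P ν := by
  simpa using eLpNorm_le_eLpNorm_mul_eLpNorm_of_nnnorm (p := Q) (q := P) (r := 1) hf hg
    (fun a b => (inner ℝ a b : ℝ)) 1 (ae_of_all _ fun x => by
      simpa using nnnorm_inner_le_nnnorm (𝕜 := ℝ) (f x) (g x))

lemma integrable_inner_of_memLp (hf : MemLp f Q ν) (hg : MemLp g P ν) :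
    Integrable (fun x => (inner ℝ (f x) (g x) : ℝ)) ν :=
  memLp_one_iff_integrable.1 ⟨hf.1.inner hg.1,
    (eLpNorm_inner_le hf.1 hg.1).trans_lt (ENNReal.mul_lt_top hf.2 hg.2)⟩

lemma abs_integral_inner_le (hf : MemLp f Q ν) (hg : MemLp g P ν) :
    |∫ x, (inner ℝ (f x) (g x) : ℝ) ∂ν| ≤ (eLpNorm f Q ν).toReal * (eLpNorm g P ν).toReal := by
  have henorm : ‖∫ x, (inner ℝ (f x) (g x) : ℝ) ∂ν‖ₑ ≤ eLpNorm f Q ν * eLpNorm g P ν :=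
    (enorm_integral_le_lintegral_enorm _).trans
      (eLpNorm_one_eq_lintegral_enorm.symm.trans_le (eLpNorm_inner_le hf.1 hg.1))
  simpa using ENNReal.toReal_mono (ENNReal.mul_ne_top hf.2.ne hg.2.ne) henorm

end Duality

section DualOfWV

variable {N : ℕ} {p c : ℝ} {Ω : Set (RN N)} {V : RN N → ℝ} {Q : ENNReal}
  [ENNReal.HolderConjugate Q (ENNReal.ofReal p)]

lemma isDualWV_integral_inner_weakGradient (hp : 0 < p) (hΩ : IsOpen Ω)
    (hV : ∀ᵐ x ∂volume.restrict Ω, 0 ≤ V x) {f : RN N → RN N}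
    (hf : MemLp f Q (volume.restrict Ω)) :
    IsDualWV Ω V p fun v => ∫ x in Ω, (inner ℝ (f x) (weakGradient Ω v x) : ℝ) := by
  refine ⟨fun v w hv hw a b => ?_, (eLpNorm f Q (volume.restrict Ω)).toReal, fun w hw => ?_⟩
  · rw [← integral_const_mul, ← integral_const_mul, ← integral_add
      ((integrable_inner_of_memLp hf (hv.1.memLp_weakGradient hΩ)).const_mul a)
      ((integrable_inner_of_memLp hf (hw.1.memLp_weakGradient hΩ)).const_mul b)]
    refine integral_congr_ae ?_
    filter_upwards [(hv.1.isWeakGradient_weakGradient.linear_combination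
      hw.1.isWeakGradient_weakGradient a b).weakGradient_ae_eq hΩ] with x hx
    simp [hx, inner_add_right, inner_smul_right]
  · refine (abs_integral_inner_le hf (hw.1.memLp_weakGradient hΩ)).trans ?_
    gcongr
    exact hw.toReal_eLpNorm_weakGradient_le_normV hp hΩ hV

lemma isDualWV_integral_inner (hp : 0 < p) (hc : 0 < c) (hV : ∀ᵐ x ∂volume.restrict Ω, c ≤ V x)
    {f : RN N → ℝ} (hf : MemLp f Q (volume.restrict Ω)) :
    IsDualWV Ω V p fun v => ∫ x in Ω, (inner ℝ (f x) (v x) : ℝ) := by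
  refine ⟨fun v w hv hw a b => ?_,
    (eLpNorm f Q (volume.restrict Ω)).toReal * (1 / c) ^ (1 / p), fun w hw => ?_⟩
  · rw [← integral_const_mul, ← integral_const_mul, ← integral_add
      ((integrable_inner_of_memLp hf hv.1.1).const_mul a)
      ((integrable_inner_of_memLp hf hw.1.1).const_mul b)]
    exact integral_congr_ae (ae_of_all _ fun x => by simp [add_mul, mul_assoc])
  · refine (abs_integral_inner_le hf hw.1.1).trans ?_
    rw [mul_assoc]
    gcongr
    exact hw.toReal_eLpNorm_le_normV hp hc hV

end DualOfWV

section Compactness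

variable {N : ℕ} {P : ENNReal}

lemma exists_isFiniteMeasure_le {α : Type*} [MeasurableSpace α] (μ : Measure α) [SigmaFinite μ] :
    ∃ ν : Measure α, IsFiniteMeasure ν ∧ ν ≤ μ ∧ μ ≪ ν := by
  obtain ⟨g, hg_pos, hg, hg_int⟩ := exists_pos_lintegral_lt_of_sigmaFinite μ one_ne_zero
  set f : α → ENNReal := fun x => min (g x) 1 with hf_def
  have hf : Measurable f := by fun_prop
  have hf_int : ∫⁻ x, f x ∂μ ≠ ⊤ :=
    ((lintegral_mono fun x => min_le_left _ _).trans_lt (hg_int.trans ENNReal.one_lt_top)).ne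
  have hf_ne : ∀ x, f x ≠ 0 := fun x => by simp [hf_def, (hg_pos x).ne']
  refine ⟨μ.withDensity f, isFiniteMeasure_withDensity hf_int, ?_,
    withDensity_absolutelyContinuous' hf.aemeasurable (ae_of_all _ hf_ne)⟩
  calc μ.withDensity f ≤ μ.withDensity 1 :=
        withDensity_mono (ae_of_all _ fun x => min_le_right _ _)
    _ = μ := withDensity_one

lemma mollify_eq_integral_inner (ρ : ContDiffBump (0 : RN N)) (f : RN N → ℝ) (x : RN N) :
    mollify ρ f x = ∫ y, (inner ℝ (ρ.normed volume (x - y)) (f y) : ℝ) := by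
  simp [mollify, mul_comm]

lemma abs_mollify_le {Q : ENNReal} [ENNReal.HolderConjugate Q P] (ρ : ContDiffBump (0 : RN N))
    {f : RN N → ℝ} (hf : MemLp f P) (x : RN N) :
    |mollify ρ f x| ≤ (eLpNorm (ρ.normed volume) Q).toReal * (eLpNorm f P).toReal := by
  have hnorm : eLpNorm (fun y => ρ.normed volume (x - y)) Q = eLpNorm (ρ.normed volume) Q :=
    eLpNorm_comp_measurePreserving (g := ρ.normed volume)
      ρ.continuous_normed.aestronglyMeasurable (Measure.measurePreserving_sub_left volume x)
  rw [mollify_eq_integral_inner, ← hnorm]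
  exact abs_integral_inner_le (isTestFunction_normed_sub ρ x).memLp hf

lemma tendsto_eLpNorm_mollify_zero (hP : 1 ≤ P) (hP' : P ≠ ⊤) {ν : Measure (RN N)}
    [IsFiniteMeasure ν] {ρ : ContDiffBump (0 : RN N)} {z : ℕ → RN N → ℝ} {K : ENNReal} (hK : K ≠ ⊤)
    (hz : ∀ n, MemLp (z n) P) (hzK : ∀ n, eLpNorm (z n) P ≤ K)
    (hlim : ∀ x, Tendsto (fun n => mollify ρ (z n) x) atTop (𝓝 0)) :
    Tendsto (fun n => eLpNorm (mollify ρ (z n)) P ν) atTop (𝓝 0) := by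
  have : (ENNReal.conjExponent P).HolderConjugate P :=
    (ENNReal.HolderConjugate.conjExponent hP).symm
  refine tendsto_eLpNorm_zero_of_dominated hP'
    (fun n => (contDiff_mollify ((hz n).locallyIntegrable hP)).continuous.aestronglyMeasurable)
    (memLp_const ((eLpNorm (ρ.normed volume) (ENNReal.conjExponent P)).toReal * K.toReal))
    (fun n => ae_of_all _ fun x => ?_) (ae_of_all _ hlim)
  rw [Real.norm_eq_abs]
  refine ((abs_mollify_le (Q := ENNReal.conjExponent P) ρ (hz n) x).trans ?_).trans (le_abs_self _)
  gcongr
  exact hzK n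

/- Weak convergence makes each fixed mollification of `z n` converge to `0`, while the gradient
bound makes `z n` uniformly close to its mollifications. -/
lemma tendsto_eLpNorm_zero_of_weakGradient_bounded (hP : 1 ≤ P) (hP' : P ≠ ⊤) {ν : Measure (RN N)}
    [IsFiniteMeasure ν] (hν : ν ≤ volume) {z : ℕ → RN N → ℝ} {w : ℕ → RN N → RN N} {K : ENNReal}
    (hK : K ≠ ⊤) (hzw : ∀ n, IsWeakGradient univ (z n) (w n)) (hz : ∀ n, MemLp (z n) P)
    (hw : ∀ n, MemLp (w n) P) (hzK : ∀ n, eLpNorm (z n) P ≤ K) (hwK : ∀ n, eLpNorm (w n) P ≤ K)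
    (hlim : ∀ ψ, IsTestFunction univ ψ → Tendsto (fun n => ∫ x, ψ x * z n x) atTop (𝓝 0)) :
    Tendsto (fun n => eLpNorm (z n) P ν) atTop (𝓝 0) := by
  refine ENNReal.tendsto_nhds_zero.2 fun ε hε => ?_
  obtain ⟨δ, hδε, hδ⟩ : ∃ δ : ℝ, ENNReal.ofReal δ * K < ε / 2 ∧ 0 < δ := by
    have hδ_lim : Tendsto (fun δ : ℝ => ENNReal.ofReal δ * K) (𝓝[>] 0) (𝓝 0) := by
      simpa using (ENNReal.Tendsto.mul_const (ENNReal.tendsto_ofReal tendsto_id)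
        (Or.inr hK)).mono_left (nhdsWithin_le_nhds (a := (0 : ℝ)))
    exact ((hδ_lim.eventually (gt_mem_nhds (ENNReal.half_pos hε.ne'))).and
      self_mem_nhdsWithin).exists
  let ρ := bumpOfRadius N δ hδ
  have hmollify := tendsto_eLpNorm_mollify_zero (ν := ν) hP hP' hK hz hzK
    fun x => hlim _ (isTestFunction_normed_sub ρ x)
  filter_upwards [(ENNReal.tendsto_nhds_zero.1 hmollify) (ε / 2) (ENNReal.half_pos hε.ne')]
    with n hn
  have hzν : AEStronglyMeasurable (z n) ν := (hz n).1.mono_ac hν.absolutelyContinuous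
  have hρν : AEStronglyMeasurable (mollify ρ (z n)) ν :=
    (contDiff_mollify ((hz n).locallyIntegrable hP)).continuous.aestronglyMeasurable
  calc eLpNorm (z n) P ν
      = eLpNorm (mollify ρ (z n) - (mollify ρ (z n) - z n)) P ν := by rw [sub_sub_cancel]
    _ ≤ eLpNorm (mollify ρ (z n)) P ν + eLpNorm (mollify ρ (z n) - z n) P ν :=
        eLpNorm_sub_le hρν (hρν.sub hzν) hP
    _ ≤ ε / 2 + ENNReal.ofReal δ * K := by
        gcongr
        refine (eLpNorm_mono_measure _ hν).trans <|
          ((hzw n).eLpNorm_mollify_sub_le hP hP' (hz n) (hw n)).trans ?_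
        gcongr
        · exact le_rfl
        · exact hwK n
    _ ≤ ε / 2 + ε / 2 := by gcongr
    _ = ε := ENNReal.add_halves ε

lemma exists_subseq_tendsto_ae_of_weakGradient_bounded (hP : 1 ≤ P) (hP' : P ≠ ⊤)
    {z : ℕ → RN N → ℝ} {w : ℕ → RN N → RN N} {K : ENNReal}
    (hK : K ≠ ⊤) (hzw : ∀ n, IsWeakGradient univ (z n) (w n)) (hz : ∀ n, MemLp (z n) P)
    (hw : ∀ n, MemLp (w n) P) (hzK : ∀ n, eLpNorm (z n) P ≤ K) (hwK : ∀ n, eLpNorm (w n) P ≤ K)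
    (hlim : ∀ ψ, IsTestFunction univ ψ → Tendsto (fun n => ∫ x, ψ x * z n x) atTop (𝓝 0)) :
    ∃ ns : ℕ → ℕ, StrictMono ns ∧ ∀ᵐ x, Tendsto (fun n => z (ns n) x) atTop (𝓝 0) := by
  obtain ⟨ν, hν_fin, hν_le, hν_ac⟩ := exists_isFiniteMeasure_le (volume : Measure (RN N))
  have hzν := tendsto_eLpNorm_zero_of_weakGradient_bounded hP hP' hν_le hK hzw hz hw hzK hwK hlim
  obtain ⟨ns, hns, hae⟩ := (tendstoInMeasure_of_tendsto_eLpNorm (zero_lt_one.trans_le hP).ne'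
    (g := 0) (fun n => (hz n).1.mono_ac hν_le.absolutelyContinuous) aestronglyMeasurable_zero
    (by simpa only [sub_zero] using hzν)).exists_seq_tendsto_ae
  exact ⟨ns, hns, hν_ac hae⟩

lemma WeaklyConvergesWV.tendsto_integral_test_mul_sub {p c : ℝ} (hp : 1 ≤ p) {V : RN N → ℝ}
    (hc : 0 < c) (hV : ∀ᵐ x, c ≤ V x) {u : ℕ → RN N → ℝ} {u₀ : RN N → ℝ}
    (h : WeaklyConvergesWV univ V p u u₀) {ψ : RN N → ℝ} (hψ : IsTestFunction univ ψ) :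
    Tendsto (fun n => ∫ x, ψ x * (u n - u₀) x) atTop (𝓝 0) := by
  obtain ⟨hu, hu₀, hlim⟩ := h
  let Q := ENNReal.conjExponent (ENNReal.ofReal p)
  have : Q.HolderConjugate (ENNReal.ofReal p) :=
    (ENNReal.HolderConjugate.conjExponent (by simpa using hp)).symm
  have hψQ : MemLp ψ Q (volume.restrict univ) := by
    rw [Measure.restrict_univ]
    exact hψ.memLp
  have hψlim := tendsto_sub_nhds_zero_iff.2 <| hlim _ <|
    isDualWV_integral_inner (by linarith) hc (by rwa [Measure.restrict_univ]) hψQ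
  refine hψlim.congr fun n => ?_
  rw [← integral_sub (integrable_inner_of_memLp hψQ (hu n).1.1)
    (integrable_inner_of_memLp hψQ hu₀.1.1), Measure.restrict_univ]
  exact integral_congr_ae (ae_of_all _ fun x => by simp; ring)

lemma WeaklyConvergesWV.exists_subseq_tendsto_ae {p c : ℝ} (hp : 1 ≤ p) {V : RN N → ℝ}
    (hc : 0 < c) (hV : ∀ᵐ x, c ≤ V x) {u : ℕ → RN N → ℝ} {u₀ : RN N → ℝ}
    (h : WeaklyConvergesWV univ V p u u₀) {K : ENNReal} (hK : K ≠ ⊤)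
    (hKu : ∀ n, eLpNorm (u n) (ENNReal.ofReal p) ≤ K)
    (hKw : ∀ n, eLpNorm (weakGradient univ (u n)) (ENNReal.ofReal p) ≤ K) :
    ∃ ns : ℕ → ℕ, StrictMono ns ∧ ∀ᵐ x, Tendsto (fun n => u (ns n) x) atTop (𝓝 (u₀ x)) := by
  have hP : 1 ≤ ENNReal.ofReal p := by simpa using hp
  have hmem : ∀ {v}, MemWV univ V p v → MemLp v (ENNReal.ofReal p) := fun hv => by
    simpa using hv.1.1
  have hgrad : ∀ {v}, MemWV univ V p v → MemLp (weakGradient univ v) (ENNReal.ofReal p) :=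
    fun hv => by simpa using hv.1.memLp_weakGradient isOpen_univ
  have hu := h.1
  have hu₀ := h.2.1
  set K' := K + (eLpNorm u₀ (ENNReal.ofReal p) + eLpNorm (weakGradient univ u₀) (ENNReal.ofReal p))
  have hK' : K' ≠ ⊤ := ENNReal.add_ne_top.2
    ⟨hK, ENNReal.add_ne_top.2 ⟨(hmem hu₀).2.ne, (hgrad hu₀).2.ne⟩⟩
  obtain ⟨ns, hns, hae⟩ := exists_subseq_tendsto_ae_of_weakGradient_bounded hP ENNReal.ofReal_ne_top
    hK' (fun n => (hu n).1.isWeakGradient_weakGradient.sub hu₀.1.isWeakGradient_weakGradient)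
    (fun n => (hmem (hu n)).sub (hmem hu₀)) (fun n => (hgrad (hu n)).sub (hgrad hu₀))
    (fun n => (eLpNorm_sub_le (hmem (hu n)).1 (hmem hu₀).1 hP).trans
      (add_le_add (hKu n) le_self_add))
    (fun n => (eLpNorm_sub_le (hgrad (hu n)).1 (hgrad hu₀).1 hP).trans
      (add_le_add (hKw n) le_add_self))
    fun ψ hψ => h.tendsto_integral_test_mul_sub hp hc hV hψ
  refine ⟨ns, hns, hae.mono fun x hx => ?_⟩
  exact tendsto_sub_nhds_zero_iff.1 hx

end Compactness

section Caratheodory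

section Superposition

variable {α : Type*} [MeasurableSpace α] {μ : Measure α} {h : α → ℝ → ℝ}

lemma aemeasurable_comp_simpleFunc (hm : ∀ t, AEMeasurable (fun x => h x t) μ)
    (s : SimpleFunc α ℝ) : AEMeasurable (fun x => h x (s x)) μ := by
  have hsum : (fun x => h x (s x))
      = fun x => ∑ t ∈ s.range, (s ⁻¹' {t}).indicator (fun y => h y t) x := by
    ext x
    rw [Finset.sum_eq_single_of_mem (s x) (s.mem_range_self x) fun t _ ht =>
      indicator_of_notMem (s := s ⁻¹' {t}) (fun hx => ht (mem_singleton_iff.1 hx).symm) _]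
    simp
  rw [hsum]
  exact Finset.aemeasurable_fun_sum _ fun t _ =>
    (hm t).indicator (s.measurableSet_preimage {t})

lemma aemeasurable_comp_of_ae_continuous (hm : ∀ t, AEMeasurable (fun x => h x t) μ)
    (hc : ∀ᵐ x ∂μ, Continuous (h x)) {u : α → ℝ} (hu : AEMeasurable u μ) :
    AEMeasurable (fun x => h x (u x)) μ := by
  have hv := hu.measurable_mk.stronglyMeasurable
  refine (aemeasurable_of_tendsto_metrizable_ae atTop
    (fun n => aemeasurable_comp_simpleFunc hm (hv.approx n)) ?_).congr
    (f := fun x => h x (hu.mk u x)) ?_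
  · filter_upwards [hc] with x hx
    exact (hx.tendsto _).comp (hv.tendsto_approx x)
  · filter_upwards [hu.ae_eq_mk] with x hx
    rw [hx]

end Superposition

namespace IsCaratheodory

variable {N k : ℕ} {h : RN N → ℝ → ℝ} {u : RN N → ℝ}

lemma ae_continuous (hh : IsCaratheodory k h) : ∀ᵐ x, Continuous (h x) :=
  hh.2.mono fun _ hx => hx.continuous

lemma ae_continuous_deriv (hh : IsCaratheodory 1 h) : ∀ᵐ x, Continuous (deriv (h x)) :=
  hh.2.mono fun _ hx => hx.continuous_deriv (by simp)

lemma aemeasurable_comp (hh : IsCaratheodory k h) (hu : AEMeasurable u) :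
    AEMeasurable fun x => h x (u x) :=
  aemeasurable_comp_of_ae_continuous hh.1 hh.ae_continuous hu

lemma aemeasurable_deriv (hh : IsCaratheodory 1 h) (t : ℝ) :
    AEMeasurable fun x => deriv (h x) t := by
  refine aemeasurable_of_tendsto_metrizable_ae atTop
    (f := fun (n : ℕ) x => ((1 : ℝ) / (n + 1))⁻¹ • (h x (t + 1 / (n + 1)) - h x t))
    (fun n => ((hh.1 (t + 1 / (n + 1))).sub (hh.1 t)).const_smul ((1 : ℝ) / (n + 1))⁻¹) ?_
  have hstep : Tendsto (fun n : ℕ => (1 : ℝ) / (n + 1)) atTop (𝓝[≠] 0) :=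
    tendsto_nhdsWithin_iff.2 ⟨tendsto_one_div_add_atTop_nhds_zero_nat,
      Eventually.of_forall fun n => Nat.one_div_pos_of_nat.ne'⟩
  filter_upwards [hh.2] with x hx
  exact (hx.differentiable (by simp) t).hasDerivAt.tendsto_slope_zero.comp hstep

lemma aemeasurable_deriv_comp (hh : IsCaratheodory 1 h) (hu : AEMeasurable u) :
    AEMeasurable fun x => deriv (h x) (u x) :=
  aemeasurable_comp_of_ae_continuous (h := fun x => deriv (h x)) hh.aemeasurable_deriv
    hh.ae_continuous_deriv hu

end IsCaratheodory

end Caratheodory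

section PLaplace

lemma rpow_sub_one_mul_self {p s : ℝ} (hp : 0 < p) (hs : 0 ≤ s) : s ^ (p - 1) * s = s ^ p := by
  rcases hs.eq_or_lt with rfl | h
  · rw [mul_zero, Real.zero_rpow hp.ne']
  · rw [← Real.rpow_add_one h.ne', sub_add_cancel]

lemma rpow_sub_two_mul_self {p s : ℝ} (hp : 1 < p) (hs : 0 ≤ s) :
    s ^ (p - 2) * s = s ^ (p - 1) := by
  rw [← rpow_sub_one_mul_self (sub_pos.2 hp) hs, sub_sub, one_add_one_eq_two]

lemma rpow_sub_rpow_mul_sub_nonneg {r s t : ℝ} (hr : 0 ≤ r) (hs : 0 ≤ s) (ht : 0 ≤ t) :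
    0 ≤ (s ^ r - t ^ r) * (s - t) := by
  rcases le_total s t with h | h
  · exact mul_nonneg_of_nonpos_of_nonpos
      (sub_nonpos.2 (Real.rpow_le_rpow hs h hr)) (sub_nonpos.2 h)
  · exact mul_nonneg (sub_nonneg.2 (Real.rpow_le_rpow ht h hr)) (sub_nonneg.2 h)

variable {E : Type*} [NormedAddCommGroup E] [InnerProductSpace ℝ E] {p : ℝ}

/-- The vector field `a ↦ |a|^{p-2} a` of the `p`-Laplacian. -/
noncomputable def pField (p : ℝ) (a : E) : E := ‖a‖ ^ (p - 2) • a

lemma norm_pField (hp : 1 < p) (a : E) : ‖pField p a‖ = ‖a‖ ^ (p - 1) := by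
  rw [pField, norm_smul, Real.norm_of_nonneg (by positivity),
    rpow_sub_two_mul_self hp (norm_nonneg _)]

lemma inner_pField_self (hp : 1 < p) (a : E) : (inner ℝ (pField p a) a : ℝ) = ‖a‖ ^ p := by
  rw [pField, inner_smul_left, real_inner_self_eq_norm_mul_norm, conj_trivial, ← mul_assoc,
    rpow_sub_two_mul_self hp (norm_nonneg _),
    rpow_sub_one_mul_self (zero_lt_one.trans hp) (norm_nonneg _)]

lemma continuous_pField (hp : 1 < p) : Continuous (pField p : E → E) := by
  refine continuous_iff_continuousAt.2 fun a => ?_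
  rcases eq_or_ne a 0 with rfl | h
  · have h_zero : pField p (0 : E) = 0 := smul_zero _
    rw [ContinuousAt, h_zero, tendsto_zero_iff_norm_tendsto_zero]
    simp only [norm_pField hp]
    exact tendsto_rpow_zero (sub_pos.2 hp) tendsto_norm_zero
  · exact (continuousAt_id.norm.rpow_const (Or.inl (norm_ne_zero_iff.2 h))).smul continuousAt_id

lemma pField_smul {r : ℝ} (hr : 0 < r) (a : E) :
    pField p (r • a) = r ^ (p - 1) • pField p a := by
  have hr_pow : r ^ (p - 2) * r = r ^ (p - 1) := by
    rw [← Real.rpow_add_one hr.ne', show p - 2 + 1 = p - 1 by ring]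
  rw [pField, pField, norm_smul, Real.norm_of_nonneg hr.le, Real.mul_rpow hr.le (norm_nonneg _),
    smul_smul, smul_smul, ← hr_pow, mul_right_comm]

/-- The monotonicity gap `(|a|^{p-2} a - |b|^{p-2} b) · (a - b)` of the vector field `pField`. -/
noncomputable def pGap (p : ℝ) (a b : E) : ℝ := inner ℝ (pField p a - pField p b) (a - b)

lemma continuous_pGap (hp : 1 < p) : Continuous fun z : E × E => pGap p z.1 z.2 := by
  have := continuous_pField (E := E) hp
  unfold pGap
  fun_prop

lemma pGap_eq (hp : 1 < p) (a b : E) :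
    pGap p a b = (‖a‖ ^ (p - 1) - ‖b‖ ^ (p - 1)) * (‖a‖ - ‖b‖)
      + (‖a‖ ^ (p - 2) + ‖b‖ ^ (p - 2)) * (‖a‖ * ‖b‖ - inner ℝ a b) := by
  have hp0 : 0 < p := zero_lt_one.trans hp
  rw [pGap, inner_sub_left, inner_sub_right, inner_sub_right, inner_pField_self hp,
    inner_pField_self hp, pField, pField, real_inner_smul_left, real_inner_smul_left,
    ← rpow_sub_one_mul_self hp0 (norm_nonneg a), ← rpow_sub_one_mul_self hp0 (norm_nonneg b),
    ← rpow_sub_two_mul_self hp (norm_nonneg a), ← rpow_sub_two_mul_self hp (norm_nonneg b),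
    real_inner_comm b a]
  ring

lemma inner_defect_nonneg (a b : E) :
    0 ≤ (‖a‖ ^ (p - 2) + ‖b‖ ^ (p - 2)) * (‖a‖ * ‖b‖ - inner ℝ a b) :=
  mul_nonneg (by positivity) (sub_nonneg.2 (real_inner_le_norm a b))

lemma pGap_nonneg (hp : 1 < p) (a b : E) : 0 ≤ pGap p a b := by
  rw [pGap_eq hp]
  exact add_nonneg (rpow_sub_rpow_mul_sub_nonneg (by linarith) (norm_nonneg a) (norm_nonneg b))
    (inner_defect_nonneg a b)

lemma eq_of_pGap_eq_zero (hp : 1 < p) {a b : E} (h : pGap p a b = 0) : a = b := by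
  rw [pGap_eq hp, add_eq_zero_iff_of_nonneg
    (rpow_sub_rpow_mul_sub_nonneg (by linarith) (norm_nonneg a) (norm_nonneg b))
    (inner_defect_nonneg a b)] at h
  have hnorm : ‖a‖ = ‖b‖ := by
    rcases mul_eq_zero.1 h.1 with hpow | hsub
    · exact (Real.rpow_left_inj (norm_nonneg _) (norm_nonneg _) (by linarith)).1
        (sub_eq_zero.1 hpow)
    · exact sub_eq_zero.1 hsub
  rcases eq_or_ne a 0 with rfl | ha
  · exact (norm_eq_zero.1 (hnorm.symm.trans norm_zero)).symm
  · have hpos : 0 < ‖a‖ ^ (p - 2) + ‖b‖ ^ (p - 2) := by positivity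
    have hinner : inner ℝ a b = ‖a‖ * ‖b‖ :=
      (sub_eq_zero.1 ((mul_eq_zero.1 h.2).resolve_left hpos.ne')).symm
    have hcollinear := inner_eq_norm_mul_iff_real.1 hinner
    rw [hnorm] at hcollinear
    exact smul_right_injective E (hnorm ▸ norm_ne_zero_iff.2 ha) hcollinear

lemma pGap_smul {r : ℝ} (hr : 0 < r) (a b : E) :
    pGap p (r • a) (r • b) = r ^ p * pGap p a b := by
  have hr_pow : r ^ (p - 1) * r = r ^ p := by rw [← Real.rpow_add_one hr.ne', sub_add_cancel]
  rw [pGap, pGap, pField_smul hr, pField_smul hr, ← smul_sub, ← smul_sub, real_inner_smul_left,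
    real_inner_smul_right, ← hr_pow, mul_assoc]

lemma exists_forall_le_add_mul_of_isCompact {X : Type*} [TopologicalSpace X] {K : Set X}
    (hK : IsCompact K) {f g : X → ℝ} (hf : Continuous f) (hg : Continuous g)
    (hg0 : ∀ x ∈ K, 0 ≤ g x) (hfg : ∀ x ∈ K, g x = 0 → f x ≤ 0) {ε : ℝ} (hε : 0 < ε) :
    ∃ C, 0 ≤ C ∧ ∀ x ∈ K, f x ≤ ε + C * g x := by
  have hpos : ∀ x ∈ K ∩ {x | ε ≤ f x}, 0 < g x := fun x hx =>
    (hg0 x hx.1).lt_of_ne' fun h => (hε.trans_le hx.2).not_ge (hfg x hx.1 h)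
  obtain ⟨C, hC⟩ := (hK.inter_right (isClosed_le continuous_const hf)).exists_bound_of_continuousOn
    (hf.continuousOn.div hg.continuousOn fun x hx => (hpos x hx).ne')
  refine ⟨max C 0, le_max_right _ _, fun x hx => ?_⟩
  rcases lt_or_ge (f x) ε with h | h
  · linarith [mul_nonneg (le_max_right C 0) (hg0 x hx)]
  · have hle : f x ≤ C * g x :=
      (div_le_iff₀ (hpos x ⟨hx, h⟩)).1 ((le_abs_self _).trans (hC x ⟨hx, h⟩))
    linarith [mul_le_mul_of_nonneg_right (le_max_left C 0) (hg0 x hx)]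

variable [FiniteDimensional ℝ E]

lemma isCompact_setOf_norm_rpow_add_eq_one (hp : 0 < p) :
    IsCompact {z : E × E | ‖z.1‖ ^ p + ‖z.2‖ ^ p = 1} := by
  have : ProperSpace E := FiniteDimensional.proper ℝ E
  have hclosed : IsClosed {z : E × E | ‖z.1‖ ^ p + ‖z.2‖ ^ p = 1} :=
    isClosed_eq ((continuous_fst.norm.rpow_const fun _ => Or.inr hp.le).add
      (continuous_snd.norm.rpow_const fun _ => Or.inr hp.le)) continuous_const
  refine (isCompact_closedBall (0 : E × E) 1).of_isClosed_subset hclosed fun z hz => ?_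
  have hle : ∀ {s t : ℝ}, 0 ≤ s → 0 ≤ t → s ^ p + t ^ p = 1 → s ≤ 1 := fun hs ht h => by
    rw [← Real.rpow_le_rpow_iff hs zero_le_one hp, Real.one_rpow]
    linarith [Real.rpow_nonneg ht p]
  rw [mem_closedBall_zero_iff, Prod.norm_def]
  exact max_le (hle (norm_nonneg _) (norm_nonneg _) hz)
    (hle (norm_nonneg _) (norm_nonneg _) ((add_comm _ _).trans hz))

lemma exists_norm_sub_rpow_le (hp : 1 < p) {ε : ℝ} (hε : 0 < ε) :
    ∃ C, 0 ≤ C ∧ ∀ a b : E, ‖a - b‖ ^ p ≤ ε * (‖a‖ ^ p + ‖b‖ ^ p) + C * pGap p a b := by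
  have hp0 : 0 < p := by linarith
  obtain ⟨C, hC, hsphere⟩ := exists_forall_le_add_mul_of_isCompact
    (isCompact_setOf_norm_rpow_add_eq_one (E := E) hp0)
    (f := fun z => ‖z.1 - z.2‖ ^ p)
    ((continuous_fst.sub continuous_snd).norm.rpow_const fun _ => Or.inr hp0.le)
    (continuous_pGap hp) (fun z _ => pGap_nonneg hp z.1 z.2)
    (fun z _ hz => by simp [eq_of_pGap_eq_zero hp hz, hp0.ne']) hε
  refine ⟨C, hC, fun a b => ?_⟩
  set s := ‖a‖ ^ p + ‖b‖ ^ p with hs_def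
  have hs : 0 ≤ s := by positivity
  rcases hs.eq_or_lt with h_zero | hs_pos
  · have ha : a = 0 := by
      by_contra ha
      have : 0 < s := by positivity
      exact this.ne h_zero
    have hb : b = 0 := by
      by_contra hb
      have : 0 < s := by positivity
      exact this.ne h_zero
    simp [ha, hb, pGap, hp0.ne', ← h_zero]
  · -- by homogeneity it suffices to treat `‖a‖ ^ p + ‖b‖ ^ p = 1`
    set r := s⁻¹ ^ (1 / p)
    have hr : 0 < r := by positivity
    have hrp : r ^ p = s⁻¹ := by
      rw [← Real.rpow_mul (by positivity), one_div, inv_mul_cancel₀ hp0.ne', Real.rpow_one]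
    have hscale : ∀ c : E, ‖r • c‖ ^ p = s⁻¹ * ‖c‖ ^ p := fun c => by
      rw [norm_smul, Real.norm_of_nonneg hr.le, Real.mul_rpow hr.le (norm_nonneg _), hrp]
    have hnormalized := hsphere (r • a, r • b) (by
      rw [mem_ofPred_eq, hscale, hscale, ← mul_add, ← hs_def, inv_mul_cancel₀ hs_pos.ne'])
    simp only [← smul_sub, hscale, pGap_smul hr, hrp] at hnormalized
    calc ‖a - b‖ ^ p = s * (s⁻¹ * ‖a - b‖ ^ p) := by field_simp
      _ ≤ s * (ε + C * (s⁻¹ * pGap p a b)) := by gcongr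
      _ = ε * s + C * pGap p a b := by field_simp

end PLaplace

section Sobolev

variable {N : ℕ} {p r s : ℝ} {α E : Type*} [MeasurableSpace α] [NormedAddCommGroup E]
  {μ : Measure α}

lemma exists_eLpNorm_le_mul_eLpNorm_gradient (hN : 2 ≤ N) (hs : 1 ≤ s) (hr : 0 < r)
    (hsr : 1 / r = 1 / s - 1 / N) :
    ∃ S : ENNReal, S ≠ ⊤ ∧ ∀ φ : RN N → ℝ, ContDiff ℝ 1 φ → HasCompactSupport φ →
      eLpNorm φ (ENNReal.ofReal r) ≤ S * eLpNorm (gradient φ) (ENNReal.ofReal s) := by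
  refine ⟨SNormLESNormFDerivOfEqConst ℝ (volume : Measure (RN N)) (s.toNNReal : ℝ),
    ENNReal.coe_ne_top, fun φ hφ hφc => ?_⟩
  rw [eLpNorm_congr_norm_ae (ae_of_all _ fun x => norm_gradient φ x)]
  refine eLpNorm_le_eLpNorm_fderiv_of_eq (μ := (volume : Measure (RN N))) hφ hφc
    (p := s.toNNReal) (p' := r.toNNReal) (by simpa using hs) (by simp; lia) ?_
  rw [Real.coe_toNNReal _ hr.le, NNReal.coe_inv, Real.coe_toNNReal _ (by linarith)]
  simpa using hsr

lemma eLpNorm_restrict_le_eLpNorm_mul_measure_rpow {f : α → E} {t : Set α} (hs : 0 < s)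
    (hsp : s ≤ p) (hf : AEStronglyMeasurable f μ) :
    eLpNorm f (ENNReal.ofReal s) (μ.restrict t)
      ≤ eLpNorm f (ENNReal.ofReal p) μ * μ t ^ (1 / s - 1 / p) := by
  have hholder := eLpNorm_le_eLpNorm_mul_rpow_measure_univ (μ := μ.restrict t)
    (ENNReal.ofReal_le_ofReal hsp) hf.restrict
  rw [Measure.restrict_apply_univ, ENNReal.toReal_ofReal hs.le,
    ENNReal.toReal_ofReal (hs.le.trans hsp)] at hholder
  refine hholder.trans ?_
  gcongr
  exact Measure.restrict_le_self

lemma eLpNorm_le_eLpNorm_sub_mul_add {f w : α → E} {t : Set α} (hs : 1 ≤ s) (hsp : s ≤ p)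
    (hf : AEStronglyMeasurable f μ) (hw : AEStronglyMeasurable w μ)
    (hft : ∀ x ∉ t, f x = 0) :
    eLpNorm f (ENNReal.ofReal s) μ
      ≤ eLpNorm (f - w) (ENNReal.ofReal p) μ * μ t ^ (1 / s - 1 / p)
        + eLpNorm w (ENNReal.ofReal s) μ := by
  have hsupp : Function.support f ⊆ t := fun x hx => by_contra fun hxt => hx (hft x hxt)
  calc eLpNorm f (ENNReal.ofReal s) μ
      = eLpNorm (f - w + w) (ENNReal.ofReal s) (μ.restrict t) := by
        rw [sub_add_cancel, eLpNorm_restrict_eq_of_support_subset hsupp]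
    _ ≤ eLpNorm (f - w) (ENNReal.ofReal s) (μ.restrict t)
        + eLpNorm w (ENNReal.ofReal s) (μ.restrict t) :=
      eLpNorm_add_le (hf.sub hw).restrict hw.restrict (by simpa using hs)
    _ ≤ _ := add_le_add
      (eLpNorm_restrict_le_eLpNorm_mul_measure_rpow (by linarith) hsp (hf.sub hw))
      (eLpNorm_mono_measure _ Measure.restrict_le_self)

/-- The Sobolev inequality `|u|_r ≤ S |∇u|_s` on `W_0^{1,p}(Ω)`. -/
def HasSobolevBound {N : ℕ} (Ω : Set (RN N)) (p s r : ℝ) (S : ENNReal) : Prop :=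
  ∀ u w, IsW0Gradient Ω p u w →
    eLpNorm u (ENNReal.ofReal r) ≤ S * eLpNorm w (ENNReal.ofReal s)

lemma exists_sobolev_const (hN : 2 ≤ N) (hs : 1 ≤ s) (hr : 0 < r)
    (hsr : 1 / r = 1 / s - 1 / N) :
    ∃ S : ENNReal, S ≠ ⊤ ∧ ∀ p, s ≤ p → ∀ Ω : Set (RN N), volume Ω ≠ ⊤ →
      HasSobolevBound Ω p s r S := by
  obtain ⟨S, hS, hsob⟩ := exists_eLpNorm_le_mul_eLpNorm_gradient hN hs hr hsr
  refine ⟨S, hS, fun p hsp Ω hΩ u w h => ?_⟩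
  obtain ⟨φ, hφ, happrox⟩ := h
  set c : ENNReal := volume Ω ^ (1 / s - 1 / p)
  have hc : c ≠ ⊤ := ENNReal.rpow_ne_top_of_nonneg
    (sub_nonneg.2 (one_div_le_one_div_of_le (by linarith) hsp)) hΩ
  have hbound : ∀ n, eLpNorm (φ n) (ENNReal.ofReal r)
      ≤ S * (eLpNorm (gradient (φ n) - w) (ENNReal.ofReal p) * c
        + eLpNorm w (ENNReal.ofReal s)) := by
    intro n
    refine (hsob _ ((hφ n).1.of_le (by simp)) (hφ n).2.1).trans ?_
    gcongr
    exact eLpNorm_le_eLpNorm_sub_mul_add hs hsp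
      (continuous_gradient (hφ n).1 (by simp)).aestronglyMeasurable happrox.memLp_grad.1
      fun x hx => (hφ n).gradient_eq_zero_of_notMem hx
  have hlim : Tendsto (fun n => S * (eLpNorm (gradient (φ n) - w) (ENNReal.ofReal p) * c
      + eLpNorm w (ENNReal.ofReal s))) atTop (𝓝 (S * eLpNorm w (ENNReal.ofReal s))) := by
    have h := (ENNReal.Tendsto.mul_const happrox.tendsto_grad (Or.inr hc)).add_const
      (eLpNorm w (ENNReal.ofReal s))
    rw [zero_mul, zero_add] at h
    exact ENNReal.Tendsto.const_mul h (Or.inr hS)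
  rw [← hlim.liminf_eq]
  exact (Lp.eLpNorm_lim_le_liminf_eLpNorm (fun n => (hφ n).continuous.aestronglyMeasurable) u
    happrox.tendsto_ae).trans (liminf_le_liminf (Eventually.of_forall hbound))

lemma exists_sobolev_exponents (hN : 2 ≤ N) {q : ℝ} (hp : 1 ≤ p) (hq : 0 ≤ q)
    (hqc : (q : EReal) < criticalExponent N p) :
    ∃ s r : ℝ, 1 ≤ s ∧ s ≤ p ∧ q < r ∧ 1 / r = 1 / s - 1 / N := by
  have hN' : (2 : ℝ) ≤ N := by exact_mod_cast hN
  unfold criticalExponent at hqc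
  split_ifs at hqc with hpN
  · refine ⟨p, N * p / (N - p), hp, le_rfl, by exact_mod_cast hqc, ?_⟩
    have : (N : ℝ) - p ≠ 0 := by linarith
    field_simp
  · -- Every `r > q` is admissible: its partner `s = rN / (r + N)` satisfies `s < N ≤ p`.
    have : (0 : ℝ) < q + 2 := by linarith
    refine ⟨(q + 2) * N / (q + 2 + N), q + 2, ?_, ?_, by linarith, ?_⟩
    · rw [le_div_iff₀ (by positivity)]
      nlinarith
    · rw [div_le_iff₀ (by positivity)]
      nlinarith [not_lt.1 hpN]
    · field_simp
      ring

end Sobolev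

section LevelTruncation

variable {h k m t : ℝ}

/-- A smooth even step, equal to `0` on `[-h, h]` and to `1` off `(-m, m)`: the derivative of
`levelTrunc h m`. -/
noncomputable def levelStep (h m t : ℝ) : ℝ :=
  Real.smoothTransition ((t ^ 2 - h ^ 2) / (m ^ 2 - h ^ 2))

/-- A smooth substitute for the truncation `t ↦ sign t * (|t| - h)⁺` of De Giorgi's method: it
vanishes on `[-h, h]` and has slope `1` off `(-m, m)`. -/
noncomputable def levelTrunc (h m t : ℝ) : ℝ := ∫ s in (0 : ℝ)..t, levelStep h m s

lemma contDiff_levelStep (h m : ℝ) : ContDiff ℝ ∞ (levelStep h m) :=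
  Real.smoothTransition.contDiff.comp (by fun_prop)

lemma continuous_levelStep (h m : ℝ) : Continuous (levelStep h m) :=
  (contDiff_levelStep h m).continuous

lemma levelStep_nonneg (h m t : ℝ) : 0 ≤ levelStep h m t := Real.smoothTransition.nonneg _

lemma levelStep_le_one (h m t : ℝ) : levelStep h m t ≤ 1 := Real.smoothTransition.le_one _

lemma levelStep_eq_zero (h0 : 0 ≤ h) (hm : h < m) (ht : |t| ≤ h) : levelStep h m t = 0 := by
  refine Real.smoothTransition.zero_of_nonpos (div_nonpos_of_nonpos_of_nonneg ?_ ?_)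
  · nlinarith [sq_abs t, abs_nonneg t]
  · nlinarith

lemma levelStep_eq_one (h0 : 0 ≤ h) (hm : h < m) (ht : m ≤ |t|) : levelStep h m t = 1 := by
  refine Real.smoothTransition.one_of_one_le ?_
  rw [one_le_div (by nlinarith)]
  nlinarith [sq_abs t, abs_nonneg t]

lemma levelStep_mono (h0 : 0 ≤ h) (hm : h < m) {s : ℝ} (hs : 0 ≤ s) (hst : s ≤ t) :
    levelStep h m s ≤ levelStep h m t := by
  have : 0 < m ^ 2 - h ^ 2 := by nlinarith
  refine Real.smoothTransition.monotone ?_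
  gcongr

lemma levelStep_abs (h m t : ℝ) : levelStep h m |t| = levelStep h m t := by
  simp only [levelStep, sq_abs]

lemma levelTrunc_neg (h m t : ℝ) : levelTrunc h m (-t) = -levelTrunc h m t := by
  have heven : ∀ s, levelStep h m (-s) = levelStep h m s := fun s => by
    rw [← levelStep_abs, abs_neg, levelStep_abs]
  have hreflect := intervalIntegral.integral_comp_neg (a := 0) (b := t) (levelStep h m)
  simp only [heven, neg_zero] at hreflect
  rw [levelTrunc, levelTrunc, intervalIntegral.integral_symm, ← hreflect]

lemma levelTrunc_zero (h m : ℝ) : levelTrunc h m 0 = 0 := intervalIntegral.integral_same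

lemma hasDerivAt_levelTrunc (h m t : ℝ) : HasDerivAt (levelTrunc h m) (levelStep h m t) t :=
  (continuous_levelStep h m).integral_hasStrictDerivAt 0 t |>.hasDerivAt

lemma deriv_levelTrunc (h m : ℝ) : deriv (levelTrunc h m) = levelStep h m :=
  funext fun t => (hasDerivAt_levelTrunc h m t).deriv

lemma contDiff_levelTrunc (h m : ℝ) : ContDiff ℝ ∞ (levelTrunc h m) := by
  rw [contDiff_infty_iff_deriv, deriv_levelTrunc]
  exact ⟨fun t => (hasDerivAt_levelTrunc h m t).differentiableAt, contDiff_levelStep h m⟩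

lemma abs_deriv_levelTrunc_le_one (h m t : ℝ) : |deriv (levelTrunc h m) t| ≤ 1 := by
  rw [deriv_levelTrunc, abs_of_nonneg (levelStep_nonneg h m t)]
  exact levelStep_le_one h m t

lemma levelTrunc_nonneg (ht : 0 ≤ t) : 0 ≤ levelTrunc h m t :=
  intervalIntegral.integral_nonneg ht fun s _ => levelStep_nonneg h m s

lemma abs_levelTrunc (h m t : ℝ) : |levelTrunc h m t| = levelTrunc h m |t| := by
  rcases le_total 0 t with ht | ht
  · rw [abs_of_nonneg ht, abs_of_nonneg (levelTrunc_nonneg ht)]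
  · rw [abs_of_nonpos ht, ← abs_neg, ← levelTrunc_neg,
      abs_of_nonneg (levelTrunc_nonneg (neg_nonneg.2 ht))]

lemma levelTrunc_mul_self_nonneg (h m t : ℝ) : 0 ≤ levelTrunc h m t * t := by
  rcases le_total 0 t with ht | ht
  · exact mul_nonneg (levelTrunc_nonneg ht) ht
  · rw [← neg_mul_neg, ← levelTrunc_neg]
    exact mul_nonneg (levelTrunc_nonneg (neg_nonneg.2 ht)) (neg_nonneg.2 ht)

lemma abs_levelTrunc_le (h0 : 0 ≤ h) (hm : h < m) (t : ℝ) :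
    |levelTrunc h m t| ≤ levelStep h m t * |t| := by
  have hmono := intervalIntegral.integral_mono_on (μ := volume) (g := fun _ => levelStep h m |t|)
    (abs_nonneg t) ((continuous_levelStep h m).intervalIntegrable _ _) intervalIntegrable_const
    fun s hs => levelStep_mono h0 hm hs.1 hs.2
  rw [abs_levelTrunc, ← levelStep_abs]
  simpa [levelTrunc, mul_comm] using hmono

lemma abs_levelTrunc_le_abs (h0 : 0 ≤ h) (hm : h < m) (t : ℝ) : |levelTrunc h m t| ≤ |t| :=
  (abs_levelTrunc_le h0 hm t).trans
    (mul_le_of_le_one_left (abs_nonneg _) (levelStep_le_one _ _ _))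

lemma levelTrunc_eq_zero (h0 : 0 ≤ h) (hm : h < m) (ht : |t| ≤ h) : levelTrunc h m t = 0 := by
  have hle := abs_levelTrunc_le h0 hm t
  rw [levelStep_eq_zero h0 hm ht, zero_mul] at hle
  exact abs_nonpos_iff.1 hle

lemma sub_le_abs_levelTrunc (h0 : 0 ≤ h) (hm : h < m) (ht : m ≤ |t|) :
    |t| - m ≤ |levelTrunc h m t| := by
  have hInt : ∀ a b, IntervalIntegrable (levelStep h m) volume a b :=
    (continuous_levelStep h m).intervalIntegrable
  have hslope : ∫ s in m..|t|, levelStep h m s = |t| - m := by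
    rw [intervalIntegral.integral_congr (g := fun _ => (1 : ℝ))]
    · simp
    · intro s hs
      rw [uIcc_of_le ht] at hs
      exact levelStep_eq_one h0 hm (hs.1.trans (le_abs_self s))
  calc |t| - m ≤ levelTrunc h m m + ∫ s in m..|t|, levelStep h m s := by
        rw [hslope]
        linarith [levelTrunc_nonneg (h := h) (m := m) (h0.trans hm.le)]
    _ = |levelTrunc h m t| := by
        rw [abs_levelTrunc]
        exact intervalIntegral.integral_add_adjacent_intervals (hInt 0 m) (hInt m |t|)

lemma abs_le_mul_abs_levelTrunc (h0 : 0 ≤ h) (hk : h < k) (ht : k < |t|) :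
    |t| ≤ 2 * k / (k - h) * |levelTrunc h ((h + k) / 2) t| := by
  have hkh : 0 < k - h := by linarith
  calc |t| ≤ 2 * k / (k - h) * (|t| - (h + k) / 2) := by
        rw [div_mul_eq_mul_div, le_div_iff₀ hkh]
        nlinarith
    _ ≤ 2 * k / (k - h) * |levelTrunc h ((h + k) / 2) t| :=
        mul_le_mul_of_nonneg_left (sub_le_abs_levelTrunc h0 (by linarith) (by linarith))
          (div_nonneg (by linarith) hkh.le)

end LevelTruncation

section DeGiorgi

variable {α : Type*} [MeasurableSpace α] {μ : Measure α} {u : α → ℝ} {h k p q r : ℝ}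

/-- The excess integral `∫_{|u| > h} |u|^q` of De Giorgi's iteration. -/
noncomputable def excess (μ : Measure α) (u : α → ℝ) (q h : ℝ) : ENNReal :=
  ∫⁻ x in {x | h < |u x|}, ‖u x‖ₑ ^ q ∂μ

lemma nullMeasurableSet_superlevel (hu : AEMeasurable u μ) (h : ℝ) :
    NullMeasurableSet {x | h < |u x|} μ :=
  nullMeasurableSet_lt aemeasurable_const hu.norm

lemma measure_superlevel_le_excess (hu : AEMeasurable u μ) (hh : 1 ≤ h) (hq : 0 < q) :
    μ {x | h < |u x|} ≤ excess μ u q h := by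
  rw [← setLIntegral_one, excess]
  refine lintegral_mono_ae ?_
  filter_upwards [ae_restrict_mem₀ (nullMeasurableSet_superlevel hu h)] with x hx
  refine ENNReal.one_le_rpow ?_ hq
  rw [Real.enorm_eq_ofReal_abs, ENNReal.one_le_ofReal]
  exact hh.trans (le_of_lt hx)

lemma excess_antitone (μ : Measure α) (u : α → ℝ) (q : ℝ) : Antitone (excess μ u q) :=
  fun _ _ hhk => lintegral_mono_set fun _ hx => hhk.trans_lt hx

lemma lintegral_rpow_enorm_eq {F : Type*} [NormedAddCommGroup F] {f : α → F} (hq : 0 < q) :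
    ∫⁻ x, ‖f x‖ₑ ^ q ∂μ = eLpNorm f (ENNReal.ofReal q) μ ^ q := by
  rw [eLpNorm_eq_lintegral_rpow_enorm_toReal (by simpa using hq) ENNReal.ofReal_ne_top,
    ENNReal.toReal_ofReal hq.le, ← ENNReal.rpow_mul, one_div, inv_mul_cancel₀ hq.ne',
    ENNReal.rpow_one]

lemma excess_le_eLpNorm (hq : 0 < q) (u : α → ℝ) (h : ℝ) :
    excess μ u q h ≤ eLpNorm u (ENNReal.ofReal q) μ ^ q := by
  rw [← lintegral_rpow_enorm_eq hq]
  exact setLIntegral_le_lintegral _ _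

lemma excess_le_rpow_mul_excess (hu : AEMeasurable u μ) (hqr : q ≤ r) (hk0 : 0 < k)
    (hhk : h ≤ k) : excess μ u q k ≤ ENNReal.ofReal (k ^ (q - r)) * excess μ u r h := by
  refine le_trans ?_ (mul_le_mul_right (excess_antitone μ u r hhk) _)
  rw [excess, excess, ← lintegral_const_mul' _ _ ENNReal.ofReal_ne_top]
  refine lintegral_mono_ae ?_
  filter_upwards [ae_restrict_mem₀ (nullMeasurableSet_superlevel hu k)] with x hx
  have hux : 0 < |u x| := hk0.trans hx
  rw [Real.enorm_eq_ofReal_abs, ENNReal.ofReal_rpow_of_pos hux, ENNReal.ofReal_rpow_of_pos hux,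
    ← ENNReal.ofReal_mul (by positivity)]
  refine ENNReal.ofReal_le_ofReal ?_
  calc |u x| ^ q = |u x| ^ (q - r) * |u x| ^ r := by rw [← Real.rpow_add hux, sub_add_cancel]
    _ ≤ k ^ (q - r) * |u x| ^ r := mul_le_mul_of_nonneg_right
      (Real.rpow_le_rpow_of_nonpos hk0 (le_of_lt hx) (by linarith)) (by positivity)

lemma excess_le_of_levelTrunc (hu : AEMeasurable u μ) (hq : 0 < q) (hqr : q ≤ r) (h0 : 0 ≤ h)
    (hk : h < k) :
    excess μ u q k ≤ (ENNReal.ofReal (2 * k / (k - h)) *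
      (eLpNorm (fun x => levelTrunc h ((h + k) / 2) (u x)) (ENNReal.ofReal r) μ
        * μ {x | k < |u x|} ^ (1 / q - 1 / r))) ^ q := by
  have htrunc : AEStronglyMeasurable (fun x => levelTrunc h ((h + k) / 2) (u x)) μ :=
    (contDiff_levelTrunc h _).continuous.comp_aestronglyMeasurable hu.aestronglyMeasurable
  rw [excess, lintegral_rpow_enorm_eq hq]
  gcongr
  refine (eLpNorm_le_mul_eLpNorm_of_ae_le_mul ?_ _).trans
    (mul_le_mul_right (eLpNorm_restrict_le_eLpNorm_mul_measure_rpow hq hqr htrunc) _)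
  filter_upwards [ae_restrict_mem₀ (nullMeasurableSet_superlevel hu k)] with x hx
  exact abs_le_mul_abs_levelTrunc h0 hk hx

variable {N : ℕ} {s : ℝ} {Ω : Set (RN N)} {v : RN N → ℝ} {w : RN N → RN N} {S C : ENNReal}

lemma IsW0Gradient.levelTrunc (hv : IsW0Gradient Ω p v w) (hp : 1 ≤ p) (h m : ℝ) :
    IsW0Gradient Ω p (fun x => levelTrunc h m (v x)) (fun x => levelStep h m (v x) • w x) := by
  rw [← deriv_levelTrunc]
  exact hv.comp hp (contDiff_levelTrunc h m) (levelTrunc_zero h m) (abs_deriv_levelTrunc_le_one h m)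

lemma eLpNorm_levelTrunc_le (hp : 1 ≤ p) (hs : 0 < s) (hsp : s ≤ p) (hv : IsW0Gradient Ω p v w)
    (hS : HasSobolevBound Ω p s r S) {m : ℝ} (h0 : 0 ≤ h) (hm : h < m) :
    eLpNorm (fun x => levelTrunc h m (v x)) (ENNReal.ofReal r)
      ≤ S * (eLpNorm (fun x => levelStep h m (v x) • w x) (ENNReal.ofReal p)
        * volume {x | h < |v x|} ^ (1 / s - 1 / p)) := by
  have htrunc := hv.levelTrunc hp h m
  have hsupp : Function.support (fun x => levelStep h m (v x) • w x) ⊆ {x | h < |v x|} :=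
    fun x hx => not_le.1 fun hle : |v x| ≤ h => hx (by simp [levelStep_eq_zero h0 hm hle])
  refine (hS _ _ htrunc).trans (mul_le_mul_right ?_ S)
  rw [← eLpNorm_restrict_eq_of_support_subset hsupp]
  exact eLpNorm_restrict_le_eLpNorm_mul_measure_rpow hs hsp htrunc.memLp_grad.1

lemma excess_decay (hN : N ≠ 0) (hp : 1 ≤ p) (hs : 0 < s) (hsp : s ≤ p) (hq : 0 < q) (hqr : q ≤ r)
    (hsr : 1 / r = 1 / s - 1 / N) (hv : IsW0Gradient Ω p v w) (hS : HasSobolevBound Ω p s r S)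
    (hh : 1 ≤ h) (hk : h < k)
    (henergy : eLpNorm (fun x => levelStep h ((h + k) / 2) (v x) • w x) (ENNReal.ofReal p)
      ≤ (C * excess volume v q h) ^ (1 / p)) :
    excess volume v q k ≤ (ENNReal.ofReal (2 * k / (k - h)) * (S * C ^ (1 / p))) ^ q
      * excess volume v q h ^ (1 + q / N) := by
  have hvm : AEMeasurable v volume := hv.memLp.1.aemeasurable
  set Y := excess volume v q h
  set a := 1 / s - 1 / p with ha_def
  set b := 1 / q - 1 / r with hb_def
  have ha : 0 ≤ a := sub_nonneg.2 (one_div_le_one_div_of_le hs hsp)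
  have hb : 0 ≤ b := sub_nonneg.2 (one_div_le_one_div_of_le hq hqr)
  have hexponent : (1 / p + a + b) * q = 1 + q / N := by
    rw [ha_def, hb_def, hsr]
    field_simp
    ring
  have hsuper : volume {x | h < |v x|} ≤ Y := measure_superlevel_le_excess hvm hh hq
  have hsuper' : volume {x | k < |v x|} ≤ Y := (measure_mono fun x hx => hk.trans hx).trans hsuper
  have hnorm : eLpNorm (fun x => levelTrunc h ((h + k) / 2) (v x)) (ENNReal.ofReal r)
      ≤ S * ((C * Y) ^ (1 / p) * Y ^ a) :=
    (eLpNorm_levelTrunc_le hp hs hsp hv hS (by linarith) (by linarith)).trans (by gcongr)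
  have hscaling : (ENNReal.ofReal (2 * k / (k - h)) * (S * ((C * Y) ^ (1 / p) * Y ^ a) * Y ^ b)) ^ q
      = (ENNReal.ofReal (2 * k / (k - h)) * (S * C ^ (1 / p))) ^ q * Y ^ (1 + q / N) := by
    rw [← hexponent, ENNReal.rpow_mul, ENNReal.rpow_add_of_nonneg _ _ (by positivity) hb,
      ENNReal.rpow_add_of_nonneg _ _ (by positivity) ha,
      ENNReal.mul_rpow_of_nonneg _ _ (by positivity : 0 ≤ 1 / p),
      ← ENNReal.mul_rpow_of_nonneg _ _ hq.le]
    congr 1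
    ring
  rw [← hscaling]
  refine (excess_le_of_levelTrunc hvm hq hqr (by linarith) hk).trans ?_
  gcongr

end DeGiorgi

section FastGeometricConvergence

lemma le_geometric_of_le_mul_rpow {D b δ τ ε : ℝ} (hD : 0 ≤ D) (hb : 0 ≤ b) (hδ : 0 ≤ δ)
    (hτ : 0 < τ) (hε : 0 < ε) (hbτ : b * τ ^ δ = 1) (hDε : D * ε ^ δ = τ) {Y : ℕ → ENNReal}
    (h0 : Y 0 ≤ ENNReal.ofReal ε)
    (hY : ∀ j, Y (j + 1) ≤ ENNReal.ofReal (D * b ^ j) * Y j ^ (1 + δ)) (j : ℕ) :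
    Y j ≤ ENNReal.ofReal (ε * τ ^ j) := by
  induction j with
  | zero => simpa using h0
  | succ j ih =>
    have hpow : (τ ^ j) ^ δ = (τ ^ δ) ^ j := by
      rw [← Real.rpow_natCast, ← Real.rpow_natCast, ← Real.rpow_mul hτ.le, ← Real.rpow_mul hτ.le,
        mul_comm]
    have hstep : D * b ^ j * (ε * τ ^ j) ^ (1 + δ) = ε * τ ^ (j + 1) := by
      rw [Real.rpow_add (by positivity), Real.rpow_one, Real.mul_rpow hε.le (by positivity), hpow]
      calc D * b ^ j * (ε * τ ^ j * (ε ^ δ * (τ ^ δ) ^ j))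
          = (b * τ ^ δ) ^ j * (D * ε ^ δ) * (ε * τ ^ j) := by ring
        _ = ε * τ ^ (j + 1) := by
          rw [hbτ, hDε]
          ring
    rw [← hstep, ENNReal.ofReal_mul (by positivity),
      ← ENNReal.ofReal_rpow_of_nonneg (p := 1 + δ) (by positivity) (by positivity)]
    exact (hY j).trans (by gcongr)

lemma exists_fast_geometric_convergence {D b δ : ℝ} (hD : 0 < D) (hb : 1 < b) (hδ : 0 < δ) :
    ∃ ε : ℝ, 0 < ε ∧ ∀ Y : ℕ → ENNReal, Y 0 ≤ ENNReal.ofReal ε →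
      (∀ j, Y (j + 1) ≤ ENNReal.ofReal (D * b ^ j) * Y j ^ (1 + δ)) → Tendsto Y atTop (𝓝 0) := by
  have hb0 : 0 < b := by linarith
  set τ : ℝ := b ^ (-(1 / δ))
  have hτ : 0 < τ := by positivity
  have hτ1 : τ < 1 := Real.rpow_lt_one_of_one_lt_of_neg hb (by simpa using hδ)
  have hbτ : b * τ ^ δ = 1 := by
    rw [← Real.rpow_mul hb0.le, neg_mul, one_div_mul_cancel hδ.ne', Real.rpow_neg_one,
      mul_inv_cancel₀ hb0.ne']
  set ε : ℝ := (τ / D) ^ (1 / δ)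
  have hε : 0 < ε := by positivity
  have hDε : D * ε ^ δ = τ := by
    rw [← Real.rpow_mul (by positivity), one_div_mul_cancel hδ.ne', Real.rpow_one,
      mul_div_cancel₀ _ hD.ne']
  refine ⟨ε, hε, fun Y h0 hY => ?_⟩
  have hlim := (tendsto_pow_atTop_nhds_zero_of_lt_one hτ.le hτ1).const_mul ε
  rw [mul_zero] at hlim
  exact tendsto_of_tendsto_of_tendsto_of_le_of_le tendsto_const_nhds
    (by simpa using ENNReal.tendsto_ofReal hlim) (fun _ => zero_le)
    (le_geometric_of_le_mul_rpow hD.le hb0.le hδ.le hτ hε hbτ hDε h0 hY)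

end FastGeometricConvergence

section DeGiorgiIteration

lemma two_mul_div_sub_le {K : ℝ} (hK : 0 < K) (j : ℕ) :
    2 * (2 * K - K / 2 ^ (j + 1)) / (2 * K - K / 2 ^ (j + 1) - (2 * K - K / 2 ^ j))
      ≤ 8 * 2 ^ j := by
  have : 0 < K / 2 ^ j := by positivity
  have hgap : 2 * K - K / 2 ^ (j + 1) - (2 * K - K / 2 ^ j) = K / 2 ^ j / 2 := by
    rw [pow_succ]
    field_simp
    ring
  have hcancel : 8 * (2 : ℝ) ^ j * (K / 2 ^ j / 2) = 4 * K := by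
    field_simp
    norm_num
  have : 0 < K / 2 ^ (j + 1) := by positivity
  rw [hgap, div_le_iff₀ (by positivity), hcancel]
  linarith

lemma exists_excess_eq_zero {α : Type*} [MeasurableSpace α] (μ : Measure α) {T : ENNReal}
    {q δ : ℝ} (hT : T ≠ ⊤) (hq : 0 < q) (hδ : 0 < δ) :
    ∃ ε : ℝ, 0 < ε ∧ ∀ (u : α → ℝ) (K : ℝ), 0 < K → excess μ u q K ≤ ENNReal.ofReal ε →
      (∀ h k, K ≤ h → h < k → excess μ u q k
        ≤ (ENNReal.ofReal (2 * k / (k - h)) * T) ^ q * excess μ u q h ^ (1 + δ)) →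
      excess μ u q (2 * K) = 0 := by
  obtain ⟨ε, hε, hfast⟩ := exists_fast_geometric_convergence
    (D := (8 * (T.toReal + 1)) ^ q) (b := 2 ^ q) (by positivity)
    (Real.one_lt_rpow one_lt_two hq) hδ
  refine ⟨ε, hε, fun u K hK hstart hdecay => ?_⟩
  set κ : ℕ → ℝ := fun j => 2 * K - K / 2 ^ j
  have hκK : ∀ j, K ≤ κ j := fun j => by
    have := div_le_self hK.le (one_le_pow₀ (one_le_two (α := ℝ)) (n := j))
    simp only [κ]
    linarith
  have hκ_lt : ∀ j, κ j < κ (j + 1) := fun j => by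
    have : (2 : ℝ) ^ j < 2 ^ (j + 1) := pow_lt_pow_right₀ one_lt_two j.lt_succ_self
    simp only [κ]
    gcongr
  have hκ_le : ∀ j, κ j ≤ 2 * K := fun j => sub_le_self _ (by positivity)
  have hT' : T ≤ ENNReal.ofReal (T.toReal + 1) := by
    rw [← ENNReal.ofReal_toReal hT, ENNReal.toReal_ofReal ENNReal.toReal_nonneg]
    exact ENNReal.ofReal_le_ofReal (by linarith)
  have hcoeff : ∀ j, (ENNReal.ofReal (2 * κ (j + 1) / (κ (j + 1) - κ j)) * T) ^ q
      ≤ ENNReal.ofReal ((8 * (T.toReal + 1)) ^ q * (2 ^ q) ^ j) := fun j => by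
    have hpow : ((2 : ℝ) ^ q) ^ j = (2 ^ j) ^ q := by
      rw [← Real.rpow_natCast, ← Real.rpow_natCast, ← Real.rpow_mul zero_le_two,
        ← Real.rpow_mul zero_le_two, mul_comm]
    rw [hpow, ← Real.mul_rpow (by positivity) (by positivity),
      ← ENNReal.ofReal_rpow_of_nonneg (by positivity) hq.le, mul_right_comm,
      ENNReal.ofReal_mul (by positivity)]
    gcongr
    exact two_mul_div_sub_le hK j
  have hlim : Tendsto (fun j => excess μ u q (κ j)) atTop (𝓝 0) := by
    refine hfast _ ?_ fun j => (hdecay _ _ (hκK j) (hκ_lt j)).trans ?_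
    · exact (excess_antitone μ u q (hκK 0)).trans hstart
    · gcongr
      exact hcoeff j
  exact le_antisymm (ge_of_tendsto' hlim fun j => excess_antitone μ u q (hκ_le j)) zero_le

lemma exists_rpow_mul_le {q r ε : ℝ} {E : ENNReal} (hE : E ≠ ⊤) (hqr : q < r) (hε : 0 < ε) :
    ∃ K : ℝ, 2 ≤ K ∧ ENNReal.ofReal (K ^ (q - r)) * E ≤ ENNReal.ofReal ε := by
  have hlim := ENNReal.Tendsto.mul_const (b := E)
    (ENNReal.tendsto_ofReal (tendsto_rpow_neg_atTop (sub_pos.2 hqr))) (Or.inr hE)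
  rw [ENNReal.ofReal_zero, zero_mul] at hlim
  obtain ⟨K, hKε, hK⟩ := ((hlim.eventually (gt_mem_nhds (ENNReal.ofReal_pos.2 hε))).and
    (eventually_ge_atTop (2 : ℝ))).exists
  rw [neg_sub] at hKε
  exact ⟨K, hK, hKε.le⟩

variable {N : ℕ} {p q r s : ℝ} {Ω : Set (RN N)} {u : RN N → ℝ} {w : RN N → RN N}
  {S B C : ENNReal}

lemma excess_two_le (hp : 1 ≤ p) (hs : 0 < s) (hsp : s ≤ p) (hr : 0 < r)
    (hu : IsW0Gradient Ω p u w) (hS : HasSobolevBound Ω p s r S)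
    (hBu : eLpNorm u (ENNReal.ofReal p) ≤ B) (hBw : eLpNorm w (ENNReal.ofReal p) ≤ B) :
    excess volume u r 2 ≤ (ENNReal.ofReal 4 * (S * (B * (B ^ p) ^ (1 / s - 1 / p)))) ^ r := by
  have hp0 : 0 < p := by linarith
  have hum : AEMeasurable u volume := hu.memLp.1.aemeasurable
  have hexcess := excess_le_of_levelTrunc hum hr le_rfl zero_le_one (one_lt_two (α := ℝ))
  have hratio : 2 * (2 : ℝ) / (2 - 1) = 4 := by norm_num
  rw [sub_self, ENNReal.rpow_zero, mul_one, hratio] at hexcess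
  have hstep : eLpNorm (fun x => levelStep 1 ((1 + 2) / 2) (u x) • w x) (ENNReal.ofReal p)
      ≤ B := by
    refine (eLpNorm_mono fun x => ?_).trans hBw
    rw [norm_smul, Real.norm_of_nonneg (levelStep_nonneg _ _ _)]
    exact mul_le_of_le_one_left (norm_nonneg _) (levelStep_le_one _ _ _)
  have hsuper : volume {x | 1 < |u x|} ≤ B ^ p :=
    (measure_superlevel_le_excess hum le_rfl hp0).trans
      ((excess_le_eLpNorm hp0 u 1).trans (ENNReal.rpow_le_rpow hBu hp0.le))
  have : 0 ≤ 1 / s - 1 / p := sub_nonneg.2 (one_div_le_one_div_of_le hs hsp)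
  refine hexcess.trans ?_
  gcongr
  refine (eLpNorm_levelTrunc_le hp hs hsp hu hS zero_le_one (by norm_num)).trans ?_
  gcongr

lemma exists_bound_of_energy_inequality (hN : 2 ≤ N) (hp : 1 ≤ p) (hq : 0 < q)
    (hqc : (q : EReal) < criticalExponent N p) (hC : C ≠ ⊤) (hB : B ≠ ⊤) :
    ∃ M : ℝ, ∀ Ω : Set (RN N), volume Ω ≠ ⊤ → ∀ u w, IsW0Gradient Ω p u w →
      eLpNorm u (ENNReal.ofReal p) ≤ B → eLpNorm w (ENNReal.ofReal p) ≤ B →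
      (∀ h k : ℝ, 1 ≤ h → h < k →
        eLpNorm (fun x => levelStep h k (u x) • w x) (ENNReal.ofReal p)
          ≤ (C * excess volume u q h) ^ (1 / p)) →
      ∀ᵐ x, |u x| ≤ M := by
  obtain ⟨s, r, hs, hsp, hqr, hsr⟩ := exists_sobolev_exponents hN hp hq.le hqc
  have hs0 : 0 < s := by linarith
  have hr : 0 < r := hq.trans hqr
  have hN0 : (0 : ℝ) < N := by positivity
  have hsp' : 0 ≤ 1 / s - 1 / p := sub_nonneg.2 (one_div_le_one_div_of_le hs0 hsp)
  obtain ⟨S, hS, hsob⟩ := exists_sobolev_const hN hs hr hsr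
  obtain ⟨ε, hε, hzero⟩ := exists_excess_eq_zero (volume : Measure (RN N))
    (T := S * C ^ (1 / p)) (by finiteness) hq (div_pos hq hN0)
  obtain ⟨K, hK, hKε⟩ := exists_rpow_mul_le
    (E := (ENNReal.ofReal 4 * (S * (B * (B ^ p) ^ (1 / s - 1 / p)))) ^ r) (by finiteness) hqr hε
  refine ⟨2 * K, fun Ω hΩ u w hu hBu hBw henergy => ?_⟩
  have hum : AEMeasurable u volume := hu.memLp.1.aemeasurable
  have hSΩ := hsob p hsp Ω hΩ
  have hstart : excess volume u q K ≤ ENNReal.ofReal ε :=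
    (excess_le_rpow_mul_excess hum hqr.le (by linarith) hK).trans
      (le_trans (mul_le_mul_right (excess_two_le hp hs0 hsp hr hu hSΩ hBu hBw) _) hKε)
  have hvanish := hzero u K (by linarith) hstart fun h k hh hk =>
    excess_decay (by lia) hp hs0 hsp hq hqr.le hsr hu hSΩ (by linarith) hk
      (henergy _ _ (by linarith) (by linarith))
  have hnull := measure_superlevel_le_excess hum (h := 2 * K) (by linarith) hq
  rw [hvanish, nonpos_iff_eq_zero] at hnull
  filter_upwards [measure_eq_zero_iff_ae_notMem.1 hnull] with x hx
  exact not_lt.1 hx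

end DeGiorgiIteration

section CriticalPoints

variable {N : ℕ}

/-- The standing assumptions on the potential `V`, the coefficient `A` and the nonlinearity `g`:
a positive lower bound `c` of `V`, local boundedness and ellipticity of `A`, the growth conditions
`(h_3)` and `(h_4)` relating `A` to `t A_t`, growth of order `q` of `g`, and the
Ambrosetti–Rabinowitz condition with exponent `μ`. -/
structure StructureConditions (N : ℕ) (p : ℝ) (V : RN N → ℝ) (A g : RN N → ℝ → ℝ)
    (α₀ μ q c α₁ α₂ a₁ a₂ : ℝ) : Prop where
  one_lt_p : 1 < p
  aemeasurable_V : AEMeasurable V volume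
  c_pos : 0 < c
  le_V : ∀ᵐ x : RN N, c ≤ V x
  caratheodory_A : IsCaratheodory 1 A
  bound_A : ∀ ρ : ℝ, 0 < ρ → ∃ C : ℝ, ∀ᵐ x : RN N, ∀ t : ℝ, |t| ≤ ρ →
      |A x t| ≤ C ∧ |deriv (A x) t| ≤ C
  α₀_pos : 0 < α₀
  le_A : ∀ᵐ x : RN N, ∀ t : ℝ, α₀ ≤ A x t
  p_lt_μ : p < μ
  α₁_pos : 0 < α₁
  growth_A : ∀ᵐ x : RN N, ∀ t : ℝ, α₁ * A x t ≤ (μ - p) * A x t - deriv (A x) t * t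
  α₂_pos : 0 < α₂
  lower_A : ∀ᵐ x : RN N, ∀ t : ℝ, α₂ * A x t ≤ p * A x t + deriv (A x) t * t
  caratheodory_g : IsCaratheodory 0 g
  p_le_q : p ≤ q
  a₁_nonneg : 0 ≤ a₁
  a₂_nonneg : 0 ≤ a₂
  bound_g : ∀ᵐ x : RN N, ∀ t : ℝ, |g x t| ≤ a₁ * |t| ^ (p - 1) + a₂ * |t| ^ (q - 1)
  ambrosetti_rabinowitz : ∀ᵐ x : RN N, ∀ t : ℝ,
      0 ≤ μ * (∫ s in (0 : ℝ)..t, g x s) ∧ μ * (∫ s in (0 : ℝ)..t, g x s) ≤ g x t * t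

/-- `u`, with gradient `w` and `|u| ≤ m`, is a critical point of the energy on the space `X_Ω`
of an open set `Ω`. The gradient and the bound are arguments so that estimates can refer to
them. -/
structure IsCriticalOn (Ω : Set (RN N)) (p : ℝ) (V : RN N → ℝ) (A g : RN N → ℝ → ℝ)
    (u : RN N → ℝ) (w : RN N → RN N) (m : ℝ) : Prop where
  isOpen : IsOpen Ω
  mem : MemXOn Ω V p u
  grad : IsW0Gradient Ω p u w
  bound : ∀ᵐ x, |u x| ≤ m
  critical : ∀ v, MemXOn Ω V p v → energyDifferential p V A g u v = 0

lemma rpow_sub_one_mul_le {p s t : ℝ} (hp : 1 ≤ p) (hs : 0 ≤ s) (ht : 0 ≤ t) :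
    s ^ (p - 1) * t ≤ s ^ p + t ^ p := by
  have hp0 : 0 < p := by linarith
  rcases le_total s t with h | h
  · calc s ^ (p - 1) * t ≤ t ^ (p - 1) * t := by gcongr
      _ ≤ s ^ p + t ^ p := by
        rw [rpow_sub_one_mul_self hp0 ht]
        exact le_add_of_nonneg_left (by positivity)
  · calc s ^ (p - 1) * t ≤ s ^ (p - 1) * s := by gcongr
      _ ≤ s ^ p + t ^ p := by
        rw [rpow_sub_one_mul_self hp0 hs]
        exact le_add_of_nonneg_right (by positivity)

lemma MemXOn.integrable_potential {Ω : Set (RN N)} (hΩ : MeasurableSet Ω) {p : ℝ} (hp : p ≠ 0)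
    {V v : RN N → ℝ} (h : MemXOn Ω V p v) : Integrable fun x => V x * |v x| ^ p := by
  refine ((integrable_indicator_iff hΩ).2 h.2.1).congr ?_
  filter_upwards [h.2.2.2] with x hx
  by_cases hxΩ : x ∈ Ω
  · simp only [hxΩ, indicator_of_mem]
  · simp [hxΩ, hx hxΩ, hp]

lemma MemXOn.exists_bound {Ω : Set (RN N)} (hΩ : MeasurableSet Ω) {p : ℝ}
    {V v : RN N → ℝ} (h : MemXOn Ω V p v) : ∃ m : ℝ, ∀ᵐ x, |v x| ≤ m := by
  have hfin : eLpNormEssSup v (volume.restrict Ω) ≠ ⊤ := by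
    simpa only [eLpNorm_exponent_top] using h.2.2.1.2.ne
  refine ⟨(eLpNormEssSup v (volume.restrict Ω)).toReal, ?_⟩
  filter_upwards [(ae_restrict_iff' hΩ).1 (ae_le_eLpNormEssSup (f := v)), h.2.2.2] with x hx hx0
  by_cases hxΩ : x ∈ Ω
  · simpa only [toReal_enorm, Real.norm_eq_abs] using ENNReal.toReal_mono hfin (hx hxΩ)
  · rw [hx0 hxΩ, abs_zero]
    positivity

section IntegrableTerms

variable {p C : ℝ} {a : RN N → ℝ} {w v : RN N → RN N}

lemma integrable_coeff_mul_inner_pField (hp : 1 < p) (ha : AEMeasurable a volume)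
    (hC : ∀ᵐ x, |a x| ≤ C) (hw : MemLp w (ENNReal.ofReal p)) (hv : MemLp v (ENNReal.ofReal p)) :
    Integrable fun x => a x * (inner ℝ (pField p (w x)) (v x) : ℝ) := by
  have hp0 : 0 < p := by linarith
  refine (((integrable_norm_rpow_of_memLp hp0 hw).add
    (integrable_norm_rpow_of_memLp hp0 hv)).const_mul C).mono' ?_ ?_
  · exact ha.aestronglyMeasurable.mul
      (((continuous_pField hp).comp_aestronglyMeasurable hw.1).inner hv.1)
  · filter_upwards [hC] with x hx
    rw [norm_mul]
    refine mul_le_mul hx ?_ (norm_nonneg _) ((abs_nonneg _).trans hx)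
    refine (norm_inner_le_norm _ _).trans ?_
    rw [norm_pField hp]
    exact rpow_sub_one_mul_le hp.le (norm_nonneg _) (norm_nonneg _)

lemma integrable_coeff_mul_rpow (hp : 0 < p) (ha : AEMeasurable a volume)
    (hC : ∀ᵐ x, |a x| ≤ C) (hw : MemLp w (ENNReal.ofReal p)) :
    Integrable fun x => a x * ‖w x‖ ^ p :=
  (integrable_norm_rpow_of_memLp hp hw).bdd_mul ha.aestronglyMeasurable hC

end IntegrableTerms

variable {p : ℝ} {V : RN N → ℝ} {A g : RN N → ℝ → ℝ} {α₀ μ q c α₁ α₂ a₁ a₂ : ℝ}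

namespace StructureConditions

lemma p_pos (D : StructureConditions N p V A g α₀ μ q c α₁ α₂ a₁ a₂) : 0 < p :=
  zero_lt_one.trans D.one_lt_p

lemma V_nonneg (D : StructureConditions N p V A g α₀ μ q c α₁ α₂ a₁ a₂) :
    ∀ᵐ x : RN N, 0 ≤ V x :=
  D.le_V.mono fun _ hx => D.c_pos.le.trans hx

lemma exists_coeff_bound (D : StructureConditions N p V A g α₀ μ q c α₁ α₂ a₁ a₂) (m : ℝ) :
    ∃ C : ℝ, 0 ≤ C ∧ ∀ᵐ x : RN N, ∀ t : ℝ, |t| ≤ m → |A x t| ≤ C ∧ |deriv (A x) t| ≤ C := by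
  obtain ⟨C, hC⟩ := D.bound_A (max m 1) (by positivity)
  refine ⟨|C|, abs_nonneg _, ?_⟩
  filter_upwards [hC] with x hx t ht
  obtain ⟨hA, hAt⟩ := hx t (ht.trans (le_max_left _ _))
  exact ⟨hA.trans (le_abs_self C), hAt.trans (le_abs_self C)⟩

lemma abs_g_le (D : StructureConditions N p V A g α₀ μ q c α₁ α₂ a₁ a₂) (m : ℝ) :
    ∀ᵐ x : RN N, ∀ t, |t| ≤ m → |g x t| ≤ (a₁ + a₂ * m ^ (q - p)) * |t| ^ (p - 1) := by
  have hp := D.one_lt_p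
  have hpq := D.p_le_q
  have ha := D.a₂_nonneg
  filter_upwards [D.bound_g] with x hx t ht
  refine (hx t).trans ?_
  rw [add_mul, mul_assoc]
  gcongr
  rcases (abs_nonneg t).eq_or_lt with h0 | h0
  · rw [← h0, Real.zero_rpow (by linarith), Real.zero_rpow (by linarith), mul_zero]
  · rw [show q - 1 = (q - p) + (p - 1) by ring, Real.rpow_add h0]
    gcongr

lemma integrable_g_term (D : StructureConditions N p V A g α₀ μ q c α₁ α₂ a₁ a₂)
    {u v : RN N → ℝ} {m : ℝ} (hu : MemLp u (ENNReal.ofReal p)) (hv : MemLp v (ENNReal.ofReal p))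
    (hm : ∀ᵐ x, |u x| ≤ m) : Integrable fun x => g x (u x) * v x := by
  have ha₁ := D.a₁_nonneg
  have ha₂ := D.a₂_nonneg
  refine (((integrable_norm_rpow_of_memLp D.p_pos hu).add
    (integrable_norm_rpow_of_memLp D.p_pos hv)).const_mul (a₁ + a₂ * m ^ (q - p))).mono' ?_ ?_
  · exact ((D.caratheodory_g.aemeasurable_comp hu.1.aemeasurable).mul
      hv.1.aemeasurable).aestronglyMeasurable
  · filter_upwards [hm, D.abs_g_le m] with x hxm hg
    have hm0 : 0 ≤ m := (abs_nonneg _).trans hxm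
    rw [norm_mul, Real.norm_eq_abs, Real.norm_eq_abs, Pi.add_apply]
    refine (mul_le_mul_of_nonneg_right (hg _ hxm) (abs_nonneg _)).trans ?_
    rw [mul_assoc]
    exact mul_le_mul_of_nonneg_left
      (rpow_sub_one_mul_le D.one_lt_p.le (abs_nonneg _) (abs_nonneg _)) (by positivity)

end StructureConditions

namespace IsCriticalOn

variable {Ω : Set (RN N)} {u v : RN N → ℝ} {w wv : RN N → RN N} {m : ℝ}

lemma aemeasurable (hu : IsCriticalOn Ω p V A g u w m) : AEMeasurable u volume :=
  hu.grad.memLp.1.aemeasurable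

lemma weakGradient_ae_eq (hu : IsCriticalOn Ω p V A g u w m) (hp : 1 ≤ p) :
    weakGradient univ u =ᵐ[volume] w :=
  (hu.grad.isWeakGradient hp).weakGradient_univ_ae_eq

lemma integrable_potential (hu : IsCriticalOn Ω p V A g u w m) (hp : p ≠ 0) :
    Integrable fun x => V x * |u x| ^ p :=
  hu.mem.integrable_potential hu.isOpen.measurableSet hp

lemma integrable_flux_term (hu : IsCriticalOn Ω p V A g u w m)
    (D : StructureConditions N p V A g α₀ μ q c α₁ α₂ a₁ a₂) (hwv : MemLp wv (ENNReal.ofReal p)) :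
    Integrable fun x => A x (u x) * (inner ℝ (pField p (w x)) (wv x) : ℝ) := by
  obtain ⟨C, -, hC⟩ := D.exists_coeff_bound m
  refine integrable_coeff_mul_inner_pField (C := C) D.one_lt_p
    (D.caratheodory_A.aemeasurable_comp hu.aemeasurable) ?_ hu.grad.memLp_grad hwv
  filter_upwards [hC, hu.bound] with x hA hx using (hA _ hx).1

lemma integrable_deriv_term (hu : IsCriticalOn Ω p V A g u w m)
    (D : StructureConditions N p V A g α₀ μ q c α₁ α₂ a₁ a₂) (hv : MemXOn Ω V p v) :
    Integrable fun x => deriv (A x) (u x) * v x * ‖w x‖ ^ p := by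
  obtain ⟨C, hC0, hC⟩ := D.exists_coeff_bound m
  obtain ⟨mv, hmv⟩ := hv.exists_bound hu.isOpen.measurableSet
  obtain ⟨_, hvw⟩ := hv.exists_isW0Gradient hu.isOpen D.one_lt_p.le
  refine integrable_coeff_mul_rpow (C := C * mv) D.p_pos
    ((D.caratheodory_A.aemeasurable_deriv_comp hu.aemeasurable).mul hvw.memLp.1.aemeasurable)
    ?_ hu.grad.memLp_grad
  filter_upwards [hC, hu.bound, hmv] with x hA hx hvx
  rw [abs_mul]
  exact mul_le_mul (hA _ hx).2 hvx (abs_nonneg _) hC0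

lemma euler_lagrange (hu : IsCriticalOn Ω p V A g u w m) (hp : 1 ≤ p)
    (hwv : IsW0Gradient Ω p v wv) (hv : MemXOn Ω V p v) :
    (∫ x, A x (u x) * (inner ℝ (pField p (w x)) (wv x) : ℝ))
      + (1 / p) * (∫ x, deriv (A x) (u x) * v x * ‖w x‖ ^ p)
      + (∫ x, V x * |u x| ^ (p - 2) * u x * v x) = ∫ x, g x (u x) * v x := by
  rw [← sub_eq_zero, ← hu.critical v hv, energyDifferential]
  have hw := hu.weakGradient_ae_eq hp
  congr 3
  · refine integral_congr_ae ?_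
    filter_upwards [hw, (hwv.isWeakGradient hp).weakGradient_univ_ae_eq] with x hx hxv
    rw [hx, hxv, pField, inner_smul_left, mul_assoc]
    simp only [conj_trivial]
  · congr 1
    exact integral_congr_ae (hw.mono fun x hx => by simp only [hx])

lemma euler_lagrange_self (hu : IsCriticalOn Ω p V A g u w m) (hp : 1 < p) :
    (∫ x, A x (u x) * ‖w x‖ ^ p) + (1 / p) * (∫ x, deriv (A x) (u x) * u x * ‖w x‖ ^ p)
      + (∫ x, V x * |u x| ^ p) = ∫ x, g x (u x) * u x := by
  have hpot : ∀ x, V x * |u x| ^ (p - 2) * u x * u x = V x * |u x| ^ p := fun x => by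
    rw [← rpow_sub_one_mul_self (p := p) (by linarith) (abs_nonneg (u x)),
      ← rpow_sub_two_mul_self hp (abs_nonneg (u x)), mul_assoc (_ ^ _), abs_mul_abs_self]
    ring
  simpa only [inner_pField_self hp, hpot] using hu.euler_lagrange hp.le hu.grad hu.mem

lemma energy_eq (hu : IsCriticalOn Ω p V A g u w m) (hp : 1 ≤ p) :
    energy p V A g u = (1 / p) * (∫ x, A x (u x) * ‖w x‖ ^ p)
      + (1 / p) * (∫ x, V x * |u x| ^ p) - ∫ x, ∫ s in (0 : ℝ)..(u x), g x s := by
  rw [energy]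
  congr 3
  exact integral_congr_ae ((hu.weakGradient_ae_eq hp).mono fun x hx => by simp only [hx])

lemma mul_integral_primitive_le (hu : IsCriticalOn Ω p V A g u w m)
    (D : StructureConditions N p V A g α₀ μ q c α₁ α₂ a₁ a₂) :
    μ * (∫ x, ∫ s in (0 : ℝ)..(u x), g x s) ≤ ∫ x, g x (u x) * u x := by
  rw [← integral_const_mul]
  exact integral_mono_of_nonneg (D.ambrosetti_rabinowitz.mono fun x hx => (hx (u x)).1)
    (D.integrable_g_term hu.grad.memLp hu.grad.memLp hu.bound)
    (D.ambrosetti_rabinowitz.mono fun x hx => (hx (u x)).2)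

lemma coercivity (hu : IsCriticalOn Ω p V A g u w m)
    (D : StructureConditions N p V A g α₀ μ q c α₁ α₂ a₁ a₂) :
    α₁ * α₀ * (∫ x, ‖w x‖ ^ p) ≤ (μ - p) * (∫ x, A x (u x) * ‖w x‖ ^ p)
      - ∫ x, deriv (A x) (u x) * u x * ‖w x‖ ^ p := by
  have hflux : Integrable fun x => A x (u x) * ‖w x‖ ^ p := by
    simpa only [inner_pField_self D.one_lt_p] using hu.integrable_flux_term D hu.grad.memLp_grad
  have hderiv := hu.integrable_deriv_term D hu.mem
  rw [← integral_const_mul, ← integral_const_mul, ← integral_sub (hflux.const_mul _) hderiv]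
  refine integral_mono_ae ((integrable_norm_rpow_of_memLp D.p_pos hu.grad.memLp_grad).const_mul _)
    ((hflux.const_mul _).sub hderiv) ?_
  filter_upwards [D.growth_A, D.le_A] with x hgrowth hA
  have hx : α₁ * α₀ ≤ (μ - p) * A x (u x) - deriv (A x) (u x) * u x :=
    (mul_le_mul_of_nonneg_left (hA (u x)) D.α₁_pos.le).trans (hgrowth (u x))
  calc α₁ * α₀ * ‖w x‖ ^ p
      ≤ ((μ - p) * A x (u x) - deriv (A x) (u x) * u x) * ‖w x‖ ^ p := by gcongr
    _ = (μ - p) * (A x (u x) * ‖w x‖ ^ p) - deriv (A x) (u x) * u x * ‖w x‖ ^ p := by ring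

lemma energy_bound (hu : IsCriticalOn Ω p V A g u w m)
    (D : StructureConditions N p V A g α₀ μ q c α₁ α₂ a₁ a₂) :
    α₁ * α₀ * (∫ x, ‖w x‖ ^ p) + (μ - p) * (∫ x, V x * |u x| ^ p)
      ≤ p * μ * energy p V A g u := by
  have hp0 := D.p_pos
  have hEL := hu.euler_lagrange_self D.one_lt_p
  have hAR := mul_le_mul_of_nonneg_left (hu.mul_integral_primitive_le D) hp0.le
  have hcoer := hu.coercivity D
  rw [hu.energy_eq D.one_lt_p.le]
  generalize (∫ x, A x (u x) * ‖w x‖ ^ p) = a at *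
  generalize (∫ x, deriv (A x) (u x) * u x * ‖w x‖ ^ p) = d at *
  field_simp at hEL ⊢
  linarith

end IsCriticalOn

section LevelEnergy

/-- If `F` has the sign of `t` and `|F| ≤ χ |t|`, then `F = θ t` with `0 ≤ θ ≤ χ`, so
`a χ + d F / p` is at least `a (χ - θ) + (α₂ / p) a θ`. -/
lemma coeff_lower_bound {p α₂ a d t χ F : ℝ} (hp : 0 < p) (ha : 0 ≤ a)
    (h : α₂ * a ≤ p * a + d * t) (hF : 0 ≤ F * t) (hFχ : |F| ≤ χ * |t|) (hχ : 0 ≤ χ) :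
    min 1 (α₂ / p) * a * χ ≤ a * χ + 1 / p * (d * F) := by
  obtain ⟨θ, hθ0, hθχ, rfl⟩ : ∃ θ, 0 ≤ θ ∧ θ ≤ χ ∧ F = θ * t := by
    rcases eq_or_ne t 0 with rfl | ht
    · exact ⟨0, le_rfl, hχ, by simpa using hFχ⟩
    · refine ⟨F / t, ?_, ?_, by field_simp⟩
      · rw [← mul_div_mul_right F t ht]
        exact div_nonneg hF (mul_self_nonneg t)
      · exact (le_abs_self _).trans (by rwa [abs_div, div_le_iff₀ (abs_pos.2 ht)])
  have hlow : (α₂ / p - 1) * a ≤ 1 / p * (d * t) := by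
    field_simp
    linarith
  calc min 1 (α₂ / p) * a * χ
      = min 1 (α₂ / p) * (a * (χ - θ)) + min 1 (α₂ / p) * (a * θ) := by ring
    _ ≤ 1 * (a * (χ - θ)) + α₂ / p * (a * θ) := by
      have : 0 ≤ χ - θ := sub_nonneg.2 hθχ
      gcongr
      exacts [min_le_left _ _, min_le_right _ _]
    _ = a * χ + θ * ((α₂ / p - 1) * a) := by ring
    _ ≤ a * χ + θ * (1 / p * (d * t)) := by gcongr
    _ = a * χ + 1 / p * (d * (θ * t)) := by ring

namespace IsCriticalOn

variable {Ω : Set (RN N)} {u : RN N → ℝ} {w : RN N → RN N} {m h k : ℝ}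

lemma memXOn_levelTrunc (hu : IsCriticalOn Ω p V A g u w m)
    (D : StructureConditions N p V A g α₀ μ q c α₁ α₂ a₁ a₂) (h0 : 0 ≤ h) (hk : h < k) :
    MemXOn Ω V p fun x => levelTrunc h k (u x) := by
  have hgrad := hu.grad.levelTrunc D.one_lt_p.le h k
  refine hgrad.memXOn hu.isOpen D.one_lt_p.le ?_ (C := m) ?_ ?_
  · refine ((hu.integrable_potential D.p_pos.ne').mono' ?_ ?_).integrableOn
    · exact (D.aemeasurable_V.mul
        (hgrad.memLp.1.aemeasurable.norm.pow_const p)).aestronglyMeasurable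
    · filter_upwards [D.V_nonneg] with x hV
      have hp := D.p_pos.le
      rw [Real.norm_of_nonneg (by positivity)]
      gcongr ?_ * ?_ ^ p
      exact abs_levelTrunc_le_abs h0 hk _
  · filter_upwards [hu.bound] with x hx using (abs_levelTrunc_le_abs h0 hk _).trans hx
  · filter_upwards [hu.mem.2.2.2] with x hx hxΩ
    rw [hx hxΩ, levelTrunc_zero]

lemma integrable_levelStep_mul (hu : IsCriticalOn Ω p V A g u w m) (hp : 0 < p) (h k : ℝ) :
    Integrable fun x => levelStep h k (u x) * ‖w x‖ ^ p :=
  integrable_coeff_mul_rpow hp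
    ((continuous_levelStep h k).measurable.comp_aemeasurable hu.aemeasurable) (C := 1)
    (ae_of_all _ fun x => by
      rw [abs_of_nonneg (levelStep_nonneg _ _ _)]
      exact levelStep_le_one _ _ _) hu.grad.memLp_grad

lemma level_coercivity (hu : IsCriticalOn Ω p V A g u w m)
    (D : StructureConditions N p V A g α₀ μ q c α₁ α₂ a₁ a₂) (h0 : 0 ≤ h) (hk : h < k) :
    min 1 (α₂ / p) * α₀ * (∫ x, levelStep h k (u x) * ‖w x‖ ^ p)
      ≤ (∫ x, A x (u x) * (inner ℝ (pField p (w x)) (levelStep h k (u x) • w x) : ℝ))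
        + (1 / p) * ∫ x, deriv (A x) (u x) * levelTrunc h k (u x) * ‖w x‖ ^ p := by
  have hflux := hu.integrable_flux_term D (hu.grad.levelTrunc D.one_lt_p.le h k).memLp_grad
  have hderiv := (hu.integrable_deriv_term D (hu.memXOn_levelTrunc D h0 hk)).const_mul (1 / p)
  rw [← integral_const_mul, ← integral_const_mul, ← integral_add hflux hderiv]
  refine integral_mono_ae ((hu.integrable_levelStep_mul D.p_pos h k).const_mul _)
    (hflux.add hderiv) ?_
  filter_upwards [D.lower_A, D.le_A] with x hlow hA
  have hstep := levelStep_nonneg h k (u x)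
  have hmin : 0 ≤ min 1 (α₂ / p) := le_min zero_le_one (div_nonneg D.α₂_pos.le D.p_pos.le)
  have hcoeff := coeff_lower_bound D.p_pos (D.α₀_pos.le.trans (hA _)) (hlow (u x))
    (levelTrunc_mul_self_nonneg h k (u x)) (abs_levelTrunc_le h0 hk (u x)) hstep
  calc min 1 (α₂ / p) * α₀ * (levelStep h k (u x) * ‖w x‖ ^ p)
      = min 1 (α₂ / p) * α₀ * levelStep h k (u x) * ‖w x‖ ^ p := by ring
    _ ≤ min 1 (α₂ / p) * A x (u x) * levelStep h k (u x) * ‖w x‖ ^ p := by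
      gcongr
      exact hA _
    _ ≤ _ := mul_le_mul_of_nonneg_right hcoeff (by positivity)
    _ = _ := by
      rw [inner_smul_right, inner_pField_self D.one_lt_p]
      ring

lemma integrableOn_rpow_superlevel (hu : IsCriticalOn Ω p V A g u w m) (hp : 0 < p)
    (hpq : p ≤ q) (hh : 0 ≤ h) : IntegrableOn (fun x => |u x| ^ q) {x | h < |u x|} := by
  refine (((integrable_norm_rpow_of_memLp hp hu.grad.memLp).const_mul
    (m ^ (q - p))).integrableOn (s := {x | h < |u x|})).mono'
    (hu.aemeasurable.norm.pow_const q).aestronglyMeasurable.restrict ?_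
  filter_upwards [ae_restrict_of_ae hu.bound,
    ae_restrict_mem₀ (nullMeasurableSet_superlevel hu.aemeasurable h)] with x hxm hxh
  have hpos : 0 < |u x| := hh.trans_lt hxh
  have hsplit : |u x| ^ q = |u x| ^ (q - p) * |u x| ^ p := by
    rw [← Real.rpow_add hpos, sub_add_cancel]
  rw [Real.norm_of_nonneg (by positivity), hsplit, Real.norm_eq_abs]
  gcongr

lemma excess_eq_ofReal (hu : IsCriticalOn Ω p V A g u w m) (hp : 0 < p) (hpq : p ≤ q)
    (hh : 0 ≤ h) :
    excess volume u q h = ENNReal.ofReal (∫ x in {x | h < |u x|}, |u x| ^ q) := by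
  rw [ofReal_integral_eq_lintegral_ofReal (hu.integrableOn_rpow_superlevel hp hpq hh)
    (ae_of_all _ fun x => by positivity), excess]
  congr 1 with x
  rw [← ENNReal.ofReal_rpow_of_nonneg (abs_nonneg _) (by linarith), ← Real.norm_eq_abs,
    ofReal_norm]

lemma integral_g_levelTrunc_le (hu : IsCriticalOn Ω p V A g u w m)
    (D : StructureConditions N p V A g α₀ μ q c α₁ α₂ a₁ a₂) (hh : 1 ≤ h) (hk : h < k) :
    ∫ x, g x (u x) * levelTrunc h k (u x)
      ≤ (a₁ + a₂) * ∫ x in {x | h < |u x|}, |u x| ^ q := by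
  have hp := D.one_lt_p
  have hpq := D.p_le_q
  have ha₁ := D.a₁_nonneg
  have ha₂ := D.a₂_nonneg
  have h0 : 0 ≤ h := by linarith
  rw [← setIntegral_eq_integral_of_forall_compl_eq_zero (s := {x | h < |u x|}) fun x hx => by
    rw [levelTrunc_eq_zero h0 hk (not_lt.1 hx), mul_zero], ← integral_const_mul]
  refine integral_mono_ae (D.integrable_g_term hu.grad.memLp
      (hu.grad.levelTrunc hp.le h k).memLp hu.bound).integrableOn
    ((hu.integrableOn_rpow_superlevel D.p_pos hpq h0).const_mul _) ?_
  filter_upwards [ae_restrict_of_ae D.bound_g,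
    ae_restrict_mem₀ (nullMeasurableSet_superlevel hu.aemeasurable h)] with x hg hx
  have hu1 : 1 ≤ |u x| := hh.trans hx.le
  calc g x (u x) * levelTrunc h k (u x)
      ≤ |g x (u x)| * |levelTrunc h k (u x)| := by
        rw [← abs_mul]
        exact le_abs_self _
    _ ≤ (a₁ * |u x| ^ (q - 1) + a₂ * |u x| ^ (q - 1)) * |u x| := by
        refine mul_le_mul ((hg _).trans ?_) (abs_levelTrunc_le_abs h0 hk _) (abs_nonneg _)
          (by positivity)
        gcongr
    _ = (a₁ + a₂) * |u x| ^ q := by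
        rw [← add_mul, mul_assoc, rpow_sub_one_mul_self (by linarith) (abs_nonneg _)]

lemma integral_levelStep_smul_rpow_le (hu : IsCriticalOn Ω p V A g u w m)
    (D : StructureConditions N p V A g α₀ μ q c α₁ α₂ a₁ a₂) (hh : 1 ≤ h) (hk : h < k) :
    ∫ x, ‖levelStep h k (u x) • w x‖ ^ p
      ≤ (a₁ + a₂) / (min 1 (α₂ / p) * α₀) * ∫ x in {x | h < |u x|}, |u x| ^ q := by
  have hp := D.one_lt_p
  have h0 : 0 ≤ h := by linarith
  have hκ : 0 < min 1 (α₂ / p) * α₀ :=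
    mul_pos (lt_min one_pos (div_pos D.α₂_pos D.p_pos)) D.α₀_pos
  have hgrad := hu.grad.levelTrunc hp.le h k
  have hstep : ∫ x, ‖levelStep h k (u x) • w x‖ ^ p ≤ ∫ x, levelStep h k (u x) * ‖w x‖ ^ p := by
    refine integral_mono (integrable_norm_rpow_of_memLp D.p_pos hgrad.memLp_grad)
      (hu.integrable_levelStep_mul D.p_pos h k) fun x => ?_
    have hs0 := levelStep_nonneg h k (u x)
    simp only [norm_smul, Real.norm_of_nonneg hs0, Real.mul_rpow hs0 (norm_nonneg _)]
    gcongr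
    exact Real.rpow_le_self_of_le_one hs0 (levelStep_le_one _ _ _) hp.le
  have hpot : 0 ≤ ∫ x, V x * |u x| ^ (p - 2) * u x * levelTrunc h k (u x) := by
    refine integral_nonneg_of_ae ?_
    filter_upwards [D.V_nonneg] with x hV
    rw [Pi.zero_apply, mul_assoc, mul_comm (u x)]
    exact mul_nonneg (by positivity) (levelTrunc_mul_self_nonneg h k (u x))
  have hEL := hu.euler_lagrange hp.le hgrad (hu.memXOn_levelTrunc D h0 hk)
  refine hstep.trans ?_
  rw [div_mul_eq_mul_div, le_div_iff₀ hκ, mul_comm]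
  linarith [hu.level_coercivity D h0 hk, hu.integral_g_levelTrunc_le D hh hk]

lemma level_energy (hu : IsCriticalOn Ω p V A g u w m)
    (D : StructureConditions N p V A g α₀ μ q c α₁ α₂ a₁ a₂) (hh : 1 ≤ h) (hk : h < k) :
    eLpNorm (fun x => levelStep h k (u x) • w x) (ENNReal.ofReal p)
      ≤ (ENNReal.ofReal ((a₁ + a₂) / (min 1 (α₂ / p) * α₀)) * excess volume u q h) ^ (1 / p) := by
  have hp := D.p_pos
  have hκ : 0 ≤ (a₁ + a₂) / (min 1 (α₂ / p) * α₀) :=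
    div_nonneg (add_nonneg D.a₁_nonneg D.a₂_nonneg)
      (mul_nonneg (le_min zero_le_one (div_pos D.α₂_pos hp).le) D.α₀_pos.le)
  have hsuper : 0 ≤ ∫ x in {x | h < |u x|}, |u x| ^ q := integral_nonneg fun x => by positivity
  rw [eLpNorm_eq_ofReal_integral hp (hu.grad.levelTrunc D.one_lt_p.le h k).memLp_grad,
    hu.excess_eq_ofReal hp D.p_le_q (by linarith), ← ENNReal.ofReal_mul hκ,
    ENNReal.ofReal_rpow_of_nonneg (mul_nonneg hκ hsuper) (by positivity)]
  gcongr
  exact hu.integral_levelStep_smul_rpow_le D hh hk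

end IsCriticalOn

end LevelEnergy

end CriticalPoints

section WeakStrongPairing

variable {α : Type*} [MeasurableSpace α] {ν : Measure α}

lemma holderConjugate_ofReal {p : ℝ} (hp : 1 < p) :
    ENNReal.HolderConjugate (ENNReal.ofReal (p / (p - 1))) (ENNReal.ofReal p) :=
  (Real.HolderConjugate.conjExponent hp).symm.ennrealOfReal

section PField

variable {E : Type*} [NormedAddCommGroup E] [InnerProductSpace ℝ E] {p : ℝ}

lemma eLpNorm_pField (hp : 1 < p) (w : α → E) :
    eLpNorm (fun x => pField p (w x)) (ENNReal.ofReal (p / (p - 1))) ν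
      = eLpNorm w (ENNReal.ofReal p) ν ^ (p - 1) := by
  have hp1 : 0 < p - 1 := by linarith
  calc eLpNorm (fun x => pField p (w x)) (ENNReal.ofReal (p / (p - 1))) ν
      = eLpNorm (fun x => ‖w x‖ ^ (p - 1)) (ENNReal.ofReal (p / (p - 1))) ν :=
        eLpNorm_congr_norm_ae (ae_of_all _ fun x => by
          rw [norm_pField hp, Real.norm_of_nonneg (by positivity)])
    _ = eLpNorm w (ENNReal.ofReal p) ν ^ (p - 1) := by
        rw [eLpNorm_norm_rpow w hp1, ← ENNReal.ofReal_mul (by positivity),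
          div_mul_cancel₀ _ hp1.ne']

lemma memLp_pField (hp : 1 < p) {w : α → E} (hw : MemLp w (ENNReal.ofReal p) ν) :
    MemLp (fun x => pField p (w x)) (ENNReal.ofReal (p / (p - 1))) ν := by
  refine ⟨(continuous_pField hp).comp_aestronglyMeasurable hw.1, ?_⟩
  rw [eLpNorm_pField hp]
  exact ENNReal.rpow_lt_top_of_nonneg (by linarith) hw.2.ne

lemma integrable_pGap (hp : 1 < p) {f g : α → E} (hf : MemLp f (ENNReal.ofReal p) ν)
    (hg : MemLp g (ENNReal.ofReal p) ν) : Integrable (fun x => pGap p (f x) (g x)) ν := by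
  have := holderConjugate_ofReal hp
  exact integrable_inner_of_memLp ((memLp_pField hp hf).sub (memLp_pField hp hg)) (hf.sub hg)

end PField

lemma tendsto_eLpNorm_smul_zero {G : Type*} [NormedAddCommGroup G] [NormedSpace ℝ G]
    {P : ENNReal} (hP : P ≠ ⊤) {a : ℕ → α → ℝ} {h : α → G} {C : ℝ}
    (ha : ∀ n, AEMeasurable (a n) ν) (hC : ∀ n, ∀ᵐ x ∂ν, |a n x| ≤ C) (hh : MemLp h P ν)
    (hlim : ∀ᵐ x ∂ν, Tendsto (fun n => a n x) atTop (𝓝 0)) :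
    Tendsto (fun n => eLpNorm (fun x => a n x • h x) P ν) atTop (𝓝 0) := by
  refine tendsto_eLpNorm_zero_of_dominated hP (g := C • h)
    (fun n => (ha n).aestronglyMeasurable.smul hh.1) (hh.const_smul C) (fun n => ?_) ?_
  · filter_upwards [hC n] with x hx
    rw [norm_smul, Pi.smul_apply, norm_smul]
    gcongr
    exact hx.trans (le_abs_self C)
  · filter_upwards [hlim] with x hx
    simpa only [zero_smul] using hx.smul_const (h x)

variable {G : Type*} [NormedAddCommGroup G] [InnerProductSpace ℝ G]
  {P Q : ENNReal} [ENNReal.HolderConjugate Q P]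

lemma tendsto_integral_inner_zero {f g : ℕ → α → G} {B : ENNReal} (hB : B ≠ ⊤)
    (hf : ∀ n, MemLp (f n) Q ν) (hfB : ∀ n, eLpNorm (f n) Q ν ≤ B) (hg : ∀ n, MemLp (g n) P ν)
    (hlim : Tendsto (fun n => eLpNorm (g n) P ν) atTop (𝓝 0)) :
    Tendsto (fun n => ∫ x, (inner ℝ (f n x) (g n x) : ℝ) ∂ν) atTop (𝓝 0) := by
  have hbound : Tendsto (fun n => B.toReal * (eLpNorm (g n) P ν).toReal) atTop (𝓝 0) := by
    simpa using ((ENNReal.tendsto_toReal ENNReal.zero_ne_top).comp hlim).const_mul B.toReal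
  refine squeeze_zero_norm (fun n => ?_) hbound
  refine (abs_integral_inner_le (hf n) (hg n)).trans ?_
  gcongr
  exact hfB n

lemma tendsto_integral_coeff_mul_inner_zero (hP : P ≠ ⊤) {a : ℕ → α → ℝ} {C : ℝ}
    (ha : ∀ n, AEMeasurable (a n) ν) (hC : ∀ n, ∀ᵐ x ∂ν, |a n x| ≤ C)
    (hlim : ∀ᵐ x ∂ν, Tendsto (fun n => a n x) atTop (𝓝 0)) {f : ℕ → α → G} {B : ENNReal}
    (hB : B ≠ ⊤) (hf : ∀ n, MemLp (f n) Q ν) (hfB : ∀ n, eLpNorm (f n) Q ν ≤ B) {h : α → G}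
    (hh : MemLp h P ν) :
    Tendsto (fun n => ∫ x, a n x * (inner ℝ (f n x) (h x) : ℝ) ∂ν) atTop (𝓝 0) := by
  have hmem : ∀ n, MemLp (fun x => a n x • h x) P ν := fun n =>
    hh.smul (memLp_top_of_bound (ha n).aestronglyMeasurable C (hC n))
  simpa only [inner_smul_right] using
    tendsto_integral_inner_zero hB hf hfB hmem (tendsto_eLpNorm_smul_zero hP ha hC hh hlim)

lemma tendsto_integral_coeff_mul_inner_of_weak (hQ : Q ≠ ⊤) {a : ℕ → α → ℝ} {a₀ : α → ℝ} {C : ℝ}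
    (ha : ∀ n, AEMeasurable (a n) ν) (hC : ∀ n, ∀ᵐ x ∂ν, |a n x| ≤ C)
    (hlim : ∀ᵐ x ∂ν, Tendsto (fun n => a n x) atTop (𝓝 (a₀ x))) {g : ℕ → α → G} {B : ENNReal}
    (hB : B ≠ ⊤) (hg : ∀ n, MemLp (g n) P ν) (hgB : ∀ n, eLpNorm (g n) P ν ≤ B)
    (hweak : ∀ f, MemLp f Q ν → Tendsto (fun n => ∫ x, (inner ℝ (f x) (g n x) : ℝ) ∂ν) atTop (𝓝 0))
    {h : α → G} (hh : MemLp h Q ν) :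
    Tendsto (fun n => ∫ x, a n x * (inner ℝ (h x) (g n x) : ℝ) ∂ν) atTop (𝓝 0) := by
  have hPQ : ENNReal.HolderConjugate P Q := ENNReal.HolderConjugate.symm
  have ha₀ : AEMeasurable a₀ ν := aemeasurable_of_tendsto_metrizable_ae atTop ha hlim
  have hC₀ : ∀ᵐ x ∂ν, |a₀ x| ≤ C := by
    filter_upwards [ae_all_iff.2 hC, hlim] with x hx hxlim
    exact le_of_tendsto hxlim.abs (Eventually.of_forall hx)
  have hstrong : Tendsto (fun n => ∫ x, (a n x - a₀ x) * (inner ℝ (g n x) (h x) : ℝ) ∂ν)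
      atTop (𝓝 0) := by
    refine tendsto_integral_coeff_mul_inner_zero (C := C + C) hQ (fun n => (ha n).sub ha₀)
      (fun n => ?_) ?_ hB hg hgB hh
    · filter_upwards [hC n, hC₀] with x hx hx₀ using (abs_sub _ _).trans (add_le_add hx hx₀)
    · filter_upwards [hlim] with x hx
      simpa only [Pi.sub_apply, sub_self] using hx.sub_const (a₀ x)
  have hmem : ∀ {b : α → ℝ} {D : ℝ}, AEMeasurable b ν → (∀ᵐ x ∂ν, |b x| ≤ D) →
      MemLp (fun x => b x • h x) Q ν := fun hb hD =>
    hh.smul (memLp_top_of_bound hb.aestronglyMeasurable _ hD)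
  have hsum := hstrong.add (hweak _ (hmem ha₀ hC₀))
  rw [add_zero] at hsum
  refine hsum.congr fun n => ?_
  have hi := integrable_inner_of_memLp (hmem (ha n) (hC n)) (hg n)
  have hi₀ := integrable_inner_of_memLp (hmem ha₀ hC₀) (hg n)
  simp only [inner_smul_left, conj_trivial] at hi hi₀ ⊢
  simp only [real_inner_comm (h _), sub_mul]
  rw [integral_sub hi hi₀, sub_add_cancel]

end WeakStrongPairing

section LocalCompactness

/-- The function is a truncation of `sinh ((κ + 1) t)`. -/
lemma exists_exponential_test_function {κ m : ℝ} (hκ : 0 ≤ κ) (hm : 0 ≤ m) :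
    ∃ F : ℝ → ℝ, ContDiff ℝ ∞ F ∧ HasCompactSupport F ∧ F 0 = 0 ∧
      ∀ t, |t| ≤ m → 1 ≤ deriv F t - κ * |F t| := by
  let χ : ContDiffBump (0 : ℝ) := ⟨m + 1, m + 2, by linarith, by linarith⟩
  refine ⟨fun t => χ t * Real.sinh ((κ + 1) * t),
    χ.contDiff.mul (Real.contDiff_sinh.comp (contDiff_const.mul contDiff_id)),
    χ.hasCompactSupport.mul_right, by simp, fun t ht => ?_⟩
  have hlocal : (fun t => χ t * Real.sinh ((κ + 1) * t)) =ᶠ[𝓝 t]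
      fun t => Real.sinh ((κ + 1) * t) := by
    have hnear : ∀ᶠ s in 𝓝 t, |s| < m + 1 :=
      continuous_abs.continuousAt.eventually (gt_mem_nhds (by linarith))
    filter_upwards [hnear] with s hs
    rw [χ.one_of_mem_closedBall (by simpa using hs.le), one_mul]
  have hderiv : HasDerivAt (fun t => Real.sinh ((κ + 1) * t))
      (Real.cosh ((κ + 1) * t) * ((κ + 1) * 1)) t :=
    (Real.hasDerivAt_sinh _).comp t ((hasDerivAt_id t).const_mul (κ + 1))
  have hsinh : |Real.sinh ((κ + 1) * t)| ≤ Real.cosh ((κ + 1) * t) := by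
    rw [Real.abs_sinh, ← Real.cosh_abs]
    exact (Real.sinh_lt_cosh _).le
  rw [hlocal.deriv_eq, hderiv.deriv]
  simp only [hlocal.eq_of_nhds]
  linarith [Real.one_le_cosh ((κ + 1) * t), mul_le_mul_of_nonneg_left hsinh hκ]

variable {N : ℕ}

lemma exists_cutoff {R : ℝ} (hR : 0 < R) : ∃ η : RN N → ℝ,
    IsTestFunction (closedBall 0 (R + 1)) η ∧ (∀ x, 0 ≤ η x) ∧ ∀ x ∈ ball 0 R, η x = 1 := by
  let χ : ContDiffBump (0 : RN N) := ⟨R, R + 1, hR, by linarith⟩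
  exact ⟨χ, ⟨χ.contDiff, χ.hasCompactSupport, χ.tsupport_eq.subset⟩, fun x => χ.nonneg,
    fun x hx => χ.one_of_mem_closedBall (ball_subset_closedBall hx)⟩

lemma IsTestFunction.memLp_smul {K : Set (RN N)} {η : RN N → ℝ} (hη : IsTestFunction K η)
    {P : ENNReal} {f : RN N → RN N} (hf : MemLp f P) : MemLp (fun x => η x • f x) P :=
  hf.smul (hη.memLp (P := ⊤))

/-- The quadratic-growth term `b ‖w‖ ^ p` is absorbed because `F' - κ |F| ≥ 1`; here `s` and `s'`
stand for the values of `F` and `F'`, and `t` and `e` for those of the cutoff and its gradient. -/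
lemma mul_pGap_le {E : Type*} [NormedAddCommGroup E] [InnerProductSpace ℝ E] {p : ℝ} (hp : 1 < p)
    {α a b κ s s' t : ℝ} {w w₀ e : E} (hα : 0 ≤ α) (ha : α ≤ a) (hb : |b| ≤ p * κ * a)
    (hs : 1 ≤ s' - κ * |s|) (ht : 0 ≤ t) :
    α * (t * pGap p w w₀) ≤
      a * inner ℝ (pField p w) (t • s' • (w - w₀) + s • e) + 1 / p * (b * (t * s) * ‖w‖ ^ p)
      - a * s * inner ℝ (pField p w) e + a * (κ * |s|) * inner ℝ (pField p w) (t • w₀)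
      - a * (s' - κ * |s|) * inner ℝ (t • pField p w₀) (w - w₀) := by
  have : 0 < p := by linarith
  have hgap : pGap p w w₀ = inner ℝ (pField p w) (w - w₀) - inner ℝ (pField p w₀) (w - w₀) := by
    rw [pGap, inner_sub_left]
  have hpow : ‖w‖ ^ p = inner ℝ (pField p w) (w - w₀) + inner ℝ (pField p w) w₀ := by
    rw [← inner_add_right, sub_add_cancel, inner_pField_self hp]
  have habsorb : -(a * (κ * |s|) * t * ‖w‖ ^ p) ≤ 1 / p * (b * (t * s) * ‖w‖ ^ p) := by
    have hbs : -(p * κ * a * |s|) ≤ b * s := by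
      refine (neg_le_neg ?_).trans (neg_abs_le _)
      rw [abs_mul]
      gcongr
    calc -(a * (κ * |s|) * t * ‖w‖ ^ p) = 1 / p * (-(p * κ * a * |s|) * (t * ‖w‖ ^ p)) := by
          field_simp
      _ ≤ 1 / p * (b * s * (t * ‖w‖ ^ p)) := by gcongr
      _ = 1 / p * (b * (t * s) * ‖w‖ ^ p) := by ring
  have helliptic : α * (t * pGap p w w₀) ≤ a * (s' - κ * |s|) * (t * pGap p w w₀) := by
    have := mul_nonneg ht (pGap_nonneg hp w w₀)
    gcongr
    exact ha.trans (le_mul_of_one_le_right (hα.trans ha) hs)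
  refine helliptic.trans ?_
  rw [hpow] at habsorb ⊢
  simp only [hgap, inner_add_right, inner_smul_right, inner_smul_left, conj_trivial] at habsorb ⊢
  linarith

/-- A sequence of critical points `U n` on open sets `Ω n`, with `|U n| ≤ M` and with gradients
`w n` bounded by `B` in `L^p`, converging to `u₀` weakly in `W_V^{1,p}(ℝ^N)` and almost
everywhere. -/
structure IsConvergentCriticalSeq (p : ℝ) (V : RN N → ℝ) (A g : RN N → ℝ → ℝ)
    (Ω : ℕ → Set (RN N)) (U : ℕ → RN N → ℝ) (w : ℕ → RN N → RN N) (M : ℝ) (B : ENNReal)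
    (u₀ : RN N → ℝ) : Prop where
  critical : ∀ n, IsCriticalOn (Ω n) p V A g (U n) (w n) M
  bound_ne_top : B ≠ ⊤
  eLpNorm_grad_le : ∀ n, eLpNorm (w n) (ENNReal.ofReal p) ≤ B
  weak : WeaklyConvergesWV univ V p U u₀
  ae_tendsto : ∀ᵐ x, Tendsto (fun n => U n x) atTop (𝓝 (u₀ x))

namespace IsConvergentCriticalSeq

variable {p : ℝ} {V : RN N → ℝ} {A g : RN N → ℝ → ℝ} {α₀ μ q c α₁ α₂ a₁ a₂ : ℝ}
  {Ω : ℕ → Set (RN N)} {U : ℕ → RN N → ℝ} {w : ℕ → RN N → RN N} {M : ℝ} {B : ENNReal}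
  {u₀ : RN N → ℝ}

lemma memLp_limit (h : IsConvergentCriticalSeq p V A g Ω U w M B u₀) :
    MemLp u₀ (ENNReal.ofReal p) := by
  simpa only [Measure.restrict_univ] using h.weak.2.1.1.1

lemma memLp_grad_limit (h : IsConvergentCriticalSeq p V A g Ω U w M B u₀) :
    MemLp (weakGradient univ u₀) (ENNReal.ofReal p) := by
  simpa only [Measure.restrict_univ] using h.weak.2.1.1.memLp_weakGradient isOpen_univ

lemma memLp_grad_sub (h : IsConvergentCriticalSeq p V A g Ω U w M B u₀) (n : ℕ) :
    MemLp (w n - weakGradient univ u₀) (ENNReal.ofReal p) :=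
  (h.critical n).grad.memLp_grad.sub h.memLp_grad_limit

lemma isWeakGradient_sub (h : IsConvergentCriticalSeq p V A g Ω U w M B u₀) (hp : 1 ≤ p) (n : ℕ) :
    IsWeakGradient univ (U n - u₀) (w n - weakGradient univ u₀) :=
  ((h.critical n).grad.isWeakGradient hp).sub h.weak.2.1.1.isWeakGradient_weakGradient

lemma aemeasurable_sub (h : IsConvergentCriticalSeq p V A g Ω U w M B u₀) (n : ℕ) :
    AEMeasurable (fun x => U n x - u₀ x) volume :=
  (h.critical n).aemeasurable.sub h.memLp_limit.1.aemeasurable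

lemma ae_abs_sub_le (h : IsConvergentCriticalSeq p V A g Ω U w M B u₀) :
    ∀ᵐ x, ∀ n, |U n x - u₀ x| ≤ 2 * M := by
  filter_upwards [ae_all_iff.2 fun n => (h.critical n).bound, h.ae_tendsto] with x hU hlim n
  have hu₀ : |u₀ x| ≤ M := le_of_tendsto hlim.abs (Eventually.of_forall hU)
  linarith [abs_sub (U n x) (u₀ x), hU n]

lemma ae_tendsto_comp_sub (h : IsConvergentCriticalSeq p V A g Ω U w M B u₀) {ψ : ℝ → ℝ}
    (hψ : Continuous ψ) : ∀ᵐ x, Tendsto (fun n => ψ (U n x - u₀ x)) atTop (𝓝 (ψ 0)) := by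
  filter_upwards [h.ae_tendsto] with x hx
  refine (hψ.tendsto 0).comp ?_
  simpa only [sub_self] using hx.sub_const (u₀ x)

lemma exists_abs_comp_sub_le (h : IsConvergentCriticalSeq p V A g Ω U w M B u₀) {ψ : ℝ → ℝ}
    (hψ : Continuous ψ) : ∃ C, ∀ᵐ x, ∀ n, |ψ (U n x - u₀ x)| ≤ C := by
  obtain ⟨C, hC⟩ := (isCompact_Icc (a := -(2 * M)) (b := 2 * M)).exists_bound_of_continuousOn
    hψ.continuousOn
  exact ⟨C, h.ae_abs_sub_le.mono fun x hx n => hC _ (abs_le.1 (hx n))⟩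

lemma tendsto_integral_inner_grad_sub (h : IsConvergentCriticalSeq p V A g Ω U w M B u₀)
    (D : StructureConditions N p V A g α₀ μ q c α₁ α₂ a₁ a₂) {f : RN N → RN N}
    (hf : MemLp f (ENNReal.ofReal (p / (p - 1)))) :
    Tendsto (fun n => ∫ x, (inner ℝ (f x) ((w n - weakGradient univ u₀) x) : ℝ)) atTop (𝓝 0) := by
  have := holderConjugate_ofReal D.one_lt_p
  have hdual : IsDualWV univ V p fun v => ∫ x, (inner ℝ (f x) (weakGradient univ v x) : ℝ) := by
    simpa only [Measure.restrict_univ] using isDualWV_integral_inner_weakGradient (V := V)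
      D.p_pos isOpen_univ (ae_restrict_of_ae D.V_nonneg) (hf.restrict univ)
  have hlim := (h.weak.2.2 _ hdual).sub_const (∫ x, (inner ℝ (f x) (weakGradient univ u₀ x) : ℝ))
  rw [sub_self] at hlim
  refine hlim.congr fun n => ?_
  have hgrad : ∫ x, (inner ℝ (f x) (weakGradient univ (U n) x) : ℝ)
      = ∫ x, (inner ℝ (f x) (w n x) : ℝ) :=
    integral_congr_ae (((h.critical n).weakGradient_ae_eq D.one_lt_p.le).mono fun x hx => by
      simp only [hx])
  rw [hgrad, ← integral_sub (integrable_inner_of_memLp hf (h.critical n).grad.memLp_grad)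
    (integrable_inner_of_memLp hf h.memLp_grad_limit)]
  simp only [Pi.sub_apply, inner_sub_right]

lemma aemeasurable_coeff (h : IsConvergentCriticalSeq p V A g Ω U w M B u₀)
    (hA : IsCaratheodory 1 A) {ψ : ℝ → ℝ} (hψ : Continuous ψ) (n : ℕ) :
    AEMeasurable (fun x => A x (U n x) * ψ (U n x - u₀ x)) volume :=
  (hA.aemeasurable_comp (h.critical n).aemeasurable).mul
    (hψ.measurable.comp_aemeasurable (h.aemeasurable_sub n))

lemma exists_abs_coeff_le (h : IsConvergentCriticalSeq p V A g Ω U w M B u₀)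
    (D : StructureConditions N p V A g α₀ μ q c α₁ α₂ a₁ a₂) {ψ : ℝ → ℝ} (hψ : Continuous ψ) :
    ∃ C, ∀ n, ∀ᵐ x, |A x (U n x) * ψ (U n x - u₀ x)| ≤ C := by
  obtain ⟨CA, hCA0, hCA⟩ := D.exists_coeff_bound M
  obtain ⟨L, hL⟩ := h.exists_abs_comp_sub_le hψ
  refine ⟨CA * L, fun n => ?_⟩
  filter_upwards [hCA, (h.critical n).bound, hL] with x hA hU hψx
  rw [abs_mul]
  exact mul_le_mul (hA _ hU).1 (hψx n) (abs_nonneg _) hCA0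

lemma ae_tendsto_coeff (h : IsConvergentCriticalSeq p V A g Ω U w M B u₀)
    (hA : IsCaratheodory 1 A) {ψ : ℝ → ℝ} (hψ : Continuous ψ) :
    ∀ᵐ x, Tendsto (fun n => A x (U n x) * ψ (U n x - u₀ x)) atTop (𝓝 (A x (u₀ x) * ψ 0)) := by
  filter_upwards [hA.ae_continuous, h.ae_tendsto, h.ae_tendsto_comp_sub hψ] with x hAx hU hψx
  exact ((hAx.tendsto _).comp hU).mul hψx

lemma tendsto_integral_flux_zero (h : IsConvergentCriticalSeq p V A g Ω U w M B u₀)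
    (D : StructureConditions N p V A g α₀ μ q c α₁ α₂ a₁ a₂) {ψ : ℝ → ℝ} (hψ : Continuous ψ)
    (hψ0 : ψ 0 = 0) {f : RN N → RN N} (hf : MemLp f (ENNReal.ofReal p)) :
    Tendsto (fun n => ∫ x, A x (U n x) * ψ (U n x - u₀ x) * (inner ℝ (pField p (w n x)) (f x) : ℝ))
      atTop (𝓝 0) := by
  have hp := D.one_lt_p
  have := holderConjugate_ofReal hp
  obtain ⟨C, hC⟩ := h.exists_abs_coeff_le D hψ
  refine tendsto_integral_coeff_mul_inner_zero ENNReal.ofReal_ne_top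
    (h.aemeasurable_coeff D.caratheodory_A hψ) hC ?_
    (ENNReal.rpow_ne_top_of_nonneg (sub_nonneg.2 hp.le) h.bound_ne_top)
    (fun n => memLp_pField hp (h.critical n).grad.memLp_grad) (fun n => ?_) hf
  · simpa only [hψ0, mul_zero] using h.ae_tendsto_coeff D.caratheodory_A hψ
  · rw [eLpNorm_pField hp]
    exact ENNReal.rpow_le_rpow (h.eLpNorm_grad_le n) (sub_nonneg.2 hp.le)

lemma tendsto_integral_coeff_mul_inner_grad_sub
    (h : IsConvergentCriticalSeq p V A g Ω U w M B u₀)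
    (D : StructureConditions N p V A g α₀ μ q c α₁ α₂ a₁ a₂) {ψ : ℝ → ℝ} (hψ : Continuous ψ)
    {f : RN N → RN N} (hf : MemLp f (ENNReal.ofReal (p / (p - 1)))) :
    Tendsto (fun n => ∫ x, A x (U n x) * ψ (U n x - u₀ x)
      * (inner ℝ (f x) ((w n - weakGradient univ u₀) x) : ℝ)) atTop (𝓝 0) := by
  have := holderConjugate_ofReal D.one_lt_p
  obtain ⟨C, hC⟩ := h.exists_abs_coeff_le D hψ
  exact tendsto_integral_coeff_mul_inner_of_weak ENNReal.ofReal_ne_top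
    (h.aemeasurable_coeff D.caratheodory_A hψ) hC (h.ae_tendsto_coeff D.caratheodory_A hψ)
    (ENNReal.add_ne_top.2 ⟨h.bound_ne_top, h.memLp_grad_limit.2.ne⟩) h.memLp_grad_sub
    (fun n => (eLpNorm_sub_le (h.critical n).grad.memLp_grad.1 h.memLp_grad_limit.1
      (by simpa using D.one_lt_p.le)).trans (add_le_add_left (h.eLpNorm_grad_le n) _))
    (fun _ hf => h.tendsto_integral_inner_grad_sub D hf) hf

lemma tendsto_integral_zero_of_abs_le (h : IsConvergentCriticalSeq p V A g Ω U w M B u₀)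
    {η : RN N → ℝ} (hη : Integrable η) {F : ℝ → ℝ} (hF : Continuous F) (hF0 : F 0 = 0)
    {e : ℕ → RN N → ℝ} (he : ∀ n, AEStronglyMeasurable (e n) volume) {C : ℝ}
    (hle : ∀ᵐ x, ∀ n, |e n x| ≤ C * |η x * F (U n x - u₀ x)|) :
    Tendsto (fun n => ∫ x, e n x) atTop (𝓝 0) := by
  obtain ⟨L, hL⟩ := h.exists_abs_comp_sub_le hF
  rw [← integral_zero (RN N) ℝ]
  refine tendsto_integral_of_dominated_convergence (fun x => |C| * (|η x| * L)) he
    ((hη.abs.mul_const L).const_mul |C|) (fun n => ?_) ?_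
  · filter_upwards [hle, hL] with x hx hLx
    refine (hx n).trans ?_
    rw [abs_mul]
    gcongr
    exacts [le_abs_self C, hLx n]
  · filter_upwards [hle, h.ae_tendsto_comp_sub hF] with x hx hFx
    refine squeeze_zero_norm hx ?_
    simpa only [hF0, mul_zero, abs_zero] using ((hFx.const_mul (η x)).abs.const_mul C)

section TestFunction

variable {K : Set (RN N)} {CV : ℝ} {η : RN N → ℝ} {F : ℝ → ℝ} {n : ℕ}

lemma isW0Gradient_testFunction (h : IsConvergentCriticalSeq p V A g Ω U w M B u₀) (hp : 1 ≤ p)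
    (hη : IsTestFunction K η) (hF : ContDiff ℝ ∞ F) (hFc : HasCompactSupport F) (hF0 : F 0 = 0) :
    IsW0Gradient K p (fun x => η x * F (U n x - u₀ x)) (fun x =>
      η x • deriv F (U n x - u₀ x) • (w n - weakGradient univ u₀) x
        + F (U n x - u₀ x) • gradient η x) := by
  obtain ⟨L, hL⟩ := hFc.deriv.exists_bound_of_continuous (hF.continuous_deriv (by simp))
  obtain ⟨φ, hφ⟩ := IsSmoothApprox.exists_of_isWeakGradient (by simpa using hp)
    ENNReal.ofReal_ne_top ((h.critical n).grad.memLp.sub h.memLp_limit) (h.memLp_grad_sub n)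
    (h.isWeakGradient_sub hp n)
  exact hφ.isW0Gradient_mul_comp hp hη hF hF0 hL

lemma memXOn_testFunction (h : IsConvergentCriticalSeq p V A g Ω U w M B u₀)
    (D : StructureConditions N p V A g α₀ μ q c α₁ α₂ a₁ a₂)
    (hVK : ∀ᵐ x, x ∈ K → V x ≤ CV) (hη : IsTestFunction K η) (hF : ContDiff ℝ ∞ F)
    (hFc : HasCompactSupport F) (hF0 : F 0 = 0) (hKΩ : K ⊆ Ω n) :
    MemXOn (Ω n) V p fun x => η x * F (U n x - u₀ x) := by
  have hv := h.isW0Gradient_testFunction (n := n) D.one_lt_p.le (hη.mono hKΩ) hF hFc hF0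
  obtain ⟨Cη, hCη⟩ := hη.2.1.exists_bound_of_continuous hη.continuous
  obtain ⟨L, hL⟩ := hFc.exists_bound_of_continuous hF.continuous
  have hCη0 : 0 ≤ Cη := (norm_nonneg _).trans (hCη 0)
  refine hv.memXOn (h.critical n).isOpen D.one_lt_p.le ?_ (C := Cη * L)
    (ae_of_all _ fun x => ?_) (ae_of_all _ fun x hx => ?_)
  · refine (((integrable_norm_rpow_of_memLp D.p_pos hv.memLp).const_mul CV).mono'
      (D.aemeasurable_V.mul (hv.memLp.1.aemeasurable.norm.pow_const _)).aestronglyMeasurable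
      ?_).integrableOn
    filter_upwards [hVK, D.V_nonneg] with x hVx hV0
    by_cases hx : x ∈ K
    · have hnn : 0 ≤ ‖η x * F (U n x - u₀ x)‖ ^ p := by positivity
      rw [Pi.mul_apply, Real.norm_of_nonneg (mul_nonneg hV0 hnn)]
      exact mul_le_mul_of_nonneg_right (hVx hx) hnn
    · simp [hη.eq_zero_of_notMem hx, D.p_pos.ne']
  · rw [abs_mul]
    exact mul_le_mul (hCη x) (hL _) (abs_nonneg _) hCη0
  · rw [hη.eq_zero_of_notMem fun hxK => hx (hKΩ hxK), zero_mul]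

end TestFunction

lemma tendsto_integral_potential_term (h : IsConvergentCriticalSeq p V A g Ω U w M B u₀)
    (D : StructureConditions N p V A g α₀ μ q c α₁ α₂ a₁ a₂) {K : Set (RN N)} {CV : ℝ}
    (hVK : ∀ᵐ x, x ∈ K → V x ≤ CV) {η : RN N → ℝ} (hη : IsTestFunction K η) {F : ℝ → ℝ}
    (hF : Continuous F) (hF0 : F 0 = 0) :
    Tendsto (fun n => ∫ x, V x * |U n x| ^ (p - 2) * U n x * (η x * F (U n x - u₀ x)))
      atTop (𝓝 0) := by
  refine h.tendsto_integral_zero_of_abs_le (memLp_one_iff_integrable.1 hη.memLp) hF hF0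
    (fun n => ?_) (C := CV * M ^ (p - 1)) ?_
  · have hU := (h.critical n).aemeasurable
    exact (((D.aemeasurable_V.mul (hU.norm.pow_const _)).mul hU).mul
      (hη.continuous.aemeasurable.mul
        (hF.measurable.comp_aemeasurable (h.aemeasurable_sub n)))).aestronglyMeasurable
  · filter_upwards [hVK, D.V_nonneg, ae_all_iff.2 fun n => (h.critical n).bound] with x hVx hV0 hU n
    by_cases hx : x ∈ K
    · have hp := D.one_lt_p
      have hCV : 0 ≤ CV := hV0.trans (hVx hx)
      rw [abs_mul, abs_mul, abs_mul, abs_of_nonneg hV0,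
        abs_of_nonneg (by positivity : 0 ≤ |U n x| ^ (p - 2)), mul_assoc (V x),
        rpow_sub_two_mul_self hp (abs_nonneg _)]
      gcongr ?_ * ?_ ^ _ * _
      exacts [hVx hx, hU n]
    · simp [hη.eq_zero_of_notMem hx]

lemma tendsto_integral_g_term (h : IsConvergentCriticalSeq p V A g Ω U w M B u₀)
    (D : StructureConditions N p V A g α₀ μ q c α₁ α₂ a₁ a₂) {K : Set (RN N)} {η : RN N → ℝ}
    (hη : IsTestFunction K η) {F : ℝ → ℝ} (hF : Continuous F) (hF0 : F 0 = 0) :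
    Tendsto (fun n => ∫ x, g x (U n x) * (η x * F (U n x - u₀ x))) atTop (𝓝 0) := by
  refine h.tendsto_integral_zero_of_abs_le (memLp_one_iff_integrable.1 hη.memLp) hF hF0
    (fun n => ?_) (C := (a₁ + a₂ * M ^ (q - p)) * M ^ (p - 1)) ?_
  · exact ((D.caratheodory_g.aemeasurable_comp (h.critical n).aemeasurable).mul
      (hη.continuous.aemeasurable.mul
        (hF.measurable.comp_aemeasurable (h.aemeasurable_sub n)))).aestronglyMeasurable
  · filter_upwards [D.abs_g_le M, ae_all_iff.2 fun n => (h.critical n).bound] with x hg hU n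
    have hp := D.one_lt_p
    have ha₁ := D.a₁_nonneg
    have ha₂ := D.a₂_nonneg
    have hM : 0 ≤ M := (abs_nonneg _).trans (hU n)
    rw [abs_mul]
    gcongr
    refine (hg _ (hU n)).trans ?_
    gcongr ?_ * ?_ ^ _
    exact hU n

lemma integrable_coeff_mul_inner (h : IsConvergentCriticalSeq p V A g Ω U w M B u₀)
    (D : StructureConditions N p V A g α₀ μ q c α₁ α₂ a₁ a₂) {ψ : ℝ → ℝ} (hψ : Continuous ψ)
    {P Q : ENNReal} [P.HolderConjugate Q] {f v : RN N → RN N} (hf : MemLp f P) (hv : MemLp v Q)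
    (n : ℕ) :
    Integrable fun x => A x (U n x) * ψ (U n x - u₀ x) * (inner ℝ (f x) (v x) : ℝ) := by
  obtain ⟨C, hC⟩ := h.exists_abs_coeff_le D hψ
  exact (integrable_inner_of_memLp hf hv).bdd_mul
    (h.aemeasurable_coeff D.caratheodory_A hψ n).aestronglyMeasurable (hC n)

lemma mul_setIntegral_pGap_le (h : IsConvergentCriticalSeq p V A g Ω U w M B u₀)
    (D : StructureConditions N p V A g α₀ μ q c α₁ α₂ a₁ a₂) {K S : Set (RN N)} {CV κ : ℝ}
    (hVK : ∀ᵐ x, x ∈ K → V x ≤ CV) {η : RN N → ℝ} (hη : IsTestFunction K η) (hη0 : ∀ x, 0 ≤ η x)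
    (hS : MeasurableSet S) (hηS : ∀ x ∈ S, η x = 1) {F : ℝ → ℝ} (hF : ContDiff ℝ ∞ F)
    (hFc : HasCompactSupport F) (hF0 : F 0 = 0)
    (hκ : ∀ᵐ x, ∀ t, |t| ≤ M → |deriv (A x) t| ≤ p * κ * A x t)
    (hFκ : ∀ t, |t| ≤ 2 * M → 1 ≤ deriv F t - κ * |F t|) {n : ℕ} (hKΩ : K ⊆ Ω n) :
    α₀ * ∫ x in S, pGap p (w n x) (weakGradient univ u₀ x) ≤
      (∫ x, g x (U n x) * (η x * F (U n x - u₀ x)))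
      - (∫ x, V x * |U n x| ^ (p - 2) * U n x * (η x * F (U n x - u₀ x)))
      - (∫ x, A x (U n x) * F (U n x - u₀ x) * (inner ℝ (pField p (w n x)) (gradient η x) : ℝ))
      + (∫ x, A x (U n x) * (κ * |F (U n x - u₀ x)|)
          * (inner ℝ (pField p (w n x)) (η x • weakGradient univ u₀ x) : ℝ))
      - ∫ x, A x (U n x) * (deriv F (U n x - u₀ x) - κ * |F (U n x - u₀ x)|)
          * (inner ℝ (η x • pField p (weakGradient univ u₀ x))
              ((w n - weakGradient univ u₀) x) : ℝ) := by
  have hp := D.one_lt_p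
  have hα := D.α₀_pos
  have := holderConjugate_ofReal hp
  have hvw := h.isW0Gradient_testFunction hp.le (n := n) (hη.mono hKΩ) hF hFc hF0
  have hvX := h.memXOn_testFunction D hVK hη hF hFc hF0 hKΩ
  have hψ : Continuous fun t => κ * |F t| := hF.continuous.abs.const_mul κ
  have hdψ : Continuous fun t => deriv F t - κ * |F t| := (hF.continuous_deriv (by simp)).sub hψ
  have hpw := memLp_pField hp (h.critical n).grad.memLp_grad
  have i₁ := (h.critical n).integrable_flux_term D hvw.memLp_grad
  have i₂ := ((h.critical n).integrable_deriv_term D hvX).const_mul (1 / p)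
  have i₃ := h.integrable_coeff_mul_inner D hF.continuous hpw
    (hη.memLp_gradient (P := ENNReal.ofReal p)) n
  have i₄ := h.integrable_coeff_mul_inner D hψ hpw (hη.memLp_smul h.memLp_grad_limit) n
  have i₅ := h.integrable_coeff_mul_inner D hdψ
    (hη.memLp_smul (memLp_pField hp h.memLp_grad_limit)) (h.memLp_grad_sub n) n
  have i₁₂ := i₁.add i₂
  rw [← (h.critical n).euler_lagrange hp.le hvw hvX, add_sub_cancel_right,
    ← integral_const_mul (1 / p), ← integral_add' i₁ i₂, ← integral_sub' i₁₂ i₃,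
    ← integral_add' (i₁₂.sub i₃) i₄, ← integral_sub' ((i₁₂.sub i₃).add i₄) i₅,
    ← integral_indicator hS, ← integral_const_mul α₀]
  refine integral_mono_of_nonneg (ae_of_all _ fun x => mul_nonneg hα.le
    (indicator_nonneg (fun x _ => pGap_nonneg hp _ _) x)) (((i₁₂.sub i₃).add i₄).sub i₅) ?_
  filter_upwards [D.le_A, hκ, (h.critical n).bound, h.ae_abs_sub_le] with x hA hAt hU hz
  refine le_trans (mul_le_mul_of_nonneg_left ?_ hα.le)
    (mul_pGap_le hp hα.le (hA _) (hAt _ hU) (hFκ _ (hz n)) (hη0 x))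
  exact indicator_apply_le' (fun hx => by rw [hηS x hx, one_mul])
    fun _ => mul_nonneg (hη0 x) (pGap_nonneg hp _ _)

lemma tendsto_setIntegral_pGap (h : IsConvergentCriticalSeq p V A g Ω U w M B u₀)
    (D : StructureConditions N p V A g α₀ μ q c α₁ α₂ a₁ a₂) {R CV : ℝ} (hR : 0 < R)
    (hVloc : ∀ᵐ x, x ∈ closedBall 0 (R + 1) → V x ≤ CV)
    (hΩ : ∀ n, closedBall 0 (R + 1) ⊆ Ω n) :
    Tendsto (fun n => ∫ x in ball 0 R, pGap p (w n x) (weakGradient univ u₀ x)) atTop (𝓝 0) := by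
  have hp := D.one_lt_p
  have := D.p_pos
  have hα := D.α₀_pos
  obtain ⟨CA, hCA0, hCA⟩ := D.exists_coeff_bound M
  set κ := CA / (p * α₀) with hκ
  have hM : 0 ≤ M := by
    obtain ⟨x, hx⟩ := (h.critical 0).bound.exists
    exact (abs_nonneg _).trans hx
  obtain ⟨F, hF, hFc, hF0, hFκ⟩ := exists_exponential_test_function (κ := κ) (m := 2 * M)
    (by positivity) (by positivity)
  obtain ⟨η, hη, hη0, hηR⟩ := exists_cutoff (N := N) hR
  have hAκ : ∀ᵐ x, ∀ t, |t| ≤ M → |deriv (A x) t| ≤ p * κ * A x t := by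
    filter_upwards [hCA, D.le_A] with x hx hA t ht
    calc |deriv (A x) t| ≤ CA := (hx t ht).2
      _ = p * κ * α₀ := by rw [hκ]; field_simp
      _ ≤ p * κ * A x t := by have := hA t; gcongr
  have hψ : Continuous fun t => κ * |F t| := hF.continuous.abs.const_mul κ
  have hlim := ((((h.tendsto_integral_g_term D hη hF.continuous hF0).sub
    (h.tendsto_integral_potential_term D hVloc hη hF.continuous hF0)).sub
    (h.tendsto_integral_flux_zero D hF.continuous hF0 hη.memLp_gradient)).add
    (h.tendsto_integral_flux_zero D hψ (by simp [hF0])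
      (hη.memLp_smul h.memLp_grad_limit))).sub
    (h.tendsto_integral_coeff_mul_inner_grad_sub D ((hF.continuous_deriv (by simp)).sub hψ)
      (hη.memLp_smul (memLp_pField hp h.memLp_grad_limit)))
  simp only [sub_zero, add_zero] at hlim
  have hscaled := squeeze_zero
    (fun n => mul_nonneg hα.le (integral_nonneg fun x => pGap_nonneg hp (w n x) _))
    (fun n => h.mul_setIntegral_pGap_le D hVloc hη hη0 measurableSet_ball hηR hF hFc hF0 hAκ hFκ
      (hΩ n)) hlim
  simpa only [inv_mul_cancel_left₀ hα.ne', mul_zero] using hscaled.const_mul α₀⁻¹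

end IsConvergentCriticalSeq

end LocalCompactness

section StrongConvergence

section NormBounds

variable {α E : Type*} [MeasurableSpace α] {ν : Measure α} [NormedAddCommGroup E] {p : ℝ}
  {f : α → E}

lemma eLpNorm_le_of_integral_norm_rpow_le (hp : 0 < p) (hf : MemLp f (ENNReal.ofReal p) ν) {K : ℝ}
    (h : ∫ x, ‖f x‖ ^ p ∂ν ≤ K) :
    eLpNorm f (ENNReal.ofReal p) ν ≤ ENNReal.ofReal (K ^ (1 / p)) := by
  rw [eLpNorm_eq_ofReal_integral hp hf]
  gcongr

lemma integral_norm_rpow_le_of_eLpNorm_le (hp : 0 < p) (hf : MemLp f (ENNReal.ofReal p) ν)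
    {B : ENNReal} (hB : B ≠ ⊤) (h : eLpNorm f (ENNReal.ofReal p) ν ≤ B) :
    ∫ x, ‖f x‖ ^ p ∂ν ≤ B.toReal ^ p := by
  have hnonneg : 0 ≤ ∫ x, ‖f x‖ ^ p ∂ν := by positivity
  rw [eLpNorm_eq_ofReal_integral hp hf, ENNReal.ofReal_le_iff_le_toReal hB] at h
  calc ∫ x, ‖f x‖ ^ p ∂ν = ((∫ x, ‖f x‖ ^ p ∂ν) ^ (1 / p)) ^ p := by
        rw [← Real.rpow_mul hnonneg, one_div_mul_cancel hp.ne', Real.rpow_one]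
    _ ≤ B.toReal ^ p := by gcongr

variable [InnerProductSpace ℝ E] [FiniteDimensional ℝ E]

lemma exists_integral_norm_sub_rpow_le (hp : 1 < p) {ε : ℝ} (hε : 0 < ε) :
    ∃ C : ℝ, ∀ f g : α → E, MemLp f (ENNReal.ofReal p) ν → MemLp g (ENNReal.ofReal p) ν →
      ∫ x, ‖f x - g x‖ ^ p ∂ν ≤
        ε * ((∫ x, ‖f x‖ ^ p ∂ν) + ∫ x, ‖g x‖ ^ p ∂ν) + C * ∫ x, pGap p (f x) (g x) ∂ν := by
  obtain ⟨C, -, hC⟩ := exists_norm_sub_rpow_le (E := E) hp hε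
  refine ⟨C, fun f g hf hg => ?_⟩
  have hp0 : 0 < p := by linarith
  have hf' := integrable_norm_rpow_of_memLp hp0 hf
  have hg' := integrable_norm_rpow_of_memLp hp0 hg
  have hsum : Integrable (fun x => ε * (‖f x‖ ^ p + ‖g x‖ ^ p)) ν := (hf'.add hg').const_mul ε
  have hgap := (integrable_pGap hp hf hg).const_mul C
  rw [← integral_add hf' hg', ← integral_const_mul, ← integral_const_mul, ← integral_add hsum hgap]
  exact integral_mono (integrable_norm_rpow_of_memLp hp0 (hf.sub hg))
    (hsum.add hgap) fun x => hC (f x) (g x)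

lemma tendsto_integral_norm_sub_rpow_of_pGap (hp : 1 < p) {f : ℕ → α → E} {f₀ : α → E}
    (hf : ∀ n, MemLp (f n) (ENNReal.ofReal p) ν) (hf₀ : MemLp f₀ (ENNReal.ofReal p) ν)
    {B : ENNReal} (hB : B ≠ ⊤) (hfB : ∀ n, eLpNorm (f n) (ENNReal.ofReal p) ν ≤ B)
    (h : Tendsto (fun n => ∫ x, pGap p (f n x) (f₀ x) ∂ν) atTop (𝓝 0)) :
    Tendsto (fun n => ∫ x, ‖f n x - f₀ x‖ ^ p ∂ν) atTop (𝓝 0) := by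
  have hp0 : 0 < p := by linarith
  set K := B.toReal ^ p + ∫ x, ‖f₀ x‖ ^ p ∂ν
  have : 0 ≤ K := by positivity
  refine tendsto_order.2 ⟨fun a ha => Eventually.of_forall fun n => ha.trans_le (by positivity),
    fun ε hε => ?_⟩
  obtain ⟨C, hC⟩ := exists_integral_norm_sub_rpow_le (E := E) (ν := ν) hp
    (ε := ε / (K + 1)) (by positivity)
  have hlim : Tendsto (fun n => ε / (K + 1) * K + C * ∫ x, pGap p (f n x) (f₀ x) ∂ν) atTop
      (𝓝 (ε / (K + 1) * K)) := by
    simpa only [mul_zero, add_zero] using (h.const_mul C).const_add (ε / (K + 1) * K)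
  have hεK : ε / (K + 1) * K < ε := by
    rw [div_mul_eq_mul_div, div_lt_iff₀ (by positivity)]
    linarith
  filter_upwards [hlim.eventually (gt_mem_nhds hεK)] with n hn
  refine ((hC _ _ (hf n) hf₀).trans ?_).trans_lt hn
  gcongr
  exact add_le_add (integral_norm_rpow_le_of_eLpNorm_le hp0 (hf n) hB (hfB n)) le_rfl

end NormBounds

variable {N : ℕ} {p : ℝ} {V : RN N → ℝ} {A g : RN N → ℝ → ℝ} {α₀ μ q c α₁ α₂ a₁ a₂ : ℝ}

lemma MemWV.restrict {Ω : Set (RN N)} {u : RN N → ℝ} (h : MemWV univ V p u) : MemWV Ω V p u := by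
  obtain ⟨⟨hu, w, hw, hwp⟩, hV⟩ := h
  rw [Measure.restrict_univ] at hu hwp
  exact ⟨⟨hu.restrict Ω, w, hw.mono (subset_univ Ω), hwp.restrict Ω⟩, hV.mono_set (subset_univ Ω)⟩

lemma WeaklyConvergesWV.comp {Ω : Set (RN N)} {U : ℕ → RN N → ℝ} {u₀ : RN N → ℝ}
    (h : WeaklyConvergesWV Ω V p U u₀) {ns : ℕ → ℕ} (hns : Tendsto ns atTop atTop) :
    WeaklyConvergesWV Ω V p (fun n => U (ns n)) u₀ :=
  ⟨fun _ => h.1 _, h.2.1, fun ℓ hℓ => (h.2.2 ℓ hℓ).comp hns⟩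

namespace IsConvergentCriticalSeq

variable {Ω : ℕ → Set (RN N)} {U : ℕ → RN N → ℝ} {w : ℕ → RN N → RN N} {M : ℝ} {B : ENNReal}
  {u₀ : RN N → ℝ}

lemma tendsto_setIntegral_potential (h : IsConvergentCriticalSeq p V A g Ω U w M B u₀)
    (D : StructureConditions N p V A g α₀ μ q c α₁ α₂ a₁ a₂) {S : Set (RN N)}
    (hS : MeasurableSet S) (hSfin : volume S ≠ ⊤) {CV : ℝ} (hVS : ∀ᵐ x, x ∈ S → V x ≤ CV) :
    Tendsto (fun n => ∫ x in S, V x * |U n x - u₀ x| ^ p) atTop (𝓝 0) := by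
  have hp := D.p_pos
  rw [← integral_zero (RN N) ℝ]
  refine tendsto_integral_of_dominated_convergence (fun _ => CV * (2 * M) ^ p) (fun n => ?_)
    (integrableOn_const hSfin) (fun n => ?_) (ae_restrict_of_ae ?_)
  · exact (D.aemeasurable_V.mul
      ((h.aemeasurable_sub n).norm.pow_const p)).aestronglyMeasurable.restrict
  · rw [ae_restrict_iff' hS]
    filter_upwards [hVS, D.V_nonneg, h.ae_abs_sub_le] with x hVx hV0 hz hx
    rw [norm_mul, Real.norm_of_nonneg hV0, Real.norm_of_nonneg (by positivity)]
    have hCV : 0 ≤ CV := hV0.trans (hVx hx)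
    gcongr
    exacts [hVx hx, hz n]
  · filter_upwards [h.ae_tendsto_comp_sub (continuous_abs.rpow_const fun _ => Or.inr hp.le)]
      with x hx
    simpa only [abs_zero, Real.zero_rpow hp.ne', mul_zero] using hx.const_mul (V x)

lemma normV_sub_eq (h : IsConvergentCriticalSeq p V A g Ω U w M B u₀) (hp : 1 ≤ p)
    {S : Set (RN N)} (hS : IsOpen S) (n : ℕ) :
    normV S V p (U n - u₀) = ((∫ x in S, ‖w n x - weakGradient univ u₀ x‖ ^ p)
      + ∫ x in S, V x * |U n x - u₀ x| ^ p) ^ (1 / p) := by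
  have hgrad := ((h.isWeakGradient_sub hp n).mono (subset_univ S)).weakGradient_ae_eq hS
  rw [normV]
  congr 2
  refine integral_congr_ae (hgrad.mono fun x hx => ?_)
  simp only [hx, Pi.sub_apply]

lemma tendsto_normV_ball (h : IsConvergentCriticalSeq p V A g Ω U w M B u₀)
    (D : StructureConditions N p V A g α₀ μ q c α₁ α₂ a₁ a₂) {R CV : ℝ} (hR : 0 < R)
    (hVloc : ∀ᵐ x, x ∈ closedBall 0 (R + 1) → V x ≤ CV)
    (hΩ : ∀ n, closedBall 0 (R + 1) ⊆ Ω n) :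
    Tendsto (fun n => normV (ball 0 R) V p (U n - u₀)) atTop (𝓝 0) := by
  have hp := D.one_lt_p
  have := D.p_pos
  have hgrad := tendsto_integral_norm_sub_rpow_of_pGap hp
    (fun n => (h.critical n).grad.memLp_grad.restrict (ball 0 R)) (h.memLp_grad_limit.restrict _)
    h.bound_ne_top (fun n => (eLpNorm_restrict_le _ _ _ _).trans (h.eLpNorm_grad_le n))
    (h.tendsto_setIntegral_pGap D hR hVloc hΩ)
  have hpot := h.tendsto_setIntegral_potential D measurableSet_ball
    (measure_ball_lt_top (x := 0) (r := R)).ne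
    (hVloc.mono fun x hx hxR => hx (ball_subset_closedBall.trans
      (closedBall_subset_closedBall (by linarith)) hxR))
  have hlim := (hgrad.add hpot).rpow_const (p := 1 / p) (Or.inr (by positivity))
  rw [add_zero, Real.zero_rpow (by positivity)] at hlim
  simpa only [h.normV_sub_eq hp.le isOpen_ball] using hlim

end IsConvergentCriticalSeq

section UniformBounds

variable {Ω : Set (RN N)} {u : RN N → ℝ} {w : RN N → RN N} {m E : ℝ}

lemma IsCriticalOn.eLpNorm_grad_le (hu : IsCriticalOn Ω p V A g u w m)
    (D : StructureConditions N p V A g α₀ μ q c α₁ α₂ a₁ a₂) (hE : energy p V A g u ≤ E) :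
    eLpNorm w (ENNReal.ofReal p) ≤ ENNReal.ofReal ((p * μ * E / (α₁ * α₀)) ^ (1 / p)) := by
  have hp := D.p_pos
  have hμ : 0 < μ := hp.trans D.p_lt_μ
  have hα := mul_pos D.α₁_pos D.α₀_pos
  refine eLpNorm_le_of_integral_norm_rpow_le hp hu.grad.memLp_grad ?_
  rw [le_div_iff₀' hα]
  have hpot : 0 ≤ (μ - p) * ∫ x, V x * |u x| ^ p := by
    refine mul_nonneg (sub_nonneg.2 D.p_lt_μ.le) (integral_nonneg_of_ae ?_)
    filter_upwards [D.V_nonneg] with x hx using mul_nonneg hx (by positivity)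
  calc α₁ * α₀ * ∫ x, ‖w x‖ ^ p ≤ p * μ * energy p V A g u := by linarith [hu.energy_bound D]
    _ ≤ p * μ * E := by gcongr

lemma IsCriticalOn.eLpNorm_le (hu : IsCriticalOn Ω p V A g u w m)
    (D : StructureConditions N p V A g α₀ μ q c α₁ α₂ a₁ a₂) (hE : energy p V A g u ≤ E) :
    eLpNorm u (ENNReal.ofReal p) ≤ ENNReal.ofReal ((p * μ * E / ((μ - p) * c)) ^ (1 / p)) := by
  have hp := D.p_pos
  have hμ : 0 < μ := hp.trans D.p_lt_μ
  have hμp := sub_pos.2 D.p_lt_μ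
  refine eLpNorm_le_of_integral_norm_rpow_le hp hu.grad.memLp ?_
  rw [le_div_iff₀' (mul_pos hμp D.c_pos)]
  have hcV : c * ∫ x, ‖u x‖ ^ p ≤ ∫ x, V x * |u x| ^ p := by
    rw [← integral_const_mul]
    refine integral_mono_ae ((integrable_norm_rpow_of_memLp hp hu.grad.memLp).const_mul c)
      (hu.integrable_potential hp.ne') ?_
    filter_upwards [D.le_V] with x hx using mul_le_mul_of_nonneg_right hx (by positivity)
  have hgrad : 0 ≤ α₁ * α₀ * ∫ x, ‖w x‖ ^ p :=
    mul_nonneg (mul_pos D.α₁_pos D.α₀_pos).le (by positivity)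
  calc (μ - p) * c * ∫ x, ‖u x‖ ^ p = (μ - p) * (c * ∫ x, ‖u x‖ ^ p) := mul_assoc _ _ _
    _ ≤ (μ - p) * ∫ x, V x * |u x| ^ p := by gcongr
    _ ≤ p * μ * energy p V A g u := by linarith [hu.energy_bound D]
    _ ≤ p * μ * E := by gcongr

lemma exists_uniform_bounds (hN : 2 ≤ N)
    (D : StructureConditions N p V A g α₀ μ q c α₁ α₂ a₁ a₂)
    (hq : (q : EReal) < criticalExponent N p) (E : ℝ) :
    ∃ (B : ENNReal) (M : ℝ), B ≠ ⊤ ∧ ∀ (Ω : Set (RN N)), volume Ω ≠ ⊤ →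
      ∀ (u : RN N → ℝ) (w : RN N → RN N) (m : ℝ), IsCriticalOn Ω p V A g u w m →
        energy p V A g u ≤ E →
        eLpNorm u (ENNReal.ofReal p) ≤ B ∧ eLpNorm w (ENNReal.ofReal p) ≤ B ∧
          IsCriticalOn Ω p V A g u w M := by
  set B := max (ENNReal.ofReal ((p * μ * E / ((μ - p) * c)) ^ (1 / p)))
    (ENNReal.ofReal ((p * μ * E / (α₁ * α₀)) ^ (1 / p)))
  have hB : B ≠ ⊤ := (max_lt ENNReal.ofReal_lt_top ENNReal.ofReal_lt_top).ne
  obtain ⟨M, hM⟩ := exists_bound_of_energy_inequality hN D.one_lt_p.le (D.p_pos.trans_le D.p_le_q)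
    hq (C := ENNReal.ofReal ((a₁ + a₂) / (min 1 (α₂ / p) * α₀))) ENNReal.ofReal_ne_top hB
  refine ⟨B, M, hB, fun Ω hΩ u w m hu hE => ?_⟩
  have huB : eLpNorm u (ENNReal.ofReal p) ≤ B :=
    (hu.eLpNorm_le D hE).trans (le_max_left _ _)
  have hwB : eLpNorm w (ENNReal.ofReal p) ≤ B :=
    (hu.eLpNorm_grad_le D hE).trans (le_max_right _ _)
  exact ⟨huB, hwB, { hu with
    bound := hM Ω hΩ u w hu.grad huB hwB fun _ _ hh hhk => hu.level_energy D hh hhk }⟩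

end UniformBounds

end StrongConvergence

end QuasilinearSchrodinger

theorem proposition6p7_general {N : ℕ} (hN : 2 ≤ N) {p : ℝ} {V : RN N → ℝ} {A g : RN N → ℝ → ℝ}
    {α₀ μ q c α₁ α₂ a₁ a₂ : ℝ} (D : StructureConditions N p V A g α₀ μ q c α₁ α₂ a₁ a₂)
    (hq : (q : EReal) < criticalExponent N p)
    (hVloc : ∀ ρ : ℝ, 0 < ρ → ∃ C : ℝ, ∀ᵐ x : RN N, ‖x‖ ≤ ρ → V x ≤ C)
    {Ω : ℕ → Set (RN N)} (hΩ : ∀ n, IsOpen (Ω n)) (hΩfin : ∀ n, volume (Ω n) ≠ ⊤)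
    (hΩlim : ∀ ρ : ℝ, ∀ᶠ n in atTop, closedBall 0 ρ ⊆ Ω n)
    {u : ℕ → RN N → ℝ} (hu : ∀ n, MemXOn (Ω n) V p (u n)) {E : ℝ}
    (hE : ∀ n, energy p V A g (u n) ≤ E)
    (hcrit : ∀ n v, MemXOn (Ω n) V p v → energyDifferential p V A g (u n) v = 0)
    {uInf : RN N → ℝ} (hweak : WeaklyConvergesWV univ V p u uInf) {R : ℝ} (hR : 0 < R) :
    StronglyConvergesWV (ball 0 R) V p u uInf := by
  have hp := D.one_lt_p.le
  obtain ⟨B, M, hB, hBM⟩ := exists_uniform_bounds hN D hq E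
  have hbounds : ∀ n, ∃ w, eLpNorm (u n) (ENNReal.ofReal p) ≤ B ∧
      eLpNorm w (ENNReal.ofReal p) ≤ B ∧ IsCriticalOn (Ω n) p V A g (u n) w M := fun n => by
    obtain ⟨w, hw⟩ := (hu n).exists_isW0Gradient (hΩ n) hp
    obtain ⟨m, hm⟩ := (hu n).exists_bound (hΩ n).measurableSet
    exact ⟨w, hBM _ (hΩfin n) _ w m ⟨hΩ n, hu n, hw, hm, hcrit n⟩ (hE n)⟩
  choose w huB hwB hcrit using hbounds
  obtain ⟨CV, hCV⟩ := hVloc (R + 1) (by linarith)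
  refine ⟨fun n => (hweak.1 n).restrict, hweak.2.1.restrict,
    tendsto_of_subseq_tendsto fun ns hns => ?_⟩
  obtain ⟨ms, hms, hae⟩ := (hweak.comp hns).exists_subseq_tendsto_ae hp D.c_pos D.le_V hB
    (fun n => huB _) fun n => by
      rw [eLpNorm_congr_ae ((hcrit (ns n)).weakGradient_ae_eq hp)]
      exact hwB _
  obtain ⟨n₀, hn₀⟩ := eventually_atTop.1
    ((hns.comp hms.tendsto_atTop).eventually (hΩlim (R + 1)))
  have hshift : Tendsto (· + n₀) atTop atTop := tendsto_add_atTop_nat n₀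
  have hseq : IsConvergentCriticalSeq p V A g _ (fun n => u (ns (ms (n + n₀)))) _ M B uInf :=
    ⟨fun n => hcrit _, hB, fun n => hwB _, hweak.comp (hns.comp (hms.tendsto_atTop.comp hshift)),
      hae.mono fun x hx => hx.comp hshift⟩
  exact ⟨fun n => ms (n + n₀), hseq.tendsto_normV_ball D hR
    (hCV.mono fun x hx hxR => hx (mem_closedBall_zero_iff.1 hxR))
    fun n => hn₀ (n + n₀) (Nat.le_add_left _ _)⟩

theorem proposition6p7 (N : ℕ) (hN : 2 ≤ N) (p : ℝ) (hp : 1 < p)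
    (V : RN N → ℝ) (A g : RN N → ℝ → ℝ)
    -- the potential `V`
    (hV : AEMeasurable V volume)
    (hV1 : ∃ c : ℝ, 0 < c ∧ ∀ᵐ x : RN N, c ≤ V x)
    (hV2 : Tendsto (fun x : RN N => ∫ y in ball x 1, 1 / V y) (cocompact (RN N)) (𝓝 0))
    (hV3 : ∀ ρ : ℝ, 0 < ρ → ∃ C : ℝ, 0 < C ∧ ∀ᵐ x : RN N, ‖x‖ ≤ ρ → V x ≤ C)
    -- the coefficient `A`, with `A_t(x,t) = deriv (A x) t`
    (h0 : IsCaratheodory 1 A)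
    (h1 : ∀ ρ : ℝ, 0 < ρ → ∃ C : ℝ, ∀ᵐ x : RN N, ∀ t : ℝ, |t| ≤ ρ →
      |A x t| ≤ C ∧ |deriv (A x) t| ≤ C)
    (α₀ : ℝ) (hα₀ : 0 < α₀)
    (h2 : ∀ᵐ x : RN N, ∀ t : ℝ, α₀ ≤ A x t)
    (μ : ℝ) (hμ : p < μ)
    (h3 : ∃ α₁ : ℝ, 0 < α₁ ∧ ∀ᵐ x : RN N, ∀ t : ℝ,
      α₁ * A x t ≤ (μ - p) * A x t - deriv (A x) t * t)
    (h4 : ∃ α₂ : ℝ, 0 < α₂ ∧ ∀ᵐ x : RN N, ∀ t : ℝ,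
      α₂ * A x t ≤ p * A x t + deriv (A x) t * t)
    -- the nonlinearity `g`
    (g0 : IsCaratheodory 0 g)
    (q : ℝ) (hpq : p ≤ q) (hq : (q : EReal) < criticalExponent N p)
    (g1 : ∃ a₁ a₂ : ℝ, 0 < a₁ ∧ 0 < a₂ ∧ ∀ᵐ x : RN N, ∀ t : ℝ,
      |g x t| ≤ a₁ * |t| ^ (p - 1) + a₂ * |t| ^ (q - 1))
    (g2 : ∃ α : ℝ, α < α₀ / embeddingConstant V p ^ p ∧ ∀ ε : ℝ, 0 < ε → ∃ δ : ℝ, 0 < δ ∧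
      ∀ᵐ x : RN N, ∀ t : ℝ, 0 < |t| → |t| < δ → |g x t / (|t| ^ (p - 2) * t) - α| < ε)
    (g3 : ∀ᵐ x : RN N, ∀ t : ℝ, t ≠ 0 →
      0 < μ * (∫ s in (0 : ℝ)..t, g x s) ∧ μ * (∫ s in (0 : ℝ)..t, g x s) ≤ g x t * t)
    -- the sequence of critical points on the balls `B_k`, `k = 1, 2, …`
    (αLow αHigh : ℝ) (u : ℕ+ → RN N → ℝ)
    (hu_ball : ∀ k : ℕ+, MemXOn (ball 0 ((k : ℕ) : ℝ)) V p (u k))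
    (hu_level : ∀ k, αLow ≤ energy p V A g (u k) ∧ energy p V A g (u k) ≤ αHigh)
    (hu_crit : ∀ k : ℕ+, ∀ v : RN N → ℝ, MemXOn (ball 0 ((k : ℕ) : ℝ)) V p v →
      energyDifferential p V A g (u k) v = 0)
    -- its weak limit, along the whole sequence or along a subsequence
    (σ : ℕ → ℕ+) (hσ : StrictMono σ) (uInf : RN N → ℝ)
    (hu_weak : WeaklyConvergesWV univ V p (fun n => u (σ n)) uInf) :
    ∀ R : ℝ, 1 ≤ R →
      StronglyConvergesWV (ball (0 : RN N) R) V p (fun n => u (σ n)) uInf := by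
  obtain ⟨c, hc, hcV⟩ := hV1
  obtain ⟨α₁, hα₁, h3⟩ := h3
  obtain ⟨α₂, hα₂, h4⟩ := h4
  obtain ⟨a₁, a₂, ha₁, ha₂, g1⟩ := g1
  have hAR : ∀ᵐ x : RN N, ∀ t : ℝ, 0 ≤ μ * (∫ s in (0 : ℝ)..t, g x s) ∧
      μ * (∫ s in (0 : ℝ)..t, g x s) ≤ g x t * t := g3.mono fun x hx t => by
    rcases eq_or_ne t 0 with rfl | ht
    · simp
    · exact ⟨(hx t ht).1.le, (hx t ht).2⟩
  have hσlim : Tendsto (fun n => ((σ n : ℕ) : ℝ)) atTop atTop :=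
    tendsto_natCast_atTop_atTop.comp (StrictMono.tendsto_atTop (φ := fun n => (σ n : ℕ)) hσ)
  exact fun R hR => proposition6p7_general hN
    ⟨hp, hV, hc, hcV, h0, h1, hα₀, h2, hμ, hα₁, h3, hα₂, h4, g0, hpq, ha₁.le, ha₂.le, g1, hAR⟩ hq
    (fun ρ hρ => (hV3 ρ hρ).imp fun _ h => h.2) (fun _ => isOpen_ball)
    (fun _ => measure_ball_lt_top.ne)
    (fun ρ => (hσlim.eventually_gt_atTop ρ).mono fun _ => closedBall_subset_ball)
    (fun n => hu_ball (σ n)) (fun n => (hu_level (σ n)).2) (fun n => hu_crit (σ n)) hu_weak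
    (zero_lt_one.trans_le hR)
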